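/- Let $x(t)\in t\,\mathbf{Q}[[t]]$ and let $U\subset\mathbf{C}$ be open. A nonzero linear differential operator $L=\sum_{i=0}^n a_i(x)\,(d/dx)^i$ with $a_i\in\overline{\mathbf{Q}}(x)$, $a_n\neq 0$, has a singular point at $\alpha\in\mathbf{C}$ if some $a_i/a_n$ has a pole at $\alpha$; it has trivial local monodromy around $\alpha$ if there are $n$ functions, meromorphic in a neighbourhood of $\alpha$, that form a $\mathbf{C}$-basis of the solutions of $L(g)=0$ on small punctured neighbourhoods of $\alpha$. Let $\mathcal{H}(U,x(t),\mathbf{Z})$ be the set of all $f(x)\in\mathbf{Q}[[x]]$ with $f(x(t))\in\mathbf{Z}[[t]]$ that satisfy $L(f)=0$ for some such $L$ having trivial local monodromy around all of its singular points in $U$. Let $\mathcal{V}(U,x(t),\mathbf{Z})\subset\mathbf{Q}((x))$ be its $\mathbf{Q}(x)$-linear span, put $\mathcal{V}(U,\mathbf{Z}):=\mathcal{V}(U,t,\mathbf{Z})$, and for $p\in\mathbf{Q}(x)$ let $\mathcal{V}_p(U,x(t),\mathbf{Z})\subset\mathbf{Q}((x))$ be the $\mathbf{Q}(p(x))$-linear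 span of $\mathcal{H}(U,x(t),\mathbf{Z})$. **Corollary 2.3.** Let $U\subset\mathbf{C}$ be open with $0\in U$. (1) Suppose that the uniformization radius of $(U,0)$ is strictly greater than $1$; this is the radius $R\in(0,\infty]$ for which there is a holomorphic universal covering map $F$ from $\{|z|<R\}$ onto the connected component of $0$ in $U$ with $F(0)=0$ and $|F'(0)|=1$. Then $\mathcal{V}(U,\mathbf{Z})$ is finite dimensional over $\mathbf{Q}(x)$. (2) Let $p(x)\in\mathbf{Q}(x)\setminus\mathbf{Q}$ have no poles in $U$, let $\varphi$ be a function holomorphic on a neighbourhood of $\overline{D(0,1)}$ with $\varphi(\overline{D(0,1)})\subset U$, $\varphi(0)=0$ and $|\varphi'(0)|>1$, and let $x(t)\in t+t^2\mathbf{Q}[[t]]$ be such that $p(x(t))\in\mathbf{Z}[[t]]$. Then $\mathcal{V}_p(U,x(t),\mathbf{Z})$ is finite dimensional over $\mathbf{Q}(p(x))$ and $$\dim_{\mathbf{Q}(p(x))}\mathcal{V}_p(U,x(t),\mathbf{Z})\le e\cdot\frac{\int_{\mathbf{T}}\log^+|p\circ\varphi|\,\mu_{\mathrm{Haar}}}{\log|\varphi'(0)|},$$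 where $\mathbf{T}$ is the unit circle with its normalized Haar measure $\mu_{\mathrm{Haar}}$. If moreover $M\,x(t)\in\mathbf{Z}[[t]]$ for some nonzero $M\in\mathbf{Q}$ (for example if $x(t)=t$), then $\mathcal{V}(U,x(t),\mathbf{Z})$ is also finite dimensional over $\mathbf{Q}(p(x))$ and its dimension satisfies the same bound. -/

import Mathlib

open scoped ENNReal PowerSeries LaurentSeries RatFunc

noncomputable section

namespace Holonomy

/-- The field of algebraic numbers, as a subfield of `ℂ`. -/
abbrev Qbar : Type := algebraicClosure ℚ ℂ

/-- A nonzero linear differential operator `L = ∑_{i ≤ order} coeff i · (d/dx)^i` over `ℚ̄(x)`,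
written with its nonzero leading coefficient. -/
structure DiffOp where
  order : ℕ
  coeff : Fin (order + 1) → RatFunc Qbar
  lead_ne_zero : coeff (Fin.last order) ≠ 0

namespace DiffOp

/-- `L(f)` for a formal power series `f`. The coefficients of `L` are expanded at `x = 0`, where
they may have poles, so `L(f)` is a formal Laurent series. -/
def applyFormal (L : DiffOp) (f : Qbar⟦X⟧) : Qbar⸨X⸩ :=
  ∑ i, algebraMap (RatFunc Qbar) Qbar⸨X⸩ (L.coeff i) *
    (((PowerSeries.derivative Qbar)^[(i : ℕ)] f : Qbar⟦X⟧) : Qbar⸨X⸩)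

/-- The value of `L(g)` at a point `z` which is not a pole of a coefficient of `L`. -/
def applyAt (L : DiffOp) (g : ℂ → ℂ) (z : ℂ) : ℂ :=
  ∑ i, (L.coeff i).eval (algebraMap Qbar ℂ) z * iteratedDeriv (i : ℕ) g z

/-- `α` is a singular point of `L`: after division by the leading coefficient, some coefficient of
`L` has a pole at `α`. -/
def IsSingularPoint (L : DiffOp) (α : ℂ) : Prop :=
  ∃ i, Polynomial.aeval α (L.coeff i / L.coeff (Fin.last L.order)).denom = 0

/-- `h` is a holomorphic solution of `L` on some punctured neighbourhood of `α`. -/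
def IsSolutionNear (L : DiffOp) (α : ℂ) (h : ℂ → ℂ) : Prop :=
  ∀ᶠ z in nhdsWithin α {α}ᶜ, AnalyticAt ℂ h z ∧ L.applyAt h z = 0

/-- Trivial local monodromy of `L` around `α`: there are functions `g₁, …, gₙ`, `n` the order
of `L`, meromorphic at `α`, which form a `ℂ`-basis of the solutions of `L` on small punctured
neighbourhoods of `α`. -/
def TrivialMonodromyAt (L : DiffOp) (α : ℂ) : Prop :=
  ∃ g : Fin L.order → ℂ → ℂ,
    (∀ j, MeromorphicAt (g j) α) ∧
    (∀ j, L.IsSolutionNear α (g j)) ∧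
    (∀ c : Fin L.order → ℂ,
      (∀ᶠ z in nhdsWithin α {α}ᶜ, ∑ j, c j * g j z = 0) → ∀ j, c j = 0) ∧
    (∀ h : ℂ → ℂ, L.IsSolutionNear α h →
      ∃ c : Fin L.order → ℂ, ∀ᶠ z in nhdsWithin α {α}ᶜ, h z = ∑ j, c j * g j z)

end DiffOp

/-- A power series over `ℚ` all of whose coefficients are integers. -/
def IsIntegralSeries (f : ℚ⟦X⟧) : Prop :=
  ∀ n, ∃ m : ℤ, PowerSeries.coeff n f = m

/-- `𝓗(U, x(t), ℤ)`: the series `f(x) ∈ ℚ⟦x⟧` with `f(x(t)) ∈ ℤ⟦t⟧` that are annihilated by a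
nonzero linear differential operator over `ℚ̄(x)` having trivial local monodromy around all of its
singular points in `U`. (It is meant for `x(t) ∈ tℚ⟦t⟧`, for which the substitution makes sense.) -/
def H (U : Set ℂ) (x : ℚ⟦X⟧) : Set ℚ⟦X⟧ :=
  {f | IsIntegralSeries (f.subst x) ∧
    ∃ L : DiffOp, L.applyFormal (f.map (algebraMap ℚ Qbar)) = 0 ∧
      ∀ α ∈ U, L.IsSingularPoint α → L.TrivialMonodromyAt α}

/-- `𝓥(U, x(t), ℤ)`: the `ℚ(x)`-span of `𝓗(U, x(t), ℤ)` in `ℚ((x))`. -/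
def V (U : Set ℂ) (x : ℚ⟦X⟧) : Submodule (RatFunc ℚ) ℚ⸨X⸩ :=
  Submodule.span (RatFunc ℚ) ((fun f : ℚ⟦X⟧ => (f : ℚ⸨X⸩)) '' H U x)

/-- The subfield `ℚ(p(x))` of `ℚ(x)`. -/
abbrev Qp (p : RatFunc ℚ) : IntermediateField ℚ (RatFunc ℚ) :=
  IntermediateField.adjoin ℚ {p}

/-- The `ℚ(p(x))`-span of `𝓗(U, x(t), ℤ)` in `ℚ((x))`. -/
def Vp (p : RatFunc ℚ) (U : Set ℂ) (x : ℚ⟦X⟧) : Submodule (Qp p) ℚ⸨X⸩ :=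
  Submodule.span (Qp p) ((fun f : ℚ⟦X⟧ => (f : ℚ⸨X⸩)) '' H U x)

/-- `p(x(t))`, for a rational function `p` without pole at `0` and `x(t) ∈ tℚ⟦t⟧`: the denominator
`(p.denom)(x(t))` is then a unit of `ℚ⟦t⟧`. -/
def pullback (p : RatFunc ℚ) (x : ℚ⟦X⟧) : ℚ⟦X⟧ :=
  Polynomial.aeval x p.num * (Polynomial.aeval x p.denom)⁻¹

/-- `F` restricts to a holomorphic universal covering of the connected component of `a` in `U` by
the (simply connected) disc `|z| < R`, `0 < R ≤ ∞`, normalised by `F(0) = a` and `|F'(0)| = 1`. -/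
def IsUniformization (U : Set ℂ) (a : ℂ) (R : ℝ≥0∞) (F : ℂ → ℂ) : Prop :=
  0 < R ∧ DifferentiableOn ℂ F (Metric.eball 0 R) ∧ F 0 = a ∧ ‖deriv F 0‖ = 1 ∧
    ∃ h : Set.MapsTo F (Metric.eball 0 R) (connectedComponentIn U a),
      Function.Surjective h.restrict ∧ IsCoveringMap h.restrict

/-- The uniformization radius of `(U, a)`: the radius `R` (unique by the Schwarz lemma and
Liouville's theorem) of the disc in a normalised universal covering; `∞` if the universal covering
is the whole plane. -/
def uniformizationRadius (U : Set ℂ) (a : ℂ) : ℝ≥0∞ :=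
  sSup {R | ∃ F, IsUniformization U a R F}

/-- The number `e · ∫_𝕋 log⁺ |p ∘ φ| dμ / log |φ'(0)|`, `μ` the normalised Haar measure of the unit
circle `𝕋`. -/
def holonomyBound (p : RatFunc ℚ) (φ : ℂ → ℂ) : ℝ :=
  Real.exp 1 *
    Real.circleAverage (fun z => Real.posLog ‖p.eval (algebraMap ℚ ℂ) (φ z)‖) 0 1 /
    Real.log ‖deriv φ 0‖

end Holonomy

end

/-!
Let `f ∈ 𝓗(U, x(t), ℤ)` be annihilated by `L`. Near every point of `U` the solutions of `L` have a
basis of meromorphic functions. At `0` this basis spans the formal solutions too, since a linear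
differential equation of order `n` has at most `n` of them which are independent over the constants;
hence `f` converges. Continuing solutions over growing discs shows that `f ∘ φ` is meromorphic on
the closed unit disc, with poles removed by a polynomial in `φ`.

Let `f₁, …, f_m` be such series, linearly independent over `ℚ(p)`. Among the combinations, with
small integer coefficients, of the products `∏ j, p(x_j) ^ k_j * f_{i_j}(x_j)` in `d` variables,
with `k_j < D`, the box principle finds a nonzero one whose coefficients of degree less than `A` are
smaller than `1`, where `A` is close to `m * d * D / e`; the `e` comes from the volume `1 / d!` of
the `d`-dimensional simplex. Substituting `x_j = x(t_j)` shows that its coefficients of lowest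
degree are integers, so that it vanishes to order at least `A`. Substituting `x_j = φ(z_j)` and
damping by `exp (-D * ∑ j, q(z_j))`, where `q` is a polynomial whose real part majorizes
`log⁺ |p ∘ φ|` on the circle and at `0` is close to its mean, bounds these coefficients times
`|φ'(0)| ^ A` by Cauchy's inequality. In the limit `D → ∞`, `d → ∞` this gives
`m * log |φ'(0)| ≤ e * ∫ log⁺ |p ∘ φ|`.
-/

namespace Holonomy

open Filter Topology Polynomial

section Taylor

variable {𝕜 : Type*} [NontriviallyNormedField 𝕜]

/-- The Taylor series `∑ f⁽ⁿ⁾(α) / n! Xⁿ` of `f` at `α`, as a formal power series. The coefficients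
are junk unless `f` is analytic at `α`. -/
noncomputable def taylor (f : 𝕜 → 𝕜) (α : 𝕜) : 𝕜⟦X⟧ :=
  PowerSeries.mk fun n => iteratedDeriv n f α / (n.factorial : 𝕜)

lemma coeff_taylor (f : 𝕜 → 𝕜) (α : 𝕜) (n : ℕ) :
    PowerSeries.coeff n (taylor f α) = iteratedDeriv n f α / (n.factorial : 𝕜) :=
  PowerSeries.coeff_mk _ _

lemma constantCoeff_taylor (f : 𝕜 → 𝕜) (α : 𝕜) :
    PowerSeries.constantCoeff (taylor f α) = f α := by
  simp [← PowerSeries.coeff_zero_eq_constantCoeff_apply, coeff_taylor]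

lemma taylor_congr {f g : 𝕜 → 𝕜} {α : 𝕜} (h : f =ᶠ[𝓝 α] g) : taylor f α = taylor g α := by
  ext n
  rw [coeff_taylor, coeff_taylor, (h.iteratedDeriv n).eq_of_nhds]

lemma taylor_const_mul (c : 𝕜) (f : 𝕜 → 𝕜) (α : 𝕜) :
    taylor (fun z => c * f z) α = c • taylor f α := by
  ext n
  rw [map_smul, coeff_taylor, coeff_taylor, iteratedDeriv_const_mul_field, smul_eq_mul,
    mul_div_assoc]

lemma taylor_const (c α : 𝕜) : taylor (fun _ => c) α = PowerSeries.C c := by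
  ext n
  rw [coeff_taylor, iteratedDeriv_const, PowerSeries.coeff_C]
  split_ifs with h <;> simp [h]

lemma taylor_sub_self (α : 𝕜) : taylor (fun z => z - α) α = PowerSeries.X := by
  ext n
  rw [coeff_taylor, PowerSeries.coeff_X]
  rcases n with _ | _ | n
  · simp
  · simp [iteratedDeriv_one]
  · have hderiv : deriv (fun z : 𝕜 => z - α) = fun _ => 1 := by
      ext z
      simp
    rw [iteratedDeriv_succ', hderiv, iteratedDeriv_const]
    simp

lemma taylor_id_zero : taylor (fun z : 𝕜 => z) 0 = PowerSeries.X := by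
  simpa using taylor_sub_self (0 : 𝕜)

section CharZero

variable [CharZero 𝕜]

lemma taylor_deriv (f : 𝕜 → 𝕜) (α : 𝕜) :
    taylor (deriv f) α = PowerSeries.derivative 𝕜 (taylor f α) := by
  ext n
  rw [PowerSeries.coeff_derivative, coeff_taylor, coeff_taylor, ← iteratedDeriv_succ',
    Nat.factorial_succ]
  have hn : (n.factorial : 𝕜) ≠ 0 := Nat.cast_ne_zero.mpr n.factorial_ne_zero
  have hn' : (n : 𝕜) + 1 ≠ 0 := n.cast_add_one_ne_zero
  push_cast
  field_simp

end CharZero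

section CompleteSpace

variable [CompleteSpace 𝕜]

lemma taylor_add {f g : 𝕜 → 𝕜} {α : 𝕜} (hf : AnalyticAt 𝕜 f α) (hg : AnalyticAt 𝕜 g α) :
    taylor (fun z => f z + g z) α = taylor f α + taylor g α := by
  ext n
  rw [map_add, coeff_taylor, coeff_taylor, coeff_taylor,
    iteratedDeriv_fun_add hf.contDiffAt hg.contDiffAt, add_div]

lemma taylor_sum {ι : Type*} (s : Finset ι) {f : ι → 𝕜 → 𝕜} {α : 𝕜}
    (hf : ∀ i ∈ s, AnalyticAt 𝕜 (f i) α) :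
    taylor (fun z => ∑ i ∈ s, f i z) α = ∑ i ∈ s, taylor (f i) α := by
  ext n
  rw [map_sum, coeff_taylor, iteratedDeriv_fun_sum fun i hi => (hf i hi).contDiffAt,
    Finset.sum_div]
  simp only [coeff_taylor]

variable [CharZero 𝕜]

lemma taylor_mul {f g : 𝕜 → 𝕜} {α : 𝕜} (hf : AnalyticAt 𝕜 f α) (hg : AnalyticAt 𝕜 g α) :
    taylor (fun z => f z * g z) α = taylor f α * taylor g α := by
  ext n
  rw [PowerSeries.coeff_mul, coeff_taylor, iteratedDeriv_fun_mul hf.contDiffAt hg.contDiffAt,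
    Finset.Nat.sum_antidiagonal_eq_sum_range_succ_mk, Finset.sum_div]
  refine Finset.sum_congr rfl fun i hi => ?_
  have hfac (m : ℕ) : (m.factorial : 𝕜) ≠ 0 := Nat.cast_ne_zero.mpr m.factorial_ne_zero
  have h₁ := hfac n
  have h₂ := hfac i
  have h₃ := hfac (n - i)
  rw [coeff_taylor, coeff_taylor, Nat.cast_choose 𝕜 (Finset.mem_range_succ_iff.mp hi)]
  field_simp

lemma taylor_pow {f : 𝕜 → 𝕜} {α : 𝕜} (hf : AnalyticAt 𝕜 f α) (k : ℕ) :
    taylor (fun z => f z ^ k) α = taylor f α ^ k := by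
  induction k with
  | zero => simpa using taylor_const 1 α
  | succ k ih =>
    simp only [pow_succ]
    rw [taylor_mul (hf.fun_pow k) hf, ih]

lemma eventually_eq_zero_of_taylor_eq_zero {f : 𝕜 → 𝕜} {α : 𝕜} (hf : AnalyticAt 𝕜 f α)
    (h : taylor f α = 0) : ∀ᶠ z in 𝓝 α, f z = 0 := by
  rw [← analyticOrderAt_eq_top, ENat.eq_top_iff_forall_ge]
  intro n
  rw [natCast_le_analyticOrderAt_iff_iteratedDeriv_eq_zero hf]
  intro i _
  have hi := congrArg (PowerSeries.coeff i) h
  rw [coeff_taylor, map_zero, div_eq_zero_iff] at hi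
  exact hi.resolve_right (Nat.cast_ne_zero.mpr i.factorial_ne_zero)

lemma eventuallyEq_of_taylor_eq {f g : 𝕜 → 𝕜} {α : 𝕜} (hf : AnalyticAt 𝕜 f α)
    (hg : AnalyticAt 𝕜 g α) (h : taylor f α = taylor g α) : f =ᶠ[𝓝 α] g := by
  have hneg : AnalyticAt 𝕜 (fun z => -1 * g z) α := analyticAt_const.fun_mul hg
  have hsub : taylor (fun z => f z + -1 * g z) α = 0 := by
    rw [taylor_add hf hneg, taylor_const_mul, h, neg_one_smul, add_neg_cancel]
  filter_upwards [eventually_eq_zero_of_taylor_eq_zero (hf.fun_add hneg) hsub] with z hz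
  linear_combination hz

lemma taylor_polynomial_zero (P : 𝕜[X]) : taylor (fun z => P.eval z) 0 = (P : 𝕜⟦X⟧) := by
  induction P using Polynomial.induction_on' with
  | add p q hp hq =>
    simp only [Polynomial.eval_add, Polynomial.coe_add]
    rw [taylor_add (AnalyticOnNhd.eval_polynomial p 0 trivial)
      (AnalyticOnNhd.eval_polynomial q 0 trivial), hp, hq]
  | monomial n a =>
    simp only [Polynomial.eval_monomial]
    rw [taylor_const_mul, taylor_pow (f := fun z => z) analyticAt_id, taylor_id_zero,
      ← Polynomial.C_mul_X_pow_eq_monomial, PowerSeries.smul_eq_C_mul]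
    simp

lemma exists_norm_coeff_taylor_le {f : 𝕜 → 𝕜} {α : 𝕜} (hf : AnalyticAt 𝕜 f α) :
    ∃ C R : ℝ, 0 < C ∧ 0 < R ∧ ∀ n, ‖PowerSeries.coeff n (taylor f α)‖ ≤ C * R ^ n := by
  obtain ⟨r, hr⟩ := hf.hasFPowerSeriesAt
  obtain ⟨ρ, hρ0, hρr⟩ := ENNReal.lt_iff_exists_nnreal_btwn.mp hr.r_pos
  have hρ : (0 : ℝ) < ρ := by exact_mod_cast hρ0
  obtain ⟨C, hC0, hC⟩ :=
    FormalMultilinearSeries.norm_mul_pow_le_of_lt_radius _ (hρr.trans_le hr.r_le)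
  refine ⟨C, (ρ : ℝ)⁻¹, hC0, inv_pos.mpr hρ, fun n => ?_⟩
  rw [inv_pow, ← div_eq_mul_inv, le_div_iff₀ (by positivity), coeff_taylor]
  simpa only [FormalMultilinearSeries.ofScalars_norm] using hC n

lemma exists_analyticAt_taylor_eq {s : 𝕜⟦X⟧} {C R : ℝ} (hR : 0 < R)
    (h : ∀ n, ‖PowerSeries.coeff n s‖ ≤ C * R ^ n) (α : 𝕜) :
    ∃ f : 𝕜 → 𝕜, AnalyticAt 𝕜 f α ∧ taylor f α = s := by
  set p := FormalMultilinearSeries.ofScalars 𝕜 (fun n => PowerSeries.coeff n s)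
  have hR' := inv_pos.mpr hR
  have hp : 0 < p.radius := by
    refine (ENNReal.coe_pos.mpr (Real.toNNReal_pos.mpr hR')).trans_le
      (p.le_radius_of_bound C fun n => ?_)
    rw [FormalMultilinearSeries.ofScalars_norm, Real.coe_toNNReal _ hR'.le, inv_pow,
      ← div_eq_mul_inv, div_le_iff₀ (by positivity)]
    exact h n
  have hsum := ((p.hasFPowerSeriesOnBall hp).comp_sub α).hasFPowerSeriesAt
  rw [zero_add] at hsum
  refine ⟨_, hsum.analyticAt, ?_⟩
  have hcoeff := FormalMultilinearSeries.ofScalars_series_injective (𝕜 := 𝕜) (E := 𝕜)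
    (hsum.eq_formalMultilinearSeries hsum.analyticAt.hasFPowerSeriesAt)
  ext n
  rw [coeff_taylor]
  exact (congrFun hcoeff n).symm

lemma exists_eventuallyEq_sum_coeff_taylor_add {f : 𝕜 → 𝕜} {α : 𝕜} (hf : AnalyticAt 𝕜 f α)
    (n : ℕ) : ∃ r : 𝕜 → 𝕜, AnalyticAt 𝕜 r α ∧ ∀ᶠ z in 𝓝 α, f z =
      ∑ k ∈ Finset.range n, PowerSeries.coeff k (taylor f α) * (z - α) ^ k
        + (z - α) ^ n * r z := by
  have hf₀ : AnalyticAt 𝕜 (fun w => f (α + w)) 0 :=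
    AnalyticAt.fun_comp (by simpa using hf) (analyticAt_const.add analyticAt_id)
  obtain ⟨r, hr, hfr⟩ := hf₀.exists_eventuallyEq_sum_add_pow_mul n
  have hsub : Tendsto (fun z => z - α) (𝓝 α) (𝓝 0) :=
    (continuous_sub_right α).tendsto' α 0 (sub_self α)
  refine ⟨fun z => r (z - α), AnalyticAt.fun_comp (by simpa using hr)
    (analyticAt_id.sub analyticAt_const), (hsub.eventually hfr).mono fun z hz => ?_⟩
  rw [add_sub_cancel] at hz
  rw [hz]
  simp [coeff_taylor, iteratedDeriv_comp_const_add, div_eq_mul_inv, mul_comm, mul_left_comm]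

/-- Composition with `φ` followed by multiplication by a series divisible by `X ^ N` acts on Taylor
coefficients by a lower triangular matrix. -/
lemma coeff_mul_taylor_comp {g φ : 𝕜 → 𝕜} {α : 𝕜} (hg : AnalyticAt 𝕜 g (φ α))
    (hφ : AnalyticAt 𝕜 φ α) {N : ℕ} {W : 𝕜⟦X⟧} (hW : PowerSeries.X ^ N ∣ W) (n : ℕ) :
    PowerSeries.coeff (n + N) (W * taylor (fun z => g (φ z)) α) =
      ∑ k ∈ Finset.range (n + 1),
        PowerSeries.coeff (n + N) (W * taylor (fun z => φ z - φ α) α ^ k) *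
          PowerSeries.coeff k (taylor g (φ α)) := by
  obtain ⟨r, hr, hgr⟩ := exists_eventuallyEq_sum_coeff_taylor_add hg (n + 1)
  have hψ : AnalyticAt 𝕜 (fun z => φ z - φ α) α := hφ.fun_sub analyticAt_const
  have hr' : AnalyticAt 𝕜 (fun z => r (φ z)) α := hr.comp hφ
  have hX : PowerSeries.X ∣ taylor (fun z => φ z - φ α) α := by
    rw [PowerSeries.X_dvd_iff, constantCoeff_taylor, sub_self]
  have hremainder : PowerSeries.coeff (n + N)
      (W * (taylor (fun z => φ z - φ α) α ^ (n + 1) * taylor (fun z => r (φ z)) α)) = 0 := by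
    have hdvd : PowerSeries.X ^ (N + (n + 1)) ∣
        W * (taylor (fun z => φ z - φ α) α ^ (n + 1) * taylor (fun z => r (φ z)) α) :=
      pow_add (PowerSeries.X : 𝕜⟦X⟧) N (n + 1) ▸
        mul_dvd_mul hW ((pow_dvd_pow_of_dvd hX _).mul_right _)
    exact PowerSeries.X_pow_dvd_iff.mp hdvd _ (by lia)
  have hterm (k : ℕ) : AnalyticAt 𝕜
      (fun z => PowerSeries.coeff k (taylor g (φ α)) * (φ z - φ α) ^ k) α :=
    analyticAt_const.fun_mul (hψ.fun_pow k)
  rw [taylor_congr (f := fun z => g (φ z)) (hφ.continuousAt.eventually hgr),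
    taylor_add (Finset.analyticAt_fun_sum _ fun k _ => hterm k) ((hψ.fun_pow _).fun_mul hr'),
    taylor_sum _ fun k _ => hterm k, taylor_mul (hψ.fun_pow _) hr', taylor_pow hψ, mul_add,
    map_add, hremainder, add_zero, Finset.mul_sum, map_sum]
  refine Finset.sum_congr rfl fun k _ => ?_
  rw [taylor_const_mul, taylor_pow hψ, mul_smul_comm, map_smul, smul_eq_mul, mul_comm]

end CompleteSpace

lemma norm_coeff_taylor_le {f : ℂ → ℂ} {r C : ℝ} (hr : 0 < r)
    (hf : AnalyticOnNhd ℂ f (Metric.closedBall 0 r)) (hC : ∀ z ∈ Metric.sphere (0 : ℂ) r, ‖f z‖ ≤ C)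
    (n : ℕ) : ‖PowerSeries.coeff n (taylor f 0)‖ ≤ C / r ^ n := by
  have hd : DiffContOnCl ℂ f (Metric.ball 0 r) :=
    (hf.differentiableOn.mono Metric.closure_ball_subset_closedBall).diffContOnCl
  rw [coeff_taylor, norm_div, Complex.norm_natCast, div_le_iff₀ (by positivity)]
  exact (Complex.norm_iteratedDeriv_le_of_forall_mem_sphere_norm_le n hr hd hC).trans_eq (by ring)

end Taylor

section LinearODE

open scoped Differential

variable {K ι : Type*} [Field K] [Differential K]

lemma deriv_mul_eq {A : Type*} [CommRing A] [Differential A] (a b : A) :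
    (a * b)′ = a * b′ + b * a′ :=
  Derivation.leibniz _ a b

/-- The field of constants of a differential field. -/
def constants (K : Type*) [Field K] [Differential K] : Subfield K where
  carrier := {c | c′ = 0}
  mul_mem' {a b} ha hb := by simp_all
  one_mem' := Derivation.map_one_eq_zero _
  add_mem' {a b} ha hb := by simp_all
  zero_mem' := map_zero _
  neg_mem' {a} ha := by simp_all
  inv_mem' a ha := by simp_all [Derivation.leibniz_inv]

/-- Dividing a vector of minimal support by one of its entries and differentiating yields a vector
of smaller support, so the quotient has constant entries. -/
lemma exists_constants_mem_of_forall_deriv_mem [Finite ι] {W : Submodule K (ι → K)}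
    (hDW : ∀ c ∈ W, (fun j => (c j)′) ∈ W) (hW : W ≠ ⊥) :
    ∃ b : ι → constants K, b ≠ 0 ∧ (fun j => (b j : K)) ∈ W := by
  classical
  have := Fintype.ofFinite ι
  obtain ⟨c, hcW, hc0⟩ := W.ne_bot_iff.mp hW
  induction hm : (Finset.univ.filter fun j => c j ≠ 0).card using Nat.strong_induction_on
    generalizing c with
  | _ m ih =>
    obtain ⟨j₀, hj₀⟩ := Function.ne_iff.mp hc0
    set c' := (c j₀)⁻¹ • c
    have hc'W : c' ∈ W := W.smul_mem _ hcW
    have hc'j₀ : c' j₀ = 1 := inv_mul_cancel₀ hj₀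
    by_cases hDc : (fun j => (c' j)′) = 0
    · exact ⟨fun j => ⟨c' j, congrFun hDc j⟩,
        Function.ne_iff.mpr ⟨j₀, Subtype.coe_ne_coe.mp (hc'j₀.trans_ne one_ne_zero)⟩, hc'W⟩
    · refine ih _ (hm ▸ Finset.card_lt_card ?_) _ (hDW _ hc'W) hDc rfl
      refine Finset.ssubset_iff_subset_ne.mpr ⟨fun j hj => ?_, fun h => ?_⟩
      · rw [Finset.mem_filter_univ] at hj ⊢
        exact fun hcj => hj (by simp [c', hcj])
      · have hj₀' : (c' j₀)′ ≠ 0 := by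
          rw [← Finset.mem_filter_univ (p := fun j => (c' j)′ ≠ 0), h]
          simpa using hj₀
        exact hj₀' (by rw [hc'j₀, Derivation.map_one_eq_zero])

variable {n : ℕ} {a : Fin (n + 1) → K}

theorem card_le_of_linearIndependent_solutions [Fintype ι] (ha : a (Fin.last n) ≠ 0) {y : ι → K}
    (hy : ∀ j, ∑ i, a i * (⇑Differential.deriv)^[i] (y j) = 0)
    (hli : LinearIndependent (constants K) y) : Fintype.card ι ≤ n := by
  set jet := (Matrix.of fun (i : Fin n) j => (⇑Differential.deriv)^[i] (y j)).mulVecLin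
  have hjet {c : ι → K} : c ∈ LinearMap.ker jet ↔
      ∀ i : Fin (n + 1), ∑ j, (⇑Differential.deriv)^[i] (y j) * c j = 0 := by
    refine ⟨fun hc => ?_, fun h => funext fun i => h i.castSucc⟩
    have hlow (i : Fin n) : ∑ j, (⇑Differential.deriv)^[i] (y j) * c j = 0 := congrFun hc i
    have hode : ∑ i, a i * ∑ j, (⇑Differential.deriv)^[i] (y j) * c j = 0 := by
      simp_rw [Finset.mul_sum, ← mul_assoc]
      rw [Finset.sum_comm]
      simp_rw [← Finset.sum_mul, hy, zero_mul, Finset.sum_const_zero]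
    rw [Fin.sum_univ_castSucc] at hode
    simp only [Fin.val_castSucc, hlow, mul_zero, Finset.sum_const_zero, zero_add] at hode
    exact Fin.lastCases ((mul_eq_zero.mp hode).resolve_left ha) hlow
  have hstable : ∀ c ∈ LinearMap.ker jet, (fun j => (c j)′) ∈ LinearMap.ker jet := by
    intro c hc
    funext i
    have hi : ∑ j, (⇑Differential.deriv)^[i] (y j) * c j = 0 := hjet.mp hc i.castSucc
    have hi' : ∑ j, (⇑Differential.deriv)^[i + 1] (y j) * c j = 0 := hjet.mp hc i.succ
    have hDi := congrArg Differential.deriv hi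
    simp only [map_sum, Derivation.leibniz, smul_eq_mul, map_zero, Finset.sum_add_distrib] at hDi
    simp only [Function.iterate_succ_apply', mul_comm _ (c _)] at hi'
    rwa [hi', add_zero] at hDi
  by_contra! hcard
  obtain ⟨b, hb0, hb⟩ := exists_constants_mem_of_forall_deriv_mem hstable fun hbot => by
    have hle := card_le_of_injective K jet (LinearMap.ker_eq_bot.mp hbot)
    rw [Fintype.card_fin] at hle
    exact hle.not_gt hcard
  refine hb0 (funext (Fintype.linearIndependent_iff.mp hli b ?_))
  simpa [Subfield.smul_def, mul_comm] using hjet.mp hb 0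

theorem exists_eq_sum_of_linearIndependent_solutions (ha : a (Fin.last n) ≠ 0) {y : Fin n → K}
    (hy : ∀ j, ∑ i, a i * (⇑Differential.deriv)^[i] (y j) = 0)
    (hli : LinearIndependent (constants K) y) {z : K}
    (hz : ∑ i, a i * (⇑Differential.deriv)^[i] z = 0) :
    ∃ c : Fin n → constants K, z = ∑ j, c j • y j := by
  suffices hmem : z ∈ Submodule.span (constants K) (Set.range y) by
    simpa only [eq_comm] using (Submodule.mem_span_range_iff_exists_fun _).mp hmem
  by_contra hmem
  have hcard := card_le_of_linearIndependent_solutions ha (y := Fin.cons z y)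
    (Fin.cases hz hy) (linearIndependent_finCons.mpr ⟨hli, hmem⟩)
  simp at hcard

end LinearODE

section LaurentSeries

open scoped Differential

variable {R : Type*} [CommRing R]

lemma coeff_laurentSeries_derivative (f : R⸨X⸩) (n : ℤ) :
    (LaurentSeries.derivative R f).coeff n = (n + 1) * f.coeff (n + 1) := by
  rw [LaurentSeries.derivative_apply, LaurentSeries.hasseDeriv_coeff]
  simp

lemma coeff_X_mul_derivative (f : R⸨X⸩) (n : ℤ) :
    (HahnSeries.single 1 1 * LaurentSeries.derivative R f).coeff n = n * f.coeff n := by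
  rw [HahnSeries.coeff_single_mul, coeff_laurentSeries_derivative]
  simp

lemma X_mul_derivative_mul (f g : R⸨X⸩) :
    HahnSeries.single 1 1 * LaurentSeries.derivative R (f * g) =
      f * (HahnSeries.single 1 1 * LaurentSeries.derivative R g) +
        g * (HahnSeries.single 1 1 * LaurentSeries.derivative R f) := by
  have hsupp (h : R⸨X⸩) :
      (HahnSeries.single (1 : ℤ) (1 : R) * LaurentSeries.derivative R h).support ⊆ h.support :=
    fun n hn hn0 => hn (by rw [coeff_X_mul_derivative, hn0, mul_zero])
  ext n
  rw [mul_comm g, HahnSeries.coeff_add, coeff_X_mul_derivative,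
    HahnSeries.coeff_mul_right' g.isPWO_support (hsupp g),
    HahnSeries.coeff_mul_left' f.isPWO_support (hsupp f), HahnSeries.coeff_mul, Finset.mul_sum,
    ← Finset.sum_add_distrib]
  refine Finset.sum_congr rfl fun ij hij => ?_
  obtain ⟨-, -, hn⟩ := Finset.mem_antidiagonal.mp hij
  rw [coeff_X_mul_derivative, coeff_X_mul_derivative, ← hn]
  push_cast
  ring

/-- The derivation of a commutative ring given by an additive map satisfying the Leibniz rule. -/
abbrev differentialOfLeibniz {A : Type*} [CommRing A] (D : A →+ A)
    (hD : ∀ a b, D (a * b) = a * D b + b * D a) : Differential A where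
  deriv := Derivation.mk' D.toIntLinearMap hD

/-- The derivation `d/dX` of the ring of formal Laurent series. -/
noncomputable instance : Differential R⸨X⸩ :=
  differentialOfLeibniz (LaurentSeries.derivative R).toAddMonoidHom fun f g => by
    have hX : (HahnSeries.single (-1 : ℤ) (1 : R)) * HahnSeries.single 1 1 = 1 := by
      rw [HahnSeries.single_mul_single, neg_add_cancel, mul_one, HahnSeries.single_zero_one]
    have h := congrArg (HahnSeries.single (-1 : ℤ) (1 : R) * ·) (X_mul_derivative_mul f g)
    simp only [mul_add, mul_left_comm _ f, mul_left_comm _ g] at h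
    simp only [← mul_assoc _ _ (LaurentSeries.derivative R _), hX, one_mul] at h
    exact h

lemma coeff_deriv (f : R⸨X⸩) (n : ℤ) : (f′).coeff n = (n + 1) * f.coeff (n + 1) :=
  coeff_laurentSeries_derivative f n

lemma deriv_coe_powerSeries (f : R⟦X⟧) :
    (f : R⸨X⸩)′ = (PowerSeries.derivative R f : R⟦X⟧) := by
  ext n
  rw [coeff_deriv, PowerSeries.coeff_coe, PowerSeries.coeff_coe]
  rcases lt_trichotomy n (-1) with hn | rfl | hn
  · rw [if_pos (by lia), if_pos (by lia), mul_zero]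
  · simp
  · lift n to ℕ using by lia
    rw [if_neg (by lia), if_neg (by lia), Int.natAbs_natCast, PowerSeries.coeff_derivative]
    simp [show (n + 1 : ℤ).natAbs = n + 1 by lia, mul_comm]

lemma iterate_deriv_coe_powerSeries (f : R⟦X⟧) (i : ℕ) :
    (⇑Differential.deriv)^[i] (f : R⸨X⸩) = ((PowerSeries.derivative R)^[i] f : R⟦X⟧) := by
  induction i with
  | zero => rfl
  | succ i ih =>
    rw [Function.iterate_succ_apply', Function.iterate_succ_apply', ih, deriv_coe_powerSeries]

lemma mem_constants_laurentSeries_iff {F : Type*} [Field F] [CharZero F] {f : F⸨X⸩} :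
    f ∈ constants F⸨X⸩ ↔ ∃ c, HahnSeries.C c = f := by
  refine ⟨fun hf => ⟨f.coeff 0, ?_⟩, ?_⟩
  · ext n
    rcases eq_or_ne n 0 with rfl | hn0
    · simp
    · have hn : n * f.coeff n = 0 := by
        have hf' : (f′).coeff (n - 1) = 0 := congrArg (fun g => HahnSeries.coeff g (n - 1)) hf
        simpa [coeff_deriv] using hf'
      simpa [HahnSeries.C_apply, HahnSeries.coeff_single_of_ne hn0, hn0, eq_comm] using hn
  · rintro ⟨c, rfl⟩
    have hc := deriv_coe_powerSeries (PowerSeries.C c)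
    rwa [PowerSeries.derivative_C, map_zero, PowerSeries.coe_C] at hc

end LaurentSeries

section Laurent

open scoped Differential

variable {𝕜 : Type*} [NontriviallyNormedField 𝕜]

open Classical in
/-- The Laurent series of `g` at `α`, as a formal Laurent series; the junk value `0` unless `g` is
meromorphic at `α`. -/
noncomputable def laurent (g : 𝕜 → 𝕜) (α : 𝕜) : 𝕜⸨X⸩ :=
  if h : MeromorphicAt g α then
    ((PowerSeries.X : 𝕜⟦X⟧) : 𝕜⸨X⸩)⁻¹ ^ h.choose *
      (taylor (fun z => (z - α) ^ h.choose * g z) α : 𝕜⟦X⟧)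
  else 0

lemma coe_X_ne_zero {F : Type*} [Field F] : ((PowerSeries.X : F⟦X⟧) : F⸨X⸩) ≠ 0 := by
  rw [PowerSeries.coe_X]
  exact HahnSeries.single_ne_zero one_ne_zero

lemma meromorphicAt_of_pow_mul_eq {g k : 𝕜 → 𝕜} {α : 𝕜} {N : ℕ} (hk : AnalyticAt 𝕜 k α)
    (hgk : ∀ᶠ z in 𝓝[≠] α, (z - α) ^ N * g z = k z) : MeromorphicAt g α := by
  have hpow : MeromorphicAt (fun z => ((z - α) ^ N)⁻¹) α := by fun_prop
  refine (hpow.mul hk.meromorphicAt).congr ?_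
  filter_upwards [hgk, self_mem_nhdsWithin] with z hz hzα
  rw [Pi.mul_apply, ← hz, inv_mul_cancel_left₀ (pow_ne_zero _ (sub_ne_zero.mpr hzα))]

lemma exists_pow_mul_eq {g : 𝕜 → 𝕜} {α : 𝕜} (hg : MeromorphicAt g α) :
    ∃ (N : ℕ) (k : 𝕜 → 𝕜), AnalyticAt 𝕜 k α ∧ ∀ᶠ z in 𝓝[≠] α, (z - α) ^ N * g z = k z :=
  ⟨hg.choose, _, hg.choose_spec, .of_forall fun _ => rfl⟩

lemma meromorphicAt_iteratedDeriv [CompleteSpace 𝕜] {g : 𝕜 → 𝕜} {α : 𝕜} (hg : MeromorphicAt g α)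
    (n : ℕ) : MeromorphicAt (iteratedDeriv n g) α := by
  rw [iteratedDeriv_eq_iterate]
  exact hg.iterated_deriv

lemma meromorphicAt_sum_const_mul {ι : Type*} [Fintype ι] {g : ι → 𝕜 → 𝕜} {α : 𝕜}
    (hg : ∀ j, MeromorphicAt (g j) α) (c : ι → 𝕜) :
    MeromorphicAt (fun z => ∑ j, c j * g j z) α :=
  .fun_sum fun j _ => (MeromorphicAt.const (c j) α).fun_mul (hg j)

variable [CompleteSpace 𝕜] [CharZero 𝕜]

lemma taylor_sub_pow (α : 𝕜) (N : ℕ) : taylor (fun z => (z - α) ^ N) α = PowerSeries.X ^ N := by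
  rw [taylor_pow (f := fun z => z - α) (by fun_prop), taylor_sub_self]

lemma X_pow_mul_laurent {g k : 𝕜 → 𝕜} {α : 𝕜} {N : ℕ} (hk : AnalyticAt 𝕜 k α)
    (hgk : ∀ᶠ z in 𝓝[≠] α, (z - α) ^ N * g z = k z) :
    ((PowerSeries.X : 𝕜⟦X⟧) : 𝕜⸨X⸩) ^ N * laurent g α = (taylor k α : 𝕜⟦X⟧) := by
  have hg := meromorphicAt_of_pow_mul_eq hk hgk
  rw [laurent, dif_pos hg]
  set m := hg.choose
  set G := fun z => (z - α) ^ m * g z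
  have hG : AnalyticAt 𝕜 G α := hg.choose_spec
  have hpow (j : ℕ) : AnalyticAt 𝕜 (fun z => (z - α) ^ j) α := by fun_prop
  have heq : (fun z => (z - α) ^ N * G z) =ᶠ[𝓝 α] fun z => (z - α) ^ m * k z := by
    refine (((hpow N).mul hG).frequently_eq_iff_eventually_eq ((hpow m).mul hk)).mp
      (Eventually.frequently (hgk.mono fun z hz => ?_))
    simp only [Pi.mul_apply, G, ← hz]
    ring
  have htaylor := taylor_congr heq
  rw [taylor_mul (hpow N) hG, taylor_mul (hpow m) hk, taylor_sub_pow, taylor_sub_pow] at htaylor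
  have hcoe := congrArg (HahnSeries.ofPowerSeries ℤ 𝕜) htaylor
  rw [map_mul, map_mul, map_pow, map_pow] at hcoe
  rw [mul_left_comm, hcoe, ← mul_assoc, ← mul_pow, inv_mul_cancel₀ coe_X_ne_zero, one_pow, one_mul]

lemma laurent_eq_of_X_pow_mul_eq {g k : 𝕜 → 𝕜} {α : 𝕜} {N : ℕ} (hk : AnalyticAt 𝕜 k α)
    (hgk : ∀ᶠ z in 𝓝[≠] α, (z - α) ^ N * g z = k z) {s : 𝕜⸨X⸩}
    (hs : ((PowerSeries.X : 𝕜⟦X⟧) : 𝕜⸨X⸩) ^ N * s = (taylor k α : 𝕜⟦X⟧)) : laurent g α = s :=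
  mul_left_cancel₀ (pow_ne_zero N coe_X_ne_zero) ((X_pow_mul_laurent hk hgk).trans hs.symm)

lemma laurent_eq_taylor {k : 𝕜 → 𝕜} {α : 𝕜} (hk : AnalyticAt 𝕜 k α) :
    laurent k α = (taylor k α : 𝕜⟦X⟧) :=
  laurent_eq_of_X_pow_mul_eq hk (N := 0) (by simp) (by simp)

lemma laurent_congr {f g : 𝕜 → 𝕜} {α : 𝕜} (hg : MeromorphicAt g α) (h : f =ᶠ[𝓝[≠] α] g) :
    laurent f α = laurent g α := by
  obtain ⟨N, k, hk, hgk⟩ := exists_pow_mul_eq hg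
  refine laurent_eq_of_X_pow_mul_eq hk ?_ (X_pow_mul_laurent hk hgk)
  filter_upwards [h, hgk] with z hz hzk
  rw [hz, hzk]

lemma laurent_mul {f g : 𝕜 → 𝕜} {α : 𝕜} (hf : MeromorphicAt f α) (hg : MeromorphicAt g α) :
    laurent (fun z => f z * g z) α = laurent f α * laurent g α := by
  obtain ⟨M, h, hh, hfh⟩ := exists_pow_mul_eq hf
  obtain ⟨N, k, hk, hgk⟩ := exists_pow_mul_eq hg
  refine laurent_eq_of_X_pow_mul_eq (N := M + N) (hh.fun_mul hk) ?_ ?_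
  · filter_upwards [hfh, hgk] with z hz hz'
    rw [← hz, ← hz']
    ring
  · rw [taylor_mul hh hk, PowerSeries.coe_mul, ← X_pow_mul_laurent hh hfh,
      ← X_pow_mul_laurent hk hgk]
    ring

lemma laurent_add {f g : 𝕜 → 𝕜} {α : 𝕜} (hf : MeromorphicAt f α) (hg : MeromorphicAt g α) :
    laurent (fun z => f z + g z) α = laurent f α + laurent g α := by
  obtain ⟨M, h, hh, hfh⟩ := exists_pow_mul_eq hf
  obtain ⟨N, k, hk, hgk⟩ := exists_pow_mul_eq hg
  have hpow (j : ℕ) : AnalyticAt 𝕜 (fun z => (z - α) ^ j) α := by fun_prop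
  refine laurent_eq_of_X_pow_mul_eq (N := M + N)
    (((hpow N).fun_mul hh).fun_add ((hpow M).fun_mul hk)) ?_ ?_
  · filter_upwards [hfh, hgk] with z hz hz'
    rw [← hz, ← hz']
    ring
  · rw [taylor_add ((hpow N).fun_mul hh) ((hpow M).fun_mul hk), taylor_mul (hpow N) hh,
      taylor_mul (hpow M) hk, taylor_sub_pow, taylor_sub_pow, PowerSeries.coe_add,
      PowerSeries.coe_mul, PowerSeries.coe_mul, PowerSeries.coe_pow, PowerSeries.coe_pow,
      ← X_pow_mul_laurent hh hfh, ← X_pow_mul_laurent hk hgk]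
    ring

lemma laurent_const (c α : 𝕜) : laurent (fun _ => c) α = HahnSeries.C c := by
  rw [laurent_eq_taylor analyticAt_const, taylor_const, PowerSeries.coe_C]

lemma laurent_sum {ι : Type*} (s : Finset ι) {f : ι → 𝕜 → 𝕜} {α : 𝕜}
    (hf : ∀ i, MeromorphicAt (f i) α) :
    laurent (fun z => ∑ i ∈ s, f i z) α = ∑ i ∈ s, laurent (f i) α := by
  classical
  induction s using Finset.induction_on with
  | empty => simpa using laurent_const 0 α
  | insert j s hj ih =>
    simp only [Finset.sum_insert hj]
    rw [laurent_add (hf j) (.fun_sum fun i _ => hf i), ih]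

lemma laurent_deriv_of_analyticAt {k : 𝕜 → 𝕜} {α : 𝕜} (hk : AnalyticAt 𝕜 k α) :
    laurent (deriv k) α = (laurent k α)′ := by
  rw [laurent_eq_taylor hk, laurent_eq_taylor hk.deriv, taylor_deriv, deriv_coe_powerSeries]

lemma laurent_deriv {g : 𝕜 → 𝕜} {α : 𝕜} (hg : MeromorphicAt g α) :
    laurent (deriv g) α = (laurent g α)′ := by
  obtain ⟨N, k, hk, hgk⟩ := exists_pow_mul_eq hg
  have hu : AnalyticAt 𝕜 (fun z => (z - α) ^ N) α := by fun_prop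
  have hk' : deriv k =ᶠ[𝓝[≠] α]
      fun z => deriv (fun z => (z - α) ^ N) z * g z + (z - α) ^ N * deriv g z := by
    filter_upwards [eventually_eventually_nhdsWithin.mpr hgk, hg.eventually_analyticAt,
      nhdsWithin_le_nhds hu.eventually_analyticAt, self_mem_nhdsWithin] with z hz hgz huz hzα
    rw [isOpen_compl_singleton.nhdsWithin_eq hzα] at hz
    rw [← EventuallyEq.deriv_eq hz, deriv_fun_mul huz.differentiableAt hgz.differentiableAt]
  have hmul : laurent k α = laurent (fun z => (z - α) ^ N) α * laurent g α := by
    rw [← laurent_mul hu.meromorphicAt hg]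
    exact (laurent_congr hk.meromorphicAt hgk).symm
  have hderiv := laurent_deriv_of_analyticAt hk
  have hu' := hu.deriv.meromorphicAt
  have hg' := hg.deriv
  rw [laurent_congr ((hu'.fun_mul hg).fun_add (hu.meromorphicAt.fun_mul hg')) hk',
    laurent_add (hu'.fun_mul hg) (hu.meromorphicAt.fun_mul hg'), laurent_mul hu' hg,
    laurent_mul hu.meromorphicAt hg', laurent_deriv_of_analyticAt hu, hmul] at hderiv
  rw [deriv_mul_eq, mul_comm (laurent g α), add_comm] at hderiv
  refine mul_left_cancel₀ ?_ (add_right_cancel hderiv)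
  rw [laurent_eq_taylor hu, taylor_sub_pow, PowerSeries.coe_pow]
  exact pow_ne_zero N coe_X_ne_zero

lemma laurent_iteratedDeriv {g : 𝕜 → 𝕜} {α : 𝕜} (hg : MeromorphicAt g α) (n : ℕ) :
    laurent (iteratedDeriv n g) α = (⇑Differential.deriv)^[n] (laurent g α) := by
  induction n with
  | zero => simp
  | succ n ih =>
    rw [iteratedDeriv_succ, laurent_deriv (meromorphicAt_iteratedDeriv hg n), ih,
      Function.iterate_succ_apply']

lemma exists_eventuallyEq_of_laurent_eq_coe {g : 𝕜 → 𝕜} {α : 𝕜} (hg : MeromorphicAt g α)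
    {s : 𝕜⟦X⟧} (hs : laurent g α = s) :
    ∃ k, AnalyticAt 𝕜 k α ∧ taylor k α = s ∧ g =ᶠ[𝓝[≠] α] k := by
  obtain ⟨N, k, hk, hgk⟩ := exists_pow_mul_eq hg
  have hXs := X_pow_mul_laurent hk hgk
  rw [hs, ← PowerSeries.coe_pow, ← PowerSeries.coe_mul] at hXs
  replace hXs := HahnSeries.ofPowerSeries_injective hXs
  obtain ⟨r, hr, hkr⟩ := exists_eventuallyEq_sum_coeff_taylor_add hk N
  have hk0 : ∀ j ∈ Finset.range N, PowerSeries.coeff j (taylor k α) = 0 := fun j hj => by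
    rw [← hXs, PowerSeries.coeff_X_pow_mul', if_neg (by simpa using hj)]
  have hkr' : k =ᶠ[𝓝 α] fun z => (z - α) ^ N * r z := by
    filter_upwards [hkr] with z hz
    rw [hz, Finset.sum_eq_zero fun j hj => by rw [hk0 j hj, zero_mul], zero_add]
  refine ⟨r, hr, ?_, ?_⟩
  · rw [taylor_congr hkr', taylor_mul (by fun_prop) hr, taylor_sub_pow] at hXs
    exact (mul_left_cancel₀ (pow_ne_zero N PowerSeries.X_ne_zero) hXs).symm
  · filter_upwards [hgk, nhdsWithin_le_nhds hkr', self_mem_nhdsWithin] with z hz hz' hzα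
    exact mul_left_cancel₀ (pow_ne_zero N (sub_ne_zero.mpr hzα)) (hz.trans hz')

lemma laurent_eq_zero_iff {g : 𝕜 → 𝕜} {α : 𝕜} (hg : MeromorphicAt g α) :
    laurent g α = 0 ↔ ∀ᶠ z in 𝓝[≠] α, g z = 0 := by
  refine ⟨fun h => ?_, fun h => ?_⟩
  · obtain ⟨k, hk, hk0, hgk⟩ :=
      exists_eventuallyEq_of_laurent_eq_coe (s := 0) hg (by simpa using h)
    filter_upwards [hgk, nhdsWithin_le_nhds (eventually_eq_zero_of_taylor_eq_zero hk hk0)]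
      with z hz hz'
    rw [hz, hz']
  · rw [laurent_congr analyticAt_const.meromorphicAt h, laurent_const, map_zero]

lemma laurent_eq_iff {f g : 𝕜 → 𝕜} {α : 𝕜} (hf : MeromorphicAt f α) (hg : MeromorphicAt g α) :
    laurent f α = laurent g α ↔ f =ᶠ[𝓝[≠] α] g := by
  refine ⟨fun h => ?_, laurent_congr hg⟩
  have hneg : MeromorphicAt (fun z => -1 * g z) α := (MeromorphicAt.const (-1) α).fun_mul hg
  have hsub : laurent (fun z => f z + -1 * g z) α = 0 := by
    rw [laurent_add hf hneg, laurent_mul (.const (-1) α) hg, laurent_const, h, map_neg, map_one,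
      neg_one_mul, add_neg_cancel]
  filter_upwards [(laurent_eq_zero_iff (hf.fun_add hneg)).mp hsub] with z hz
  linear_combination hz

lemma laurent_sum_const_mul {ι : Type*} [Fintype ι] {g : ι → 𝕜 → 𝕜} {α : 𝕜}
    (hg : ∀ j, MeromorphicAt (g j) α) (c : ι → 𝕜) :
    laurent (fun z => ∑ j, c j * g j z) α = ∑ j, HahnSeries.C (c j) * laurent (g j) α := by
  rw [laurent_sum _ fun j => (MeromorphicAt.const (c j) α).fun_mul (hg j)]
  refine Finset.sum_congr rfl fun j _ => ?_
  rw [laurent_mul (.const (c j) α) (hg j), laurent_const]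

end Laurent

section MeromorphicODE

open scoped Differential

variable {𝕜 : Type*} [NontriviallyNormedField 𝕜] {n : ℕ}

/-- `h` is analytic and solves the linear differential equation `∑ i, a i * h⁽ⁱ⁾ = 0` on a punctured
neighbourhood of `α`. -/
def IsODESolutionNear (a : Fin (n + 1) → 𝕜 → 𝕜) (α : 𝕜) (h : 𝕜 → 𝕜) : Prop :=
  ∀ᶠ z in 𝓝[≠] α, AnalyticAt 𝕜 h z ∧ ∑ i, a i z * iteratedDeriv i h z = 0

/-- `g` is a linearly independent family of `n` meromorphic solutions near `α` of the equation
`∑ i, a i * h⁽ⁱ⁾ = 0` of order `n`. -/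
structure IsSolutionBasisNear (a : Fin (n + 1) → 𝕜 → 𝕜) (α : 𝕜) (g : Fin n → 𝕜 → 𝕜) : Prop where
  meromorphicAt : ∀ j, MeromorphicAt (g j) α
  isSolution : ∀ j, IsODESolutionNear a α (g j)
  eq_zero_of_sum : ∀ c : Fin n → 𝕜, (∀ᶠ z in 𝓝[≠] α, ∑ j, c j * g j z = 0) → ∀ j, c j = 0

variable {a : Fin (n + 1) → 𝕜 → 𝕜} {α : 𝕜}

lemma IsODESolutionNear.congr {g h : 𝕜 → 𝕜} (hg : IsODESolutionNear a α g)
    (hgh : g =ᶠ[𝓝[≠] α] h) : IsODESolutionNear a α h := by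
  filter_upwards [hg, eventually_eventually_nhdsWithin.mpr hgh, self_mem_nhdsWithin]
    with z ⟨hgz, hsum⟩ hz hzα
  rw [isOpen_compl_singleton.nhdsWithin_eq hzα] at hz
  refine ⟨hgz.congr hz, ?_⟩
  rw [← hsum]
  exact Finset.sum_congr rfl fun i _ => by rw [(EventuallyEq.iteratedDeriv hz i).eq_of_nhds]

variable [CompleteSpace 𝕜]

lemma IsODESolutionNear.sum {ι : Type*} [Fintype ι] {g : ι → 𝕜 → 𝕜}
    (hg : ∀ j, IsODESolutionNear a α (g j)) (c : ι → 𝕜) :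
    IsODESolutionNear a α fun z => ∑ j, c j * g j z := by
  filter_upwards [eventually_all.mpr hg] with z hz
  have han (j : ι) : AnalyticAt 𝕜 (fun z => c j * g j z) z := analyticAt_const.fun_mul (hz j).1
  refine ⟨Finset.analyticAt_fun_sum _ fun j _ => han j, ?_⟩
  calc ∑ i, a i z * iteratedDeriv i (fun z => ∑ j, c j * g j z) z
      = ∑ i, ∑ j, c j * (a i z * iteratedDeriv i (g j) z) := by
        refine Finset.sum_congr rfl fun i _ => ?_
        rw [iteratedDeriv_fun_sum fun j _ => (han j).contDiffAt, Finset.mul_sum]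
        refine Finset.sum_congr rfl fun j _ => ?_
        rw [iteratedDeriv_const_mul_field, mul_left_comm]
    _ = ∑ j, c j * ∑ i, a i z * iteratedDeriv i (g j) z := by
        rw [Finset.sum_comm]
        simp only [Finset.mul_sum]
    _ = 0 := Finset.sum_eq_zero fun j _ => by rw [(hz j).2, mul_zero]

variable [CharZero 𝕜]

lemma isODESolutionNear_iff_laurent (ha : ∀ i, MeromorphicAt (a i) α) {g : 𝕜 → 𝕜}
    (hg : MeromorphicAt g α) : IsODESolutionNear a α g ↔
      ∑ i, laurent (a i) α * (⇑Differential.deriv)^[i] (laurent g α) = 0 := by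
  have hterm (i : Fin (n + 1)) : MeromorphicAt (fun z => a i z * iteratedDeriv i g z) α :=
    (ha i).fun_mul (meromorphicAt_iteratedDeriv hg i)
  have hsum : ∑ i, laurent (a i) α * (⇑Differential.deriv)^[i] (laurent g α) =
      laurent (fun z => ∑ i, a i z * iteratedDeriv i g z) α := by
    rw [laurent_sum _ hterm]
    refine Finset.sum_congr rfl fun i _ => ?_
    rw [laurent_mul (ha i) (meromorphicAt_iteratedDeriv hg i), laurent_iteratedDeriv hg]
  rw [hsum, laurent_eq_zero_iff (.fun_sum fun i _ => hterm i), IsODESolutionNear, eventually_and]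
  exact and_iff_right hg.eventually_analyticAt

/-- The Laurent series of the basis span the formal solutions, since a formal equation of order `n`
has no more than `n` independent ones. -/
lemma IsSolutionBasisNear.exists_laurent_eq {g : Fin n → 𝕜 → 𝕜} (hg : IsSolutionBasisNear a α g)
    (ha : ∀ i, MeromorphicAt (a i) α) (hlast : ¬ ∀ᶠ z in 𝓝[≠] α, a (Fin.last n) z = 0) {s : 𝕜⸨X⸩}
    (hs : ∑ i, laurent (a i) α * (⇑Differential.deriv)^[i] s = 0) :
    ∃ c : Fin n → 𝕜, laurent (fun z => ∑ j, c j * g j z) α = s := by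
  have hlin : LinearIndependent (constants 𝕜⸨X⸩) fun j => laurent (g j) α := by
    rw [Fintype.linearIndependent_iff]
    intro b hb j
    choose c hc using fun j => mem_constants_laurentSeries_iff.mp (b j).2
    have hc0 : laurent (fun z => ∑ j, c j * g j z) α = 0 := by
      rw [laurent_sum_const_mul hg.meromorphicAt, ← hb]
      exact Finset.sum_congr rfl fun j _ => by rw [hc, Subfield.smul_def, smul_eq_mul]
    have hzero := hg.eq_zero_of_sum c <| (laurent_eq_zero_iff <|
      meromorphicAt_sum_const_mul hg.meromorphicAt c).mp hc0
    exact Subtype.ext (by rw [← hc, hzero, map_zero, ZeroMemClass.coe_zero])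
  obtain ⟨b, hb⟩ := exists_eq_sum_of_linearIndependent_solutions
    (mt (laurent_eq_zero_iff (ha _)).mp hlast)
    (fun j => (isODESolutionNear_iff_laurent ha (hg.meromorphicAt j)).mp (hg.isSolution j)) hlin hs
  choose c hc using fun j => mem_constants_laurentSeries_iff.mp (b j).2
  refine ⟨c, ?_⟩
  rw [laurent_sum_const_mul hg.meromorphicAt, hb]
  exact Finset.sum_congr rfl fun j _ => by rw [hc, Subfield.smul_def, smul_eq_mul]

lemma IsSolutionBasisNear.exists_eventuallyEq_sum {g : Fin n → 𝕜 → 𝕜}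
    (hg : IsSolutionBasisNear a α g) (ha : ∀ i, MeromorphicAt (a i) α)
    (hlast : ¬ ∀ᶠ z in 𝓝[≠] α, a (Fin.last n) z = 0) {h : 𝕜 → 𝕜} (hh : MeromorphicAt h α)
    (hsol : IsODESolutionNear a α h) :
    ∃ c : Fin n → 𝕜, h =ᶠ[𝓝[≠] α] fun z => ∑ j, c j * g j z := by
  obtain ⟨c, hc⟩ := hg.exists_laurent_eq ha hlast ((isODESolutionNear_iff_laurent ha hh).mp hsol)
  have hmer := meromorphicAt_sum_const_mul hg.meromorphicAt c
  exact ⟨c, ((laurent_eq_iff hmer hh).mp hc).symm⟩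

lemma IsSolutionBasisNear.exists_analyticAt_taylor_eq {g : Fin n → 𝕜 → 𝕜}
    (hg : IsSolutionBasisNear a α g) (ha : ∀ i, MeromorphicAt (a i) α)
    (hlast : ¬ ∀ᶠ z in 𝓝[≠] α, a (Fin.last n) z = 0) {f : 𝕜⟦X⟧}
    (hf : ∑ i, laurent (a i) α * (⇑Differential.deriv)^[i] (f : 𝕜⸨X⸩) = 0) :
    ∃ F, AnalyticAt 𝕜 F α ∧ taylor F α = f ∧ IsODESolutionNear a α F := by
  obtain ⟨c, hc⟩ := hg.exists_laurent_eq ha hlast hf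
  have hmer := meromorphicAt_sum_const_mul hg.meromorphicAt c
  obtain ⟨F, hF, hFf, heq⟩ := exists_eventuallyEq_of_laurent_eq_coe hmer hc
  exact ⟨F, hF, hFf, (IsODESolutionNear.sum hg.isSolution c).congr heq⟩

end MeromorphicODE

section LocalExistence

variable {𝕜 ι : Type*} [RCLike 𝕜] {α : 𝕜}

/-- The Taylor coefficients of the solution of the linear system `F' = A F`, `F(0) = y`, where `A`
has the Taylor coefficients `A 0, A 1, …`. -/
noncomputable def systemCoeff [Fintype ι] (A : ℕ → ι → ι → 𝕜) (y : ι → 𝕜) : ℕ → ι → 𝕜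
  | 0 => y
  | k + 1 => fun a => (∑ j : Fin (k + 1), ∑ b, A j a b * systemCoeff A y (k - j) b) / (k + 1)
  termination_by k => k
  decreasing_by lia

lemma norm_systemCoeff_le [Fintype ι] {A : ℕ → ι → ι → 𝕜} {y : ι → 𝕜} {C M K : ℝ} (hC : 0 ≤ C)
    (hM : 0 ≤ M) (hA : ∀ j a b, ‖A j a b‖ ≤ M * K ^ j) (hy : ∀ a, ‖y a‖ ≤ C)
    (hK : Fintype.card ι * M ≤ K) (k : ℕ) (a : ι) : ‖systemCoeff A y k a‖ ≤ C * K ^ k := by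
  have hK0 : 0 ≤ K := le_trans (by positivity) hK
  induction k using Nat.strong_induction_on generalizing a with
  | _ k ih =>
    rcases k with _ | k
    · simpa [systemCoeff] using hy a
    have hk : ‖((k : 𝕜) + 1)‖ = k + 1 := by exact_mod_cast RCLike.norm_natCast (K := 𝕜) (k + 1)
    rw [systemCoeff, norm_div, hk, div_le_iff₀ (by positivity)]
    calc ‖∑ j : Fin (k + 1), ∑ b, A j a b * systemCoeff A y (k - j) b‖
        ≤ ∑ _ : Fin (k + 1), ∑ _ : ι, M * C * K ^ k := by
          refine norm_sum_le_of_le _ fun j _ => norm_sum_le_of_le _ fun b _ => ?_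
          calc ‖A j a b * systemCoeff A y (k - j) b‖
              ≤ (M * K ^ (j : ℕ)) * (C * K ^ (k - j)) := by
                rw [norm_mul]
                exact mul_le_mul (hA j a b) (ih (k - j) (by lia) b) (norm_nonneg _) (by positivity)
            _ = M * C * K ^ k := by
                rw [mul_mul_mul_comm, ← pow_add, Nat.add_sub_cancel' (Nat.lt_succ_iff.mp j.2)]
      _ = (Fintype.card ι * M) * (C * K ^ k * (k + 1)) := by
          simp only [Finset.sum_const, Finset.card_univ, Fintype.card_fin, nsmul_eq_mul]
          push_cast
          ring
      _ ≤ K * (C * K ^ k * (k + 1)) := by gcongr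
      _ = C * K ^ (k + 1) * (k + 1) := by ring

lemma exists_forall_norm_coeff_taylor_le [Finite ι] {f : ι → 𝕜 → 𝕜}
    (hf : ∀ i, AnalyticAt 𝕜 (f i) α) :
    ∃ C R : ℝ, 0 ≤ C ∧ 0 ≤ R ∧ ∀ i n, ‖PowerSeries.coeff n (taylor (f i) α)‖ ≤ C * R ^ n := by
  have := Fintype.ofFinite ι
  choose C R hC hR hbound using fun i => exists_norm_coeff_taylor_le (hf i)
  refine ⟨∑ i, C i, ∑ i, R i, Finset.sum_nonneg fun i _ => (hC i).le,
    Finset.sum_nonneg fun i _ => (hR i).le, fun i n => (hbound i n).trans ?_⟩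
  have hCi := Finset.single_le_sum (fun i _ => (hC i).le) (Finset.mem_univ i)
  have hRi := Finset.single_le_sum (fun i _ => (hR i).le) (Finset.mem_univ i)
  have hC0 := (hC i).le
  have hR0 := (hR i).le
  exact mul_le_mul hCi (pow_le_pow_left₀ hR0 hRi n) (by positivity) (hC0.trans hCi)

lemma coeff_derivative_mk_systemCoeff [Fintype ι] (A : ι → ι → 𝕜⟦X⟧) (y : ι → 𝕜) (a : ι) (k : ℕ) :
    (systemCoeff (fun j a b => PowerSeries.coeff j (A a b)) y (k + 1) a) * (k + 1) =
      PowerSeries.coeff k (∑ b, A a b *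
        PowerSeries.mk fun k => systemCoeff (fun j a b => PowerSeries.coeff j (A a b)) y k b) := by
  rw [systemCoeff, div_mul_cancel₀ _ (by exact_mod_cast k.succ_ne_zero), Finset.sum_comm, map_sum]
  refine Finset.sum_congr rfl fun b _ => ?_
  rw [PowerSeries.coeff_mul, Finset.Nat.sum_antidiagonal_eq_sum_range_succ_mk, Finset.sum_range]
  simp only [PowerSeries.coeff_mk]

lemma exists_system_solution [Fintype ι] {A : ι → ι → 𝕜 → 𝕜}
    (hA : ∀ a b, AnalyticAt 𝕜 (A a b) α) (y : ι → 𝕜) :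
    ∃ F : ι → 𝕜 → 𝕜, (∀ a, AnalyticAt 𝕜 (F a) α) ∧ (∀ a, F a α = y a) ∧
      ∀ a, deriv (F a) =ᶠ[𝓝 α] fun z => ∑ b, A a b z * F b z := by
  obtain ⟨M, R, hM, hR, hbound⟩ := exists_forall_norm_coeff_taylor_le
    (f := fun p : ι × ι => A p.1 p.2) fun p => hA p.1 p.2
  set u := systemCoeff (fun j a b => PowerSeries.coeff j (taylor (A a b) α)) y
  set K : ℝ := Fintype.card ι * M + R + 1
  have hcard : 0 ≤ Fintype.card ι * M := by positivity
  have hu (a : ι) (k : ℕ) : ‖PowerSeries.coeff k (PowerSeries.mk fun k => u k a)‖ ≤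
      (∑ a, ‖y a‖) * K ^ k := by
    rw [PowerSeries.coeff_mk]
    refine norm_systemCoeff_le (M := M) (by positivity) hM (fun j a b => ?_)
      (fun a => Finset.single_le_sum (f := fun a => ‖y a‖) (fun a _ => norm_nonneg _)
        (Finset.mem_univ a)) (by linarith) k a
    have hRK : R ≤ K := by linarith
    exact (hbound (a, b) j).trans (by gcongr)
  choose F hF hFt using fun a => exists_analyticAt_taylor_eq (by positivity) (hu a) α
  refine ⟨F, hF, fun a => ?_, fun a => ?_⟩
  · rw [← constantCoeff_taylor (F a) α, hFt, ← PowerSeries.coeff_zero_eq_constantCoeff_apply,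
      PowerSeries.coeff_mk]
    simp only [u, systemCoeff]
  · have hAF (b : ι) : AnalyticAt 𝕜 (fun z => A a b z * F b z) α := (hA a b).fun_mul (hF b)
    refine eventuallyEq_of_taylor_eq (hF a).deriv (Finset.analyticAt_fun_sum _ fun b _ => hAF b) ?_
    rw [taylor_deriv, taylor_sum _ fun b _ => hAF b]
    ext k
    rw [PowerSeries.coeff_derivative, hFt, PowerSeries.coeff_mk, coeff_derivative_mk_systemCoeff]
    congr 1
    exact Finset.sum_congr rfl fun b _ => by rw [taylor_mul (hA a b) (hF b), hFt]

/-- The companion matrix of the equation `f⁽ⁿ⁾ = ∑ b < n, ρ b * f⁽ᵇ⁾`. -/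
def companion {n : ℕ} (ρ : Fin n → 𝕜 → 𝕜) (a b : Fin n) : 𝕜 → 𝕜 :=
  if (a : ℕ) + 1 = n then ρ b else if (b : ℕ) = a + 1 then fun _ => 1 else fun _ => 0

lemma analyticAt_companion {n : ℕ} {ρ : Fin n → 𝕜 → 𝕜} (hρ : ∀ i, AnalyticAt 𝕜 (ρ i) α)
    (a b : Fin n) : AnalyticAt 𝕜 (companion ρ a b) α := by
  unfold companion
  split_ifs
  exacts [hρ b, analyticAt_const, analyticAt_const]

lemma exists_scalar_solution {n : ℕ} {ρ : Fin n → 𝕜 → 𝕜} (hρ : ∀ i, AnalyticAt 𝕜 (ρ i) α)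
    (y : Fin n → 𝕜) :
    ∃ f : 𝕜 → 𝕜, AnalyticAt 𝕜 f α ∧ (∀ i : Fin n, iteratedDeriv i f α = y i) ∧
      ∀ᶠ z in 𝓝 α, iteratedDeriv n f z = ∑ i : Fin n, ρ i z * iteratedDeriv i f z := by
  rcases n with _ | m
  · exact ⟨fun _ => 0, analyticAt_const, fun i => i.elim0, by simp⟩
  obtain ⟨F, hF, hF0, hF'⟩ := exists_system_solution (analyticAt_companion hρ) y
  have hiter : ∀ i : Fin (m + 1), iteratedDeriv i (F 0) =ᶠ[𝓝 α] F i := fun i => by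
    induction i using Fin.induction with
    | zero => simp
    | succ i ih =>
      rw [Fin.val_succ, iteratedDeriv_succ]
      filter_upwards [ih.deriv, hF' i.castSucc] with z hz hz'
      rw [Fin.val_castSucc] at hz
      have hi : (i : ℕ) ≠ m := i.is_lt.ne
      rw [hz, hz', Finset.sum_eq_single i.succ]
      · simp [companion, hi]
      · intro b _ hb
        have hbi : ¬ (b : ℕ) = i + 1 := fun h => hb (Fin.ext (by simpa using h))
        simp [companion, hi, hbi]
      · simp
  refine ⟨F 0, hF 0, fun i => by rw [(hiter i).eq_of_nhds, hF0], ?_⟩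
  rw [iteratedDeriv_succ]
  filter_upwards [(hiter (Fin.last m)).deriv, hF' (Fin.last m), eventually_all.mpr hiter]
    with z hz hz' hall
  rw [Fin.val_last] at hz
  rw [hz, hz']
  exact Finset.sum_congr rfl fun i _ => by rw [hall]; simp [companion]

lemma eq_zero_of_eventually_sum_eq_zero {n : ℕ} {f : Fin n → 𝕜 → 𝕜}
    (hf : ∀ j, AnalyticAt 𝕜 (f j) α)
    (hf0 : ∀ i j : Fin n, iteratedDeriv i (f j) α = (Pi.single j 1 : Fin n → 𝕜) i)
    {c : Fin n → 𝕜} (hc : ∀ᶠ z in 𝓝 α, ∑ j, c j * f j z = 0) (i : Fin n) : c i = 0 := by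
  have h0 := (EventuallyEq.iteratedDeriv hc i).eq_of_nhds
  rw [iteratedDeriv_fun_sum fun j _ => (analyticAt_const.fun_mul (hf j)).contDiffAt] at h0
  simpa [iteratedDeriv_const_mul_field, hf0, iteratedDeriv_fun_const_zero, Pi.single_apply] using h0

lemma exists_analytic_isSolutionBasisNear {n : ℕ} {a : Fin (n + 1) → 𝕜 → 𝕜} {ρ : Fin n → 𝕜 → 𝕜}
    (hρ : ∀ i, AnalyticAt 𝕜 (ρ i) α)
    (ha : ∀ i : Fin n, ∀ᶠ z in 𝓝[≠] α, a i.castSucc z = ρ i z * a (Fin.last n) z) :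
    ∃ g : Fin n → 𝕜 → 𝕜, (∀ j, AnalyticAt 𝕜 (g j) α) ∧ IsSolutionBasisNear a α g := by
  choose g hg hg0 hsol using fun j : Fin n =>
    exists_scalar_solution (fun i => (hρ i).fun_neg) (Pi.single j 1)
  refine ⟨g, hg, fun j => (hg j).meromorphicAt, fun j => ?_, fun c hc =>
    eq_zero_of_eventually_sum_eq_zero hg (fun i j => hg0 j i) ?_⟩
  · filter_upwards [nhdsWithin_le_nhds (hg j).eventually_analyticAt, nhdsWithin_le_nhds (hsol j),
      eventually_all.mpr ha] with z hgz hz haz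
    refine ⟨hgz, ?_⟩
    rw [Fin.sum_univ_castSucc, Fin.val_last, hz, Finset.mul_sum, ← Finset.sum_add_distrib]
    refine Finset.sum_eq_zero fun i _ => ?_
    rw [haz, Fin.val_castSucc]
    ring
  · exact ((Finset.analyticAt_fun_sum _ fun j _ =>
      analyticAt_const.fun_mul (hg j)).frequently_eq_iff_eventually_eq analyticAt_const).mp
      hc.frequently

end LocalExistence

section RationalFunctions

universe u

variable {K 𝕜 : Type u} [Field K] [NontriviallyNormedField 𝕜] (σ : K →+* 𝕜)

lemma analyticAt_eval₂ (P : K[X]) (α : 𝕜) : AnalyticAt 𝕜 (fun z => P.eval₂ σ z) α := by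
  simp only [← eval_map]
  exact AnalyticOnNhd.eval_polynomial _ α trivial

lemma eventually_nhdsNE_eval₂_ne_zero {P : K[X]} (hP : P ≠ 0) (α : 𝕜) :
    ∀ᶠ z in 𝓝[≠] α, P.eval₂ σ z ≠ 0 := by
  have hfin : ({z | (P.map σ).IsRoot z} \ {α}).Finite :=
    (finite_setOfPred_isRoot ((Polynomial.map_ne_zero_iff σ.injective).mpr hP)).subset
      Set.sdiff_subset
  filter_upwards [nhdsWithin_le_nhds (hfin.isClosed.isOpen_compl.mem_nhds (x := α) (by simp)),
    self_mem_nhdsWithin] with z hz hzα hz0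
  exact hz ⟨by simpa [IsRoot.def, eval_map] using hz0, hzα⟩

lemma meromorphicAt_ratFunc_eval (r : K⟮X⟯) (α : 𝕜) : MeromorphicAt (fun z => r.eval σ z) α :=
  (analyticAt_eval₂ σ r.num α).meromorphicAt.fun_div (analyticAt_eval₂ σ r.denom α).meromorphicAt

lemma analyticAt_ratFunc_eval {r : K⟮X⟯} {α : 𝕜} (hr : r.denom.eval₂ σ α ≠ 0) :
    AnalyticAt 𝕜 (fun z => r.eval σ z) α :=
  (analyticAt_eval₂ σ r.num α).fun_div (analyticAt_eval₂ σ r.denom α) hr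

lemma eventually_ratFunc_eval_mul (r s : K⟮X⟯) (α : 𝕜) :
    ∀ᶠ z in 𝓝[≠] α, (r * s).eval σ z = r.eval σ z * s.eval σ z := by
  filter_upwards [eventually_nhdsNE_eval₂_ne_zero σ r.denom_ne_zero α,
    eventually_nhdsNE_eval₂_ne_zero σ s.denom_ne_zero α] with z hr hs
  exact RatFunc.eval_mul σ z hr hs

lemma eventually_ratFunc_eval_ne_zero {r : K⟮X⟯} (hr : r ≠ 0) (α : 𝕜) :
    ∀ᶠ z in 𝓝[≠] α, r.eval σ z ≠ 0 := by
  filter_upwards [eventually_nhdsNE_eval₂_ne_zero σ (RatFunc.num_ne_zero hr) α,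
    eventually_nhdsNE_eval₂_ne_zero σ r.denom_ne_zero α] with z hnum hdenom
  exact div_ne_zero hnum hdenom

end RationalFunctions

section LaurentMap

open scoped Differential

variable {R S : Type*} [CommRing R] [CommRing S] (σ : R →+* S)

/-- The extension of a ring homomorphism to Laurent series, acting on coefficients. -/
def laurentMap : R⸨X⸩ →+* S⸨X⸩ where
  toFun s := s.map σ
  map_one' := by ext n; simp [HahnSeries.coeff_one, apply_ite σ]
  map_mul' s t := HahnSeries.map_mul (σ : R →ₙ+* S)
  map_zero' := by ext; simp
  map_add' s t := by ext; simp

lemma laurentMap_coe (f : R⟦X⟧) : laurentMap σ f = (f.map σ : S⟦X⟧) := by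
  ext n
  change σ ((f : R⸨X⸩).coeff n) = _
  rw [PowerSeries.coeff_coe, PowerSeries.coeff_coe]
  split_ifs <;> simp

lemma derivative_map (f : R⟦X⟧) :
    PowerSeries.derivative S (f.map σ) = (PowerSeries.derivative R f).map σ := by
  ext n
  simp [PowerSeries.coeff_derivative]

lemma iterate_derivative_map (f : R⟦X⟧) (n : ℕ) :
    (PowerSeries.derivative S)^[n] (f.map σ) = ((PowerSeries.derivative R)^[n] f).map σ :=
  (Function.Semiconj.iterate_right (fun g => (derivative_map σ g).symm) n f).symm

end LaurentMap

lemma denom_mul_self {K : Type*} [Field K] (r : K⟮X⟯) :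
    (r.denom : K⟮X⟯) * r = r.num := by
  rw [mul_comm]
  exact ((div_eq_iff (RatFunc.algebraMap_ne_zero r.denom_ne_zero)).mp r.num_div_denom).symm

section LaurentRatFunc

universe u

variable {K 𝕜 : Type u} [Field K] [NontriviallyNormedField 𝕜] [CompleteSpace 𝕜] [CharZero 𝕜]

lemma taylor_eval₂_zero (σ : K →+* 𝕜) (P : K[X]) :
    taylor (fun z => P.eval₂ σ z) 0 = (P : K⟦X⟧).map σ := by
  simp only [← eval_map]
  rw [taylor_polynomial_zero, polynomial_map_coe]

lemma laurent_ratFunc_eval_zero (σ : K →+* 𝕜) (r : K⟮X⟯) :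
    laurent (fun z => r.eval σ z) 0 = laurentMap σ (algebraMap K⟮X⟯ K⸨X⸩ r) := by
  have hpoly (P : K[X]) : laurent (fun z => P.eval₂ σ z) 0 = laurentMap σ ((P : K⟦X⟧) : K⸨X⸩) := by
    rw [laurent_eq_taylor (analyticAt_eval₂ σ P 0), taylor_eval₂_zero, laurentMap_coe]
  have hmul : laurent (fun z => r.denom.eval₂ σ z) 0 * laurent (fun z => r.eval σ z) 0 =
      laurent (fun z => r.num.eval₂ σ z) 0 := by
    rw [← laurent_mul (analyticAt_eval₂ σ _ 0).meromorphicAt (meromorphicAt_ratFunc_eval σ r 0)]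
    refine laurent_congr (analyticAt_eval₂ σ _ 0).meromorphicAt ?_
    filter_upwards [eventually_nhdsNE_eval₂_ne_zero σ r.denom_ne_zero 0] with z hz
    exact mul_div_cancel₀ _ hz
  have hdenom : ((r.denom : K⟦X⟧) : K⸨X⸩) ≠ 0 := by
    simpa [RatFunc.coe_coe] using r.denom_ne_zero
  refine mul_left_cancel₀ ((map_ne_zero (laurentMap σ)).mpr hdenom) ?_
  rw [← hpoly, hmul, hpoly, hpoly, ← map_mul]
  rw [RatFunc.coe_coe, RatFunc.coe_coe, ← map_mul, denom_mul_self]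

end LaurentRatFunc

namespace DiffOp

/-- The coefficients of `L` as functions on `ℂ`, with value `0` at their poles. -/
noncomputable def coeffFun (L : DiffOp) (i : Fin (L.order + 1)) (z : ℂ) : ℂ :=
  (L.coeff i).eval (algebraMap Qbar ℂ) z

variable (L : DiffOp)

lemma meromorphicAt_coeffFun (i : Fin (L.order + 1)) (α : ℂ) : MeromorphicAt (L.coeffFun i) α :=
  meromorphicAt_ratFunc_eval _ _ α

lemma not_eventually_coeffFun_last_eq_zero (α : ℂ) :
    ¬ ∀ᶠ z in 𝓝[≠] α, L.coeffFun (Fin.last L.order) z = 0 := fun h =>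
  ((eventually_ratFunc_eval_ne_zero (algebraMap Qbar ℂ) L.lead_ne_zero α).and h).exists.elim
    fun _ hz => hz.1 hz.2

lemma sum_laurent_coeffFun_eq_zero {f : Qbar⟦X⟧} (hf : L.applyFormal f = 0) :
    ∑ i, laurent (L.coeffFun i) 0 *
      (⇑Differential.deriv)^[i] ((f.map (algebraMap Qbar ℂ) : ℂ⟦X⟧) : ℂ⸨X⸩) = 0 := by
  rw [← map_zero (laurentMap (algebraMap Qbar ℂ)), ← hf, applyFormal, map_sum]
  refine Finset.sum_congr rfl fun i _ => ?_
  rw [map_mul, laurentMap_coe, ← iterate_derivative_map, iterate_deriv_coe_powerSeries]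
  congr 1
  exact laurent_ratFunc_eval_zero _ _

lemma finite_setOf_isSingularPoint : {α | L.IsSingularPoint α}.Finite := by
  have hunion : {α | L.IsSingularPoint α} = ⋃ i, {α : ℂ |
      ((L.coeff i / L.coeff (Fin.last L.order)).denom.map (algebraMap Qbar ℂ)).IsRoot α} := by
    ext α
    simp [IsSingularPoint, IsRoot.def, aeval_def, eval_map]
  rw [hunion]
  exact Set.finite_iUnion fun i => finite_setOfPred_isRoot
    ((Polynomial.map_ne_zero_iff (algebraMap Qbar ℂ).injective).mpr (RatFunc.denom_ne_zero _))

lemma exists_analytic_isSolutionBasisNear {α : ℂ} (hα : ¬ L.IsSingularPoint α) :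
    ∃ g, (∀ j, AnalyticAt ℂ (g j) α) ∧ IsSolutionBasisNear L.coeffFun α g := by
  rw [IsSingularPoint, not_exists] at hα
  refine Holonomy.exists_analytic_isSolutionBasisNear
    (fun i : Fin L.order => analyticAt_ratFunc_eval (algebraMap Qbar ℂ) (hα i.castSucc)) fun i => ?_
  filter_upwards [eventually_ratFunc_eval_mul (algebraMap Qbar ℂ)
    (L.coeff i.castSucc / L.coeff (Fin.last L.order)) (L.coeff (Fin.last L.order)) α] with z hz
  rwa [div_mul_cancel₀ _ L.lead_ne_zero] at hz

variable {L}

lemma exists_isSolutionBasisNear {U : Set ℂ}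
    (hL : ∀ α ∈ U, L.IsSingularPoint α → L.TrivialMonodromyAt α) {α : ℂ} (hα : α ∈ U) :
    ∃ g, (¬ L.IsSingularPoint α → ∀ j, AnalyticAt ℂ (g j) α) ∧
      IsSolutionBasisNear L.coeffFun α g := by
  by_cases hs : L.IsSingularPoint α
  · obtain ⟨g, hmer, hsol, hind, -⟩ := hL α hα hs
    exact ⟨g, fun h => absurd hs h, hmer, hsol, hind⟩
  · obtain ⟨g, hg, hbasis⟩ := L.exists_analytic_isSolutionBasisNear hs
    exact ⟨g, fun _ => hg, hbasis⟩

end DiffOp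

section Continuation

variable {E F : Type*} [NormedAddCommGroup E] [NormedSpace ℂ E] [NormedAddCommGroup F]
  [NormedSpace ℂ F]

lemma eqOn_ball_inter_ball {C : Set E} (hCo : IsOpen C) (hC : Convex ℝ C) {δ : ℝ} {M : E → F}
    (hM : AnalyticOnNhd ℂ M C) {z z' : E} (hz : z ∈ C) (hz' : z' ∈ C) {s s' : E → F}
    (hs : AnalyticOnNhd ℂ s (Metric.ball z δ)) (hs' : AnalyticOnNhd ℂ s' (Metric.ball z' δ))
    (hsM : s =ᶠ[𝓝 z] M) (hsM' : s' =ᶠ[𝓝 z'] M) :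
    Set.EqOn s s' (Metric.ball z δ ∩ Metric.ball z' δ) := by
  have heqOn {z : E} {s : E → F} (hz : z ∈ C) (hs : AnalyticOnNhd ℂ s (Metric.ball z δ))
      (hsM : s =ᶠ[𝓝 z] M) : Set.EqOn s M (Metric.ball z δ ∩ C) := fun v hv =>
    AnalyticOnNhd.eqOn_of_preconnected_of_eventuallyEq (hs.mono Set.inter_subset_left)
      (hM.mono Set.inter_subset_right) ((convex_ball z δ).inter hC).isPreconnected
      ⟨Metric.mem_ball_self (Metric.pos_of_mem_ball hv.1), hz⟩ hsM hv
  intro v hv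
  have hzz' : dist z z' < 2 * δ := by
    linarith [dist_triangle z v z', Metric.mem_ball'.mp hv.1, Metric.mem_ball.mp hv.2]
  have hm : midpoint ℝ z z' ∈ C := hC.midpoint_mem hz hz'
  have hmz : midpoint ℝ z z' ∈ Metric.ball z δ := by
    rw [Metric.mem_ball, dist_midpoint_left, Real.norm_ofNat]
    linarith
  have hmz' : midpoint ℝ z z' ∈ Metric.ball z' δ := by
    rw [Metric.mem_ball, dist_midpoint_right, Real.norm_ofNat]
    linarith
  refine AnalyticOnNhd.eqOn_of_preconnected_of_eventuallyEq (hs.mono Set.inter_subset_left)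
    (hs'.mono Set.inter_subset_right) ((convex_ball z δ).inter (convex_ball z' δ)).isPreconnected
    ⟨hmz, hmz'⟩ ?_ hv
  filter_upwards [Metric.isOpen_ball.mem_nhds hmz, Metric.isOpen_ball.mem_nhds hmz',
    hCo.mem_nhds hm] with u hu hu' huC
  rw [heqOn hz hs hsM ⟨hu, huC⟩, heqOn hz' hs' hsM' ⟨hu', huC⟩]

/-- A property `S M z` of a function `M` and a point `z` which only depends on the germ of `M` at
`z`, and which forces this germ to be analytic. -/
structure IsAnalyticGermProperty (S : (E → F) → E → Prop) : Prop where
  analyticAt : ∀ {M z}, S M z → AnalyticAt ℂ M z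
  congr : ∀ {M M' z}, S M z → M =ᶠ[𝓝 z] M' → S M' z

namespace IsAnalyticGermProperty

variable {S : (E → F) → E → Prop}

lemma exists_extension_thickening (hS : IsAnalyticGermProperty S) {C : Set E} (hCo : IsOpen C)
    (hC : Convex ℝ C) {δ : ℝ} (hδ : 0 < δ)
    (hext : ∀ w ∈ C, ∀ M, S M w → ∃ M', (∀ v ∈ Metric.ball w δ, S M' v) ∧ M' =ᶠ[𝓝 w] M)
    {M : E → F} (hM : ∀ z ∈ C, S M z) :
    ∃ M', (∀ z ∈ Metric.thickening δ C, S M' z) ∧ Set.EqOn M' M C := by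
  choose! s hs hsM using fun z (hz : z ∈ C) => hext z hz M (hM z hz)
  have hagree (z : E) (hz : z ∈ C) (z' : E) (hz' : z' ∈ C) :
      Set.EqOn (s z) (s z') (Metric.ball z δ ∩ Metric.ball z' δ) :=
    eqOn_ball_inter_ball hCo hC (fun v hv => hS.analyticAt (hM v hv)) hz hz'
      (fun v hv => hS.analyticAt (hs z hz v hv)) (fun v hv => hS.analyticAt (hs z' hz' v hv))
      (hsM z hz) (hsM z' hz')
  choose! c hcC hc using fun w (hw : w ∈ Metric.thickening δ C) => Metric.mem_thickening_iff.mp hw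
  refine ⟨fun w => s (c w) w, fun w hw => hS.congr (hs _ (hcC w hw) w (hc w hw)) ?_, fun z hz => ?_⟩
  · filter_upwards [Metric.isOpen_thickening.mem_nhds hw, Metric.isOpen_ball.mem_nhds (hc w hw)]
      with v hv hvw
    exact hagree _ (hcC w hw) _ (hcC v hv) ⟨hvw, hc v hv⟩
  · have hzC := Metric.self_subset_thickening hδ C hz
    rw [← (hsM z hz).eq_of_nhds]
    exact hagree _ (hcC z hzC) z hz ⟨hc z hzC, Metric.mem_ball_self hδ⟩

lemma exists_continuation_closedBall_of_uniform (hS : IsAnalyticGermProperty S) {x : E} {R δ : ℝ}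
    (hR : 0 < R) (hδ : 0 < δ)
    (hext : ∀ w ∈ Metric.closedBall x R, ∀ M, S M w →
      ∃ M', (∀ v ∈ Metric.ball w δ, S M' v) ∧ M' =ᶠ[𝓝 w] M) {M₀ : E → F} (h0 : S M₀ x) :
    ∃ M, (∀ z ∈ Metric.closedBall x R, S M z) ∧ M =ᶠ[𝓝 x] M₀ := by
  have hstep {r : ℝ} (hr : 0 < r) (hrR : r ≤ R) {M : E → F} (hM : ∀ z ∈ Metric.ball x r, S M z)
      (hMx : M =ᶠ[𝓝 x] M₀) : ∃ M', (∀ z ∈ Metric.ball x (δ + r), S M' z) ∧ M' =ᶠ[𝓝 x] M₀ := by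
    obtain ⟨M', hM', heq⟩ := hS.exists_extension_thickening Metric.isOpen_ball (convex_ball x r) hδ
      (fun w hw => hext w (Metric.ball_subset_closedBall.trans
        (Metric.closedBall_subset_closedBall hrR) hw)) hM
    rw [thickening_ball hδ hr] at hM'
    exact ⟨M', hM', (heq.eventuallyEq_of_mem (Metric.ball_mem_nhds x hr)).trans hMx⟩
  have hind (k : ℕ) : ∃ M, (∀ z ∈ Metric.ball x (min ((k + 1) * δ) R), S M z) ∧ M =ᶠ[𝓝 x] M₀ := by
    induction k with
    | zero =>
      obtain ⟨M, hM, hMx⟩ := hext x (Metric.mem_closedBall_self hR.le) M₀ h0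
      exact ⟨M, fun z hz => hM z (Metric.ball_subset_ball (by simp) hz), hMx⟩
    | succ k ih =>
      obtain ⟨M, hM, hMx⟩ := ih
      obtain ⟨M', hM', hMx'⟩ := hstep (by positivity) (min_le_right _ _) hM hMx
      refine ⟨M', fun z hz => hM' z (Metric.ball_subset_ball ?_ hz), hMx'⟩
      rw [← min_add_add_left]
      refine min_le_min (by push_cast; linarith) (by linarith)
  obtain ⟨k, hk⟩ := exists_nat_gt (R / δ)
  have hkR : R ≤ (k + 1) * δ := by
    rw [div_lt_iff₀ hδ] at hk
    linarith
  obtain ⟨M, hM, hMx⟩ := hind k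
  rw [min_eq_right hkR] at hM
  obtain ⟨M', hM', hMx'⟩ := hstep hR le_rfl hM hMx
  exact ⟨M', fun z hz => hM' z (Metric.closedBall_subset_ball (by linarith) hz), hMx'⟩

lemma exists_continuation_closedBall [ProperSpace E] (hS : IsAnalyticGermProperty S) {x : E} {R : ℝ}
    (hR : 0 < R)
    (hext : ∀ z ∈ Metric.closedBall x R, ∃ V ∈ 𝓝 z, ∀ w ∈ V, ∀ M, S M w →
      ∃ M', (∀ v ∈ V, S M' v) ∧ M' =ᶠ[𝓝 w] M) {M₀ : E → F} (h0 : S M₀ x) :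
    ∃ M, (∀ z ∈ Metric.closedBall x R, S M z) ∧ M =ᶠ[𝓝 x] M₀ := by
  choose! V hV hext using hext
  obtain ⟨W, hW, hWV⟩ := lebesgue_number_lemma_nhds' (isCompact_closedBall x R) hV
  obtain ⟨δ, hδ, hδW⟩ := Metric.mem_uniformity_dist.mp hW
  refine hS.exists_continuation_closedBall_of_uniform hR hδ (fun w hw M hM => ?_) h0
  obtain ⟨z, hz⟩ := hWV w hw
  have hsub : Metric.ball w δ ⊆ V z := fun v hv => hz (hδW (Metric.mem_ball'.mp hv))
  obtain ⟨M', hM', hMw⟩ := hext z z.2 w (hsub (Metric.mem_ball_self hδ)) M hM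
  exact ⟨M', fun v hv => hM' v (hsub hv), hMw⟩

end IsAnalyticGermProperty

end Continuation

section Pullback

lemma eventually_nhds_eventually_nhdsNE {X : Type*} [TopologicalSpace X] [T1Space X]
    {P : X → Prop} {α : X} (h : ∀ᶠ z in 𝓝[≠] α, P z) :
    ∀ᶠ β in 𝓝 α, ∀ᶠ z in 𝓝[≠] β, P z := by
  filter_upwards [eventually_eventually_nhds.mpr (eventually_nhdsWithin_iff.mp h)] with β hβ
  by_cases hβα : β = α
  · rw [hβα]
    exact h
  · filter_upwards [nhdsWithin_le_nhds hβ, nhdsWithin_le_nhds (isOpen_ne.mem_nhds hβα)]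
      with z hz hzα using hz hzα

lemma eventually_nhds_meromorphicAt {f : ℂ → ℂ} {α : ℂ} (hf : MeromorphicAt f α) :
    ∀ᶠ β in 𝓝 α, MeromorphicAt f β := by
  filter_upwards [eventually_nhdsWithin_iff.mp hf.eventually_analyticAt] with β hβ
  by_cases hβα : β = α
  · rwa [hβα]
  · exact (hβ hβα).meromorphicAt

variable {n : ℕ} {a : Fin (n + 1) → ℂ → ℂ} {α : ℂ} {g : Fin n → ℂ → ℂ}

lemma IsSolutionBasisNear.eventually_nhds (hg : IsSolutionBasisNear a α g) :
    ∀ᶠ β in 𝓝 α, IsSolutionBasisNear a β g := by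
  have hmer := eventually_all.mpr fun j => eventually_nhds_meromorphicAt (hg.meromorphicAt j)
  have hsol := eventually_all.mpr fun j => eventually_nhds_eventually_nhdsNE (hg.isSolution j)
  obtain ⟨ε, hε, hball⟩ := Metric.eventually_nhds_iff_ball.mp (hmer.and hsol)
  filter_upwards [Metric.ball_mem_nhds α hε] with β hβ
  refine ⟨(hball β hβ).1, (hball β hβ).2, fun c hc => hg.eq_zero_of_sum c ?_⟩
  rw [← meromorphicOrderAt_eq_top_iff] at hc ⊢
  contrapose! hc
  have hsum : MeromorphicOn (fun z => ∑ j, c j * g j z) (Metric.ball α ε) := fun z hz =>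
    meromorphicAt_sum_const_mul (hball z hz).1 c
  exact hsum.meromorphicOrderAt_ne_top_of_isPreconnected
    (convex_ball α ε).isPreconnected (Metric.mem_ball_self hε) hβ hc

lemma eventually_nhdsNE_eval_ne_zero {Q : ℂ[X]} (hQ : Q ≠ 0) (α : ℂ) :
    ∀ᶠ z in 𝓝[≠] α, Q.eval z ≠ 0 :=
  eventually_nhdsNE_eval₂_ne_zero (RingHom.id ℂ) hQ α

lemma analyticAt_eval (Q : ℂ[X]) (α : ℂ) : AnalyticAt ℂ (fun z => Q.eval z) α :=
  analyticAt_eval₂ (RingHom.id ℂ) Q α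

lemma exists_pow_mul_analyticAt {ι : Type*} [Finite ι] {g : ι → ℂ → ℂ} {α : ℂ}
    (hg : ∀ j, MeromorphicAt (g j) α) : ∃ N : ℕ, ∀ Q : ℂ[X], (X - C α) ^ N ∣ Q →
      ∀ j, AnalyticAt ℂ (fun z => Q.eval z * g j z) α := by
  have := Fintype.ofFinite ι
  choose e he using hg
  refine ⟨∑ j, e j, fun Q hQ j => ?_⟩
  obtain ⟨P, rfl⟩ := (pow_dvd_pow _ (Finset.single_le_sum_of_canonicallyOrdered
    (Finset.mem_univ j))).trans hQ
  refine ((analyticAt_eval P α).fun_mul (he j)).congr (.of_forall fun z => ?_)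
  simp only [eval_mul, eval_pow, eval_sub, eval_X, eval_C, smul_eq_mul]
  ring

lemma exists_polynomial_mul_analyticAt {U s : Set ℂ} (hs : s.Finite)
    (hU : ∀ α ∈ U, ∃ g, (α ∉ s → ∀ j, AnalyticAt ℂ (g j) α) ∧ IsSolutionBasisNear a α g) :
    ∃ Q : ℂ[X], Q ≠ 0 ∧ ∀ α ∈ U, ∃ g, IsSolutionBasisNear a α g ∧
      ∀ j, AnalyticAt ℂ (fun z => Q.eval z * g j z) α := by
  choose! g han hg using hU
  choose! N hN using fun α hα => exists_pow_mul_analyticAt (hg α hα).meromorphicAt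
  refine ⟨∏ α ∈ hs.toFinset, (X - C α) ^ N α,
    Finset.prod_ne_zero_iff.mpr fun α _ => pow_ne_zero _ (X_sub_C_ne_zero α),
    fun α hα => ⟨g α, hg α hα, ?_⟩⟩
  by_cases hαs : α ∈ s
  · exact hN α hα _ (Finset.dvd_prod_of_mem _ (hs.mem_toFinset.mpr hαs))
  · exact fun j => (analyticAt_eval _ α).fun_mul (han α hα hαs j)

/-- Near `z`, the function `M` is the pullback by `φ` of a function `Q * h`, analytic at `φ z`,
where `h` is a solution of the differential equation with coefficients `a`. -/
def IsPullbackNear (a : Fin (n + 1) → ℂ → ℂ) (Q : ℂ[X]) (φ M : ℂ → ℂ) (z : ℂ) : Prop :=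
  AnalyticAt ℂ φ z ∧ ∃ h : ℂ → ℂ, IsODESolutionNear a (φ z) h ∧
    AnalyticAt ℂ (fun w => Q.eval w * h w) (φ z) ∧
    M =ᶠ[𝓝 z] fun w => Q.eval (φ w) * h (φ w)

lemma isAnalyticGermProperty_isPullbackNear (a : Fin (n + 1) → ℂ → ℂ) (Q : ℂ[X]) (φ : ℂ → ℂ) :
    IsAnalyticGermProperty (IsPullbackNear a Q φ) where
  analyticAt := fun ⟨hφ, _, _, hQh, hM⟩ => (hQh.comp hφ).congr hM.symm
  congr := fun ⟨hφ, h, hh, hQh, hM⟩ hMM' => ⟨hφ, h, hh, hQh, hMM'.symm.trans hM⟩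

variable {Q : ℂ[X]}

lemma IsSolutionBasisNear.exists_eval_mul_eventuallyEq_sum (hg : IsSolutionBasisNear a α g)
    (ha : ∀ i, MeromorphicAt (a i) α) (hlast : ¬ ∀ᶠ z in 𝓝[≠] α, a (Fin.last n) z = 0) (hQ : Q ≠ 0)
    (hQg : ∀ j, AnalyticAt ℂ (fun z => Q.eval z * g j z) α) {h : ℂ → ℂ}
    (hh : IsODESolutionNear a α h) (hQh : AnalyticAt ℂ (fun z => Q.eval z * h z) α) :
    ∃ c : Fin n → ℂ, AnalyticAt ℂ (fun z => Q.eval z * ∑ j, c j * g j z) α ∧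
      (fun z => Q.eval z * h z) =ᶠ[𝓝 α] fun z => Q.eval z * ∑ j, c j * g j z := by
  have hmer : MeromorphicAt h α := by
    refine (hQh.meromorphicAt.fun_div (analyticAt_eval Q α).meromorphicAt).congr ?_
    filter_upwards [eventually_nhdsNE_eval_ne_zero hQ α] with z hz
    rw [mul_div_cancel_left₀ _ hz]
  obtain ⟨c, hc⟩ := hg.exists_eventuallyEq_sum ha hlast hmer hh
  have han : AnalyticAt ℂ (fun z => Q.eval z * ∑ j, c j * g j z) α := by
    simp only [Finset.mul_sum, mul_left_comm (Q.eval _)]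
    exact Finset.analyticAt_fun_sum _ fun j _ => analyticAt_const.fun_mul (hQg j)
  refine ⟨c, han, (hQh.frequently_eq_iff_eventually_eq han).mp (Eventually.frequently ?_)⟩
  filter_upwards [hc] with z hz
  rw [hz]

lemma IsSolutionBasisNear.exists_isPullbackNear_extension {φ : ℂ → ℂ} {z : ℂ}
    (ha : ∀ α i, MeromorphicAt (a i) α) (hlast : ∀ α, ¬ ∀ᶠ z in 𝓝[≠] α, a (Fin.last n) z = 0)
    (hQ : Q ≠ 0) (hg : IsSolutionBasisNear a (φ z) g)
    (hQg : ∀ j, AnalyticAt ℂ (fun w => Q.eval w * g j w) (φ z)) (hφ : AnalyticAt ℂ φ z) :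
    ∃ V ∈ 𝓝 z, ∀ w ∈ V, ∀ M, IsPullbackNear a Q φ M w →
      ∃ M', (∀ v ∈ V, IsPullbackNear a Q φ M' v) ∧ M' =ᶠ[𝓝 w] M := by
  have hnear := hφ.continuousAt.eventually <| hg.eventually_nhds.and <|
    eventually_all.mpr fun j => (hQg j).eventually_analyticAt
  refine ⟨_, hφ.eventually_analyticAt.and hnear, fun w ⟨hφw, hgw, hQgw⟩ M ⟨_, h, hh, hQh, hM⟩ => ?_⟩
  obtain ⟨c, -, hc⟩ :=
    hgw.exists_eval_mul_eventuallyEq_sum (ha _) (hlast _) hQ hQgw hh hQh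
  refine ⟨fun u => Q.eval (φ u) * ∑ j, c j * g j (φ u), fun v ⟨hφv, hgv, hQgv⟩ =>
    ⟨hφv, fun u => ∑ j, c j * g j u, IsODESolutionNear.sum hgv.isSolution c, ?_, .rfl⟩, ?_⟩
  · simp only [Finset.mul_sum, mul_left_comm (Q.eval _)]
    exact Finset.analyticAt_fun_sum _ fun j _ => analyticAt_const.fun_mul (hQgv j)
  · exact (hM.trans (hφw.continuousAt.eventually hc)).symm

/-- `f` converges near `0`, and, up to a polynomial multiple, `f ∘ φ` extends to a holomorphic
function on a neighbourhood of the closed unit disc. -/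
def ContinuesAlong (φ : ℂ → ℂ) (f : ℚ⟦X⟧) : Prop :=
  ∃ F : ℂ → ℂ, AnalyticAt ℂ F 0 ∧ taylor F 0 = f.map (algebraMap ℚ ℂ) ∧
    ∃ Q : ℂ[X], Q ≠ 0 ∧ ∃ M, AnalyticOnNhd ℂ M (Metric.closedBall 0 1) ∧
      M =ᶠ[𝓝 0] fun z => Q.eval (φ z) * F (φ z)

lemma continuesAlong_of_mem_H {U : Set ℂ} {x f : ℚ⟦X⟧} (hf : f ∈ H U x) {φ : ℂ → ℂ}
    (hφ : AnalyticOnNhd ℂ φ (Metric.closedBall 0 1))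
    (hφU : Set.MapsTo φ (Metric.closedBall 0 1) U) (hφ0 : φ 0 = 0) : ContinuesAlong φ f := by
  obtain ⟨-, L, hLf, hL⟩ := hf
  have ha (α i) : MeromorphicAt (L.coeffFun i) α := L.meromorphicAt_coeffFun i α
  have hlast := L.not_eventually_coeffFun_last_eq_zero
  obtain ⟨Q, hQ, hbasis⟩ := exists_polynomial_mul_analyticAt (U := U)
    L.finite_setOf_isSingularPoint fun α => DiffOp.exists_isSolutionBasisNear hL
  have h0 : (0 : ℂ) ∈ Metric.closedBall 0 1 := Metric.mem_closedBall_self zero_le_one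
  obtain ⟨g, hg, -⟩ := hbasis 0 (hφ0 ▸ hφU h0)
  obtain ⟨F, hF, hFf, hFsol⟩ := hg.exists_analyticAt_taylor_eq (ha 0) (hlast 0)
    (L.sum_laurent_coeffFun_eq_zero hLf)
  have hstart : IsPullbackNear L.coeffFun Q φ (fun z => Q.eval (φ z) * F (φ z)) 0 :=
    ⟨hφ 0 h0, F, hφ0.symm ▸ hFsol, hφ0.symm ▸ (analyticAt_eval Q 0).fun_mul hF, .rfl⟩
  have hpull := isAnalyticGermProperty_isPullbackNear L.coeffFun Q φ
  obtain ⟨M, hM, hM0⟩ := hpull.exists_continuation_closedBall zero_lt_one (fun z hz => by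
    obtain ⟨g, hg, hQg⟩ := hbasis (φ z) (hφU hz)
    exact hg.exists_isPullbackNear_extension ha hlast hQ hQg (hφ z hz)) hstart
  refine ⟨F, hF, ?_, Q, hQ, M, fun z hz => hpull.analyticAt (hM z hz), hM0⟩
  rw [hFf]
  ext k
  simp only [PowerSeries.coeff_map]
  exact (IsScalarTower.algebraMap_apply ℚ Qbar ℂ _).symm

end Pullback

section TensorCoeff

/-- The coefficient of `∏ j, x_j ^ n j` in `∑ I, a I * ∏ j, g_{I j}(x_j)`, where `g s` is the
sequence of coefficients of the power series `g_s`. -/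
def tensorCoeff {K S : Type*} [CommSemiring K] [Fintype S] {d : ℕ} (g : S → ℕ → K)
    (a : (Fin d → S) → K) (n : Fin d → ℕ) : K :=
  ∑ I : Fin d → S, a I * ∏ j, g (I j) (n j)

variable {K K' S : Type*} [Fintype S] {d : ℕ}

lemma map_tensorCoeff [CommSemiring K] [CommSemiring K'] (σ : K →+* K') (g : S → ℕ → K)
    (a : (Fin d → S) → K) (n : Fin d → ℕ) :
    σ (tensorCoeff g a n) = tensorCoeff (fun s k => σ (g s k)) (fun I => σ (a I)) n := by
  simp only [tensorCoeff, map_sum, map_mul, map_prod]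

lemma tensorCoeff_cons [CommSemiring K] (g : S → ℕ → K) (a : (Fin (d + 1) → S) → K) (k : ℕ)
    (n : Fin d → ℕ) :
    tensorCoeff g a (Fin.cons k n) = ∑ s, tensorCoeff g (fun I => a (Fin.cons s I)) n * g s k := by
  rw [tensorCoeff, ← (Fin.consEquiv fun _ => S).sum_comp, Fintype.sum_prod_type]
  refine Finset.sum_congr rfl fun s _ => ?_
  rw [tensorCoeff, Finset.sum_mul]
  refine Finset.sum_congr rfl fun I _ => ?_
  have hcons : (Fin.consEquiv fun _ => S) (s, I) = (Fin.cons s I : Fin (d + 1) → S) := rfl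
  rw [Fin.prod_univ_succ, hcons]
  simp only [Fin.cons_zero, Fin.cons_succ]
  ring

lemma eq_zero_of_tensorCoeff_eq_zero [CommRing K] {g : S → ℕ → K} (hg : LinearIndependent K g)
    {a : (Fin d → S) → K} (h : ∀ n, tensorCoeff g a n = 0) : a = 0 := by
  induction d with
  | zero =>
    ext I
    simpa [tensorCoeff, Subsingleton.elim I default] using h 0
  | succ d ih =>
    have hslice (s : S) (n : Fin d → ℕ) : tensorCoeff g (fun I => a (Fin.cons s I)) n = 0 := by
      refine Fintype.linearIndependent_iff.mp hg
        (fun s => tensorCoeff g (fun I => a (Fin.cons s I)) n) ?_ s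
      ext k
      rw [Pi.zero_apply, ← h (Fin.cons k n), tensorCoeff_cons, Finset.sum_apply]
      rfl
    ext I
    rw [← Fin.cons_self_tail I]
    exact congrFun (ih (hslice (I 0))) (Fin.tail I)

lemma exists_tensorCoeff_ne_zero_of_minimal [CommRing K] {g : S → ℕ → K}
    (hg : LinearIndependent K g) {a : (Fin d → S) → K} (ha : a ≠ 0) :
    ∃ n, tensorCoeff g a n ≠ 0 ∧ ∀ k : Fin d → ℕ, ∑ j, k j < ∑ j, n j → tensorCoeff g a k = 0 := by
  have hne : {n | tensorCoeff g a n ≠ 0}.Nonempty := by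
    by_contra hempty
    rw [Set.not_nonempty_iff_eq_empty, Set.eq_empty_iff_forall_notMem] at hempty
    exact ha (eq_zero_of_tensorCoeff_eq_zero hg fun n => not_not.mp (hempty n))
  have hwf := (measure fun n : Fin d → ℕ => ∑ j, n j).wf
  exact ⟨hwf.min _ hne, hwf.min_mem _ hne, fun k hk =>
    not_not.mp fun hk0 => hwf.not_lt_min _ hk0 hk⟩

lemma tensorCoeff_triangular [CommRing K] {g g' : S → ℕ → K} {t : ℕ → ℕ → K}
    (hg : ∀ s n, g' s n = ∑ k ∈ Finset.range (n + 1), t n k * g s k) (a : (Fin d → S) → K)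
    (n : Fin d → ℕ) (hlow : ∀ k : Fin d → ℕ, ∑ j, k j < ∑ j, n j → tensorCoeff g a k = 0) :
    tensorCoeff g' a n = (∏ j, t (n j) (n j)) * tensorCoeff g a n := by
  have hexpand : tensorCoeff g' a n = ∑ k ∈ Fintype.piFinset fun j => Finset.range (n j + 1),
      (∏ j, t (n j) (k j)) * tensorCoeff g a k := by
    simp only [tensorCoeff, hg, Finset.prod_univ_sum, Finset.mul_sum]
    rw [Finset.sum_comm]
    refine Finset.sum_congr rfl fun k _ => Finset.sum_congr rfl fun I _ => ?_
    rw [Finset.prod_mul_distrib]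
    ring
  have hn : n ∈ Fintype.piFinset fun j => Finset.range (n j + 1) :=
    Fintype.mem_piFinset.mpr fun j => Finset.self_mem_range_succ _
  rw [hexpand, Finset.sum_eq_single_of_mem n hn]
  intro k hk hkn
  have hle (j) : k j ≤ n j :=
    Nat.lt_succ_iff.mp (Finset.mem_range.mp (Fintype.mem_piFinset.mp hk j))
  have hlt : ∑ j, k j < ∑ j, n j := by
    refine (Finset.sum_le_sum fun j _ => hle j).lt_of_ne fun heq => hkn ?_
    exact funext fun j =>
      (Finset.sum_eq_sum_iff_of_le fun j _ => hle j).mp heq j (Finset.mem_univ j)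
  rw [hlow k hlt, mul_zero]

lemma norm_tensorCoeff_le [NormedField K] {g : S → ℕ → K} {a : (Fin d → S) → K} {B C : ℝ}
    (ha : ∀ I, ‖a I‖ ≤ B) (hg : ∀ s n, ‖g s n‖ ≤ C) (n : Fin d → ℕ) :
    ‖tensorCoeff g a n‖ ≤ (Fintype.card S : ℝ) ^ d * (B * C ^ d) := by
  calc ‖tensorCoeff g a n‖ ≤ ∑ _ : Fin d → S, B * C ^ d := by
        refine norm_sum_le_of_le _ fun I _ => ?_
        rw [norm_mul, norm_prod]
        have hprod : ∏ j, ‖g (I j) (n j)‖ ≤ C ^ d := by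
          simpa using Finset.prod_le_prod (fun j _ => norm_nonneg _) fun j (_ : j ∈ Finset.univ) =>
            hg (I j) (n j)
        exact mul_le_mul (ha I) hprod (Finset.prod_nonneg fun _ _ => norm_nonneg _)
          ((norm_nonneg _).trans (ha I))
    _ = (Fintype.card S : ℝ) ^ d * (B * C ^ d) := by simp

end TensorCoeff

section BoxPrinciple

lemma card_Icc_floor_le {X : ℝ} (hX : 0 ≤ X) : ((Finset.Icc ⌊-X⌋ ⌊X⌋).card : ℝ) ≤ 2 * X + 2 := by
  have hle : ⌊-X⌋ ≤ ⌊X⌋ := Int.floor_mono (by linarith)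
  have hcard : ((Finset.Icc ⌊-X⌋ ⌊X⌋).card : ℤ) = ⌊X⌋ + 1 - ⌊-X⌋ := by
    rw [Int.card_Icc, Int.toNat_of_nonneg (by linarith)]
  have hcard' : ((Finset.Icc ⌊-X⌋ ⌊X⌋).card : ℝ) = ⌊X⌋ + 1 - ⌊-X⌋ := by exact_mod_cast hcard
  linarith [Int.floor_le X, Int.lt_floor_add_one (-X)]

lemma exists_ne_forall_abs_sub_lt_one {α κ : Type*} [Fintype α] [Fintype κ] {L : α → κ → ℝ} {X : ℝ}
    (hX : 0 ≤ X) (hL : ∀ u k, |L u k| ≤ X)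
    (hcard : (2 * X + 2) ^ Fintype.card κ < (Fintype.card α : ℝ)) :
    ∃ u v, u ≠ v ∧ ∀ k, |L u k - L v k| < 1 := by
  classical
  have hmaps : ∀ u ∈ (Finset.univ : Finset α),
      (fun k => ⌊L u k⌋) ∈ Fintype.piFinset fun _ : κ => Finset.Icc ⌊-X⌋ ⌊X⌋ := fun u _ =>
    Fintype.mem_piFinset.mpr fun k => Finset.mem_Icc.mpr
      ⟨Int.floor_mono (abs_le.mp (hL u k)).1, Int.floor_mono (abs_le.mp (hL u k)).2⟩
  have hlt : (Fintype.piFinset fun _ : κ => Finset.Icc ⌊-X⌋ ⌊X⌋).card <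
      (Finset.univ : Finset α).card := by
    rw [Fintype.card_piFinset, Finset.prod_const, Finset.card_univ, Finset.card_univ]
    have := (pow_le_pow_left₀ (Nat.cast_nonneg _) (card_Icc_floor_le hX) _).trans_lt hcard
    exact_mod_cast this
  obtain ⟨u, -, v, -, huv, hfloor⟩ := Finset.exists_ne_map_eq_of_card_lt_of_maps_to hlt hmaps
  exact ⟨u, v, huv, fun k => Int.abs_sub_lt_one_of_floor_eq_floor (congrFun hfloor k)⟩

lemma exists_int_vec_abs_sum_lt_one {ι κ : Type*} [Fintype ι] [Fintype κ] {B : κ → ι → ℝ} {T : ℕ}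
    {Y : ℝ} (hB : ∀ k i, |B k i| ≤ Y) (hY : 1 ≤ Fintype.card ι * Y)
    (hcard : ((T + 1 : ℝ) * (2 * (Fintype.card ι * Y))) ^ Fintype.card κ <
      (T + 1 : ℝ) ^ Fintype.card ι) :
    ∃ a : ι → ℤ, a ≠ 0 ∧ (∀ i, |a i| ≤ T) ∧ ∀ k, |∑ i, (a i : ℝ) * B k i| < 1 := by
  classical
  have habs (u : ι → Fin (T + 1)) (k : κ) :
      |∑ i, ((u i : ℕ) : ℝ) * B k i| ≤ T * (Fintype.card ι * Y) := by
    calc |∑ i, ((u i : ℕ) : ℝ) * B k i| ≤ ∑ _ : ι, (T : ℝ) * Y := by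
          refine (Finset.abs_sum_le_sum_abs _ _).trans (Finset.sum_le_sum fun i _ => ?_)
          rw [abs_mul, Nat.abs_cast]
          have huT : ((u i : ℕ) : ℝ) ≤ T := by exact_mod_cast Nat.lt_succ_iff.mp (u i).2
          exact mul_le_mul huT (hB k i) (abs_nonneg _) (Nat.cast_nonneg _)
      _ = T * (Fintype.card ι * Y) := by
          rw [Finset.sum_const, Finset.card_univ, nsmul_eq_mul]
          ring
  obtain ⟨u, v, huv, hsub⟩ := exists_ne_forall_abs_sub_lt_one (by positivity) habs (by
    rw [Fintype.card_fun, Fintype.card_fin]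
    push_cast
    refine lt_of_le_of_lt (pow_le_pow_left₀ (by positivity) ?_ _) hcard
    linarith)
  refine ⟨fun i => ((u i : ℕ) : ℤ) - ((v i : ℕ) : ℤ), fun hzero => huv ?_, fun i => ?_, fun k => ?_⟩
  · ext i
    have := congrFun hzero i
    simp only [Pi.zero_apply] at this
    omega
  · have := (u i).2
    have := (v i).2
    change |((u i : ℕ) : ℤ) - ((v i : ℕ) : ℤ)| ≤ T
    rw [abs_le]
    constructor <;> omega
  · push_cast
    simpa only [sub_mul, Finset.sum_sub_distrib] using hsub k

/-- The exponents `n ∈ ℕ ^ d` of total degree less than `A`. -/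
def lowDegree (d A : ℕ) : Finset (Fin d → ℕ) :=
  (Fintype.piFinset fun _ => Finset.range A).filter fun n => ∑ j, n j < A

lemma mem_lowDegree {d A : ℕ} {n : Fin d → ℕ} : n ∈ lowDegree d A ↔ ∑ j, n j < A := by
  rw [lowDegree, Finset.mem_filter, Fintype.mem_piFinset, and_iff_right_iff_imp]
  intro h j
  exact Finset.mem_range.mpr
    ((Finset.single_le_sum_of_canonicallyOrdered (Finset.mem_univ j)).trans_lt h)

lemma card_lowDegree_le_choose (d A : ℕ) : (lowDegree d A).card ≤ (d + A).choose d := by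
  calc (lowDegree d A).card
      ≤ (Finset.finsuppAntidiag (Finset.univ : Finset (Fin (d + 1))) A).card := by
        refine Finset.card_le_card_of_injOn (fun n => Finsupp.equivFunOnFinite.symm
          (Fin.cons (A - ∑ j, n j) n : Fin (d + 1) → ℕ)) (fun n hn => ?_) fun n _ n' _ hnn' =>
          (Fin.cons_inj.mp (Finsupp.equivFunOnFinite.symm.injective hnn')).2
        rw [Finset.mem_coe, Finset.mem_finsuppAntidiag]
        exact ⟨by simp [Fin.sum_univ_succ, (mem_lowDegree.mp hn).le], Finset.subset_univ _⟩
    _ = (d + A).choose d := by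
        rw [Finset.card_finsuppAntidiag_nat_eq_choose, Finset.card_univ, Fintype.card_fin,
          Nat.add_right_comm, Nat.add_sub_cancel, Nat.choose_symm_add]

lemma card_lowDegree_mul_factorial_le (d A : ℕ) :
    (lowDegree d A).card * d.factorial ≤ (A + d) ^ d := by
  calc (lowDegree d A).card * d.factorial ≤ (d + A).choose d * d.factorial := by
        gcongr
        exact card_lowDegree_le_choose d A
    _ = (A + d).descFactorial d := by
        rw [Nat.descFactorial_eq_factorial_mul_choose, mul_comm, add_comm]
    _ ≤ (A + d) ^ d := Nat.descFactorial_le_pow _ _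

lemma exists_floor_rpow_bounds {Y : ℝ} (hY : 0 < Y) {K : ℕ} (hK : 0 < K) :
    ∃ T : ℕ, (T : ℝ) ≤ Y ^ (1 / K : ℝ) ∧ Y < (T + 1 : ℝ) ^ K := by
  refine ⟨⌊Y ^ (1 / K : ℝ)⌋₊, Nat.floor_le (by positivity), ?_⟩
  calc Y = (Y ^ (1 / K : ℝ)) ^ K := by rw [one_div, Real.rpow_inv_natCast_pow hY.le hK.ne']
    _ < _ := pow_lt_pow_left₀ (Nat.lt_floor_add_one _) (by positivity) hK.ne'

lemma exists_int_tensorCoeff_abs_lt_one {S : Type*} [Fintype S] [Nonempty S] {g : S → ℕ → ℝ}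
    {d A K : ℕ} (hA : 0 < A) (hK : 0 < K) {C R : ℝ} (hC : 1 ≤ C) (hR : 1 ≤ R)
    (hg : ∀ s n, |g s n| ≤ C * R ^ n)
    (hcard : (lowDegree d A).card * (K + 1) ≤ Fintype.card S ^ d) :
    ∃ a : (Fin d → S) → ℤ, a ≠ 0 ∧
      (∀ I, |(a I : ℝ)| ≤
        (2 * ((Fintype.card S : ℝ) ^ d * (C ^ d * R ^ A))) ^ (1 / K : ℝ)) ∧
      ∀ n : Fin d → ℕ, ∑ j, n j < A → |tensorCoeff g (fun I => (a I : ℝ)) n| < 1 := by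
  classical
  have hS : 1 ≤ (Fintype.card S : ℝ) := by exact_mod_cast Fintype.card_pos
  have hprod (n : lowDegree d A) (I : Fin d → S) :
      |∏ j, g (I j) ((n : Fin d → ℕ) j)| ≤ C ^ d * R ^ A := by
    calc |∏ j, g (I j) ((n : Fin d → ℕ) j)| ≤ ∏ j, C * R ^ (n : Fin d → ℕ) j := by
          rw [Finset.abs_prod]
          exact Finset.prod_le_prod (fun _ _ => abs_nonneg _) fun j _ => hg _ _
      _ = C ^ d * R ^ ∑ j, (n : Fin d → ℕ) j := by
          simp [Finset.prod_mul_distrib, Finset.prod_pow_eq_pow_sum]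
      _ ≤ C ^ d * R ^ A := by
          gcongr
          exact (mem_lowDegree.mp n.2).le
  obtain ⟨T, hT, hYT⟩ := exists_floor_rpow_bounds (K := K)
    (Y := 2 * ((Fintype.card S : ℝ) ^ d * (C ^ d * R ^ A))) (by positivity) hK
  set Y := 2 * ((Fintype.card S : ℝ) ^ d * (C ^ d * R ^ A)) with hY
  have hlow : (lowDegree d A).card ≠ 0 :=
    Finset.card_ne_zero_of_mem (a := 0) (mem_lowDegree.mpr (by simpa using hA))
  have hcount : ((T + 1 : ℝ) * Y) ^ (lowDegree d A).card < (T + 1 : ℝ) ^ Fintype.card S ^ d := by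
    calc ((T + 1 : ℝ) * Y) ^ (lowDegree d A).card
        < ((T + 1 : ℝ) * (T + 1 : ℝ) ^ K) ^ (lowDegree d A).card := by gcongr
      _ = (T + 1 : ℝ) ^ ((lowDegree d A).card * (K + 1)) := by
          rw [← pow_succ', ← pow_mul, mul_comm]
      _ ≤ (T + 1 : ℝ) ^ Fintype.card S ^ d :=
          pow_le_pow_right₀ (by linarith [T.cast_nonneg (α := ℝ)]) hcard
  obtain ⟨a, ha, haT, hsmall⟩ := exists_int_vec_abs_sum_lt_one (T := T) hprod
    (by
      rw [Fintype.card_fun, Fintype.card_fin, Nat.cast_pow]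
      exact one_le_mul_of_one_le_of_one_le (one_le_pow₀ hS)
        (one_le_mul_of_one_le_of_one_le (one_le_pow₀ hC) (one_le_pow₀ hR)))
    (by simpa only [Fintype.card_fun, Fintype.card_fin, Nat.cast_pow, Fintype.card_coe]
      using hcount)
  refine ⟨a, ha, fun I => le_trans (by exact_mod_cast haT I) hT, fun n hn => ?_⟩
  exact hsmall ⟨n, mem_lowDegree.mpr hn⟩

lemma one_le_abs_tensorCoeff {S : Type*} [Fintype S] {g : S → ℕ → ℚ} {t : ℕ → ℕ → ℚ}
    (ht : ∀ n, t n n = 1)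
    (hint : ∀ s n, ∃ z : ℤ, ∑ k ∈ Finset.range (n + 1), t n k * g s k = z) {d : ℕ}
    (a : (Fin d → S) → ℤ) (n : Fin d → ℕ)
    (hlow : ∀ k : Fin d → ℕ, ∑ j, k j < ∑ j, n j → tensorCoeff g (fun I => (a I : ℚ)) k = 0)
    (hn : tensorCoeff g (fun I => (a I : ℚ)) n ≠ 0) :
    1 ≤ |tensorCoeff g (fun I => (a I : ℚ)) n| := by
  choose z hz using hint
  have hcoeff : tensorCoeff g (fun I => (a I : ℚ)) n = (tensorCoeff z a n : ℤ) := by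
    calc tensorCoeff g (fun I => (a I : ℚ)) n
        = tensorCoeff (fun s k => (z s k : ℚ)) (fun I => (a I : ℚ)) n := by
          rw [tensorCoeff_triangular (fun s n => (hz s n).symm) _ n hlow]
          simp only [ht, Finset.prod_const_one, one_mul]
      _ = (tensorCoeff z a n : ℤ) := (map_tensorCoeff (Int.castRingHom ℚ) z a n).symm
  rw [hcoeff] at hn ⊢
  exact_mod_cast Int.one_le_abs (Int.cast_ne_zero.mp hn)

/-- The box principle produces a combination of tensor products, with small integer coefficients,
whose coefficients of degree less than `A` have absolute value less than `1`. Its coefficients of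
lowest degree are integers, so that this degree is at least `A`; the second coordinate system
bounds them from above. -/
lemma norm_pow_mul_norm_pow_le {S : Type*} [Fintype S] [Nonempty S] {g : S → ℕ → ℚ}
    (hli : LinearIndependent ℚ g) {d A K : ℕ} (hA : 0 < A) (hK : 0 < K) {t : ℕ → ℕ → ℚ}
    (ht : ∀ n, t n n = 1)
    (hint : ∀ s n, ∃ z : ℤ, ∑ k ∈ Finset.range (n + 1), t n k * g s k = z)
    {C R : ℝ} (hC : 1 ≤ C) (hR : 1 ≤ R) (hg : ∀ s n, |(g s n : ℝ)| ≤ C * R ^ n)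
    (hcard : (lowDegree d A).card * (K + 1) ≤ Fintype.card S ^ d)
    {g' : S → ℕ → ℂ} {t' : ℕ → ℕ → ℂ}
    (hg' : ∀ s n, g' s n = ∑ k ∈ Finset.range (n + 1), t' n k * (g s k : ℂ)) {w lam : ℂ}
    (ht' : ∀ n, t' n n = w * lam ^ n) (hlam : 1 ≤ ‖lam‖) {C' : ℝ} (hC' : ∀ s n, ‖g' s n‖ ≤ C') :
    ‖w‖ ^ d * ‖lam‖ ^ A ≤ (Fintype.card S : ℝ) ^ d *
      ((2 * ((Fintype.card S : ℝ) ^ d * (C ^ d * R ^ A))) ^ (1 / K : ℝ) * C' ^ d) := by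
  obtain ⟨a, ha, haY, hsmall⟩ := exists_int_tensorCoeff_abs_lt_one hA hK hC hR hg hcard
  obtain ⟨n, hn, hlow⟩ := exists_tensorCoeff_ne_zero_of_minimal hli (a := fun I => (a I : ℚ))
    fun h => ha (funext fun I => Int.cast_eq_zero.mp (congrFun h I))
  have hone := one_le_abs_tensorCoeff ht hint a n hlow hn
  have hAn : A ≤ ∑ j, n j := by
    by_contra! hlt
    have hcast := map_tensorCoeff (Rat.castHom ℝ) g (fun I => (a I : ℚ)) n
    simp only [map_intCast, eq_ratCast] at hcast
    have := hsmall n hlt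
    rw [← hcast, ← Rat.cast_abs] at this
    exact this.not_ge (by exact_mod_cast hone)
  have hcastC (k : Fin d → ℕ) : tensorCoeff (fun s n => (g s n : ℂ)) (fun I => (a I : ℂ)) k =
      (tensorCoeff g (fun I => (a I : ℚ)) k : ℚ) := by
    have := map_tensorCoeff (Rat.castHom ℂ) g (fun I => (a I : ℚ)) k
    simpa only [map_intCast, eq_ratCast] using this.symm
  have htri : tensorCoeff g' (fun I => (a I : ℂ)) n =
      (∏ j, t' (n j) (n j)) * (tensorCoeff g (fun I => (a I : ℚ)) n : ℚ) := by
    rw [← hcastC]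
    exact tensorCoeff_triangular hg' _ n fun k hk => by rw [hcastC, hlow k hk, Rat.cast_zero]
  calc ‖w‖ ^ d * ‖lam‖ ^ A ≤ ‖w‖ ^ d * ‖lam‖ ^ ∑ j, n j := by gcongr
    _ = ‖∏ j, t' (n j) (n j)‖ := by
        simp [ht', Finset.prod_mul_distrib, Finset.prod_pow_eq_pow_sum]
    _ ≤ ‖tensorCoeff g' (fun I => (a I : ℂ)) n‖ := by
        rw [htri, norm_mul]
        refine le_mul_of_one_le_right (norm_nonneg _) ?_
        rw [Complex.norm_ratCast]
        exact_mod_cast hone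
    _ ≤ _ := norm_tensorCoeff_le (fun I => (Complex.norm_intCast _).trans_le (haY I)) hC' n

end BoxPrinciple

section HarmonicMajorant

lemma exists_polynomial_re_eq {T : ℝ} {w : C(AddCircle T, ℂ)}
    (hw : w ∈ Submodule.span ℂ (Set.range (@fourier T))) (c : ℂ) :
    ∃ q : ℂ[X], ∀ θ, (c * w θ).re = (q.eval (AddCircle.toCircle θ : ℂ)).re := by
  induction hw using Submodule.span_induction generalizing c with
  | mem w hw =>
    obtain ⟨n, rfl⟩ := hw
    obtain ⟨k, rfl | rfl⟩ := Int.eq_nat_or_neg n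
    · exact ⟨C c * X ^ k, fun θ => by simp [fourier_apply, AddCircle.toCircle_nsmul]⟩
    · -- `c * z ^ (-k)` and its conjugate `conj c * z ^ k` have the same real part
      refine ⟨C (starRingEnd ℂ c) * X ^ k, fun θ => ?_⟩
      rw [fourier_neg, ← Complex.conj_re]
      simp [fourier_apply, AddCircle.toCircle_nsmul]
  | zero => exact ⟨0, fun θ => by simp⟩
  | add x y _ _ hx hy =>
    obtain ⟨q, hq⟩ := hx c
    obtain ⟨q', hq'⟩ := hy c
    exact ⟨q + q', fun θ => by
      rw [ContinuousMap.add_apply, mul_add, Complex.add_re, hq, hq', eval_add, Complex.add_re]⟩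
  | smul a x _ hx =>
    obtain ⟨q, hq⟩ := hx (c * a)
    exact ⟨q, fun θ => by rw [← hq, ContinuousMap.smul_apply, smul_eq_mul, mul_assoc]⟩

lemma exists_polynomial_forall_abs_sub_re_le {u : ℂ → ℝ}
    (hu : ContinuousOn u (Metric.sphere 0 1)) {ε : ℝ} (hε : 0 < ε) :
    ∃ q : ℂ[X], ∀ z ∈ Metric.sphere (0 : ℂ) 1, |u z - (q.eval z).re| ≤ ε := by
  have hcont : Continuous fun θ : AddCircle (1 : ℝ) => u (AddCircle.toCircle θ) :=
    hu.comp_continuous (continuous_subtype_val.comp AddCircle.continuous_toCircle) fun θ =>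
      mem_sphere_zero_iff_norm.mpr (Circle.norm_coe _)
  let v : C(AddCircle (1 : ℝ), ℂ) :=
    ⟨fun θ => u (AddCircle.toCircle θ), Complex.continuous_ofReal.comp hcont⟩
  have hmem : v ∈ closure ((Submodule.span ℂ (Set.range (@fourier 1)) :
      Submodule ℂ C(AddCircle (1 : ℝ), ℂ)) : Set C(AddCircle (1 : ℝ), ℂ)) := by
    rw [← Submodule.topologicalClosure_coe, span_fourier_closure_eq_top]
    trivial
  obtain ⟨w, hw, hvw⟩ := Metric.mem_closure_iff.mp hmem ε hε
  obtain ⟨q, hq⟩ := exists_polynomial_re_eq hw 1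
  refine ⟨q, fun z hz => ?_⟩
  obtain ⟨θ, hθ⟩ := (AddCircle.homeomorphCircle one_ne_zero).surjective
    (⟨z, mem_sphere_zero_iff_norm.mpr (mem_sphere_zero_iff_norm.mp hz)⟩ : Circle)
  rw [AddCircle.homeomorphCircle_apply] at hθ
  have hθz : (AddCircle.toCircle θ : ℂ) = z := congrArg Subtype.val hθ
  calc |u z - (q.eval z).re| = |(v θ - w θ).re| := by
        rw [← hθz, ← hq, one_mul, Complex.sub_re]
        rfl
    _ ≤ dist (v θ) (w θ) := (Complex.abs_re_le_norm _).trans_eq (dist_eq_norm _ _).symm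
    _ ≤ ε := (ContinuousMap.dist_apply_le_dist θ).trans hvw.le

lemma circleAverage_re_polynomial (q : ℂ[X]) :
    Real.circleAverage (fun z => (q.eval z).re) 0 1 = (q.eval 0).re := by
  have hmean : Real.circleAverage (fun z => q.eval z) 0 1 = q.eval 0 :=
    DiffContOnCl.circleAverage q.differentiable.diffContOnCl
  rw [← hmean]
  exact Complex.reCLM.circleAverage_comp_comm
    (q.continuous.continuousOn.circleIntegrable zero_le_one)

lemma exists_polynomial_re_ge {u : ℂ → ℝ} (hu : ContinuousOn u (Metric.sphere 0 1)) {ε : ℝ}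
    (hε : 0 < ε) : ∃ q : ℂ[X], (∀ z ∈ Metric.sphere (0 : ℂ) 1, u z ≤ (q.eval z).re) ∧
      (q.eval 0).re ≤ Real.circleAverage u 0 1 + ε := by
  obtain ⟨q, hq⟩ := exists_polynomial_forall_abs_sub_re_le hu (half_pos hε)
  have hshift (z : ℂ) : ((q + C ((ε / 2 : ℝ) : ℂ)).eval z).re = (q.eval z).re + ε / 2 := by
    rw [eval_add, eval_C, Complex.add_re, Complex.ofReal_re]
  refine ⟨q + C ((ε / 2 : ℝ) : ℂ), fun z hz => ?_, ?_⟩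
  · rw [hshift]
    linarith [(abs_le.mp (hq z hz)).2]
  · have hu' : CircleIntegrable u 0 1 := hu.circleIntegrable zero_le_one
    have hconst : CircleIntegrable (fun _ : ℂ => ε / 2) 0 1 :=
      continuousOn_const.circleIntegrable zero_le_one
    have hre : CircleIntegrable (fun z => (q.eval z).re) 0 1 :=
      (Complex.continuous_re.comp q.continuous).continuousOn.circleIntegrable zero_le_one
    calc ((q + C ((ε / 2 : ℝ) : ℂ)).eval 0).re
        = Real.circleAverage (fun z => (q.eval z).re) 0 1 + ε / 2 := by
          rw [hshift, circleAverage_re_polynomial]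
      _ ≤ Real.circleAverage (fun z => u z + ε / 2) 0 1 + ε / 2 := by
          refine add_le_add ?_ le_rfl
          refine Real.circleAverage_mono hre (hu'.add hconst) fun z hz => ?_
          rw [abs_one] at hz
          linarith [(abs_le.mp (hq z hz)).1]
      _ = Real.circleAverage u 0 1 + ε := by
          rw [Real.circleAverage_fun_add hu' hconst, Real.circleAverage_const]
          ring

end HarmonicMajorant

section Asymptotics

lemma nonpos_of_eventually_mul_le_log {a b c : ℝ}
    (h : ∀ᶠ D : ℕ in atTop, a * D ≤ b * Real.log D + c) : a ≤ 0 := by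
  have hlog : Tendsto (fun x : ℝ => Real.log x / x) atTop (𝓝 0) := by
    simpa using Real.isLittleO_log_id_atTop.tendsto_div_nhds_zero
  have hlim : Tendsto (fun D : ℕ => b * (Real.log D / D) + c / D) atTop (𝓝 (b * 0 + 0)) :=
    ((hlog.comp tendsto_natCast_atTop_atTop).const_mul b).add
      (tendsto_const_div_atTop_nhds_zero_nat c)
  rw [mul_zero, add_zero] at hlim
  refine ge_of_tendsto hlim ?_
  filter_upwards [h, eventually_gt_atTop 0] with D hD hD0
  rwa [← mul_div_assoc, ← add_div, le_div_iff₀ (by exact_mod_cast hD0)]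

lemma pow_self_le_exp_pow_mul_factorial (d : ℕ) :
    (d : ℝ) ^ d ≤ Real.exp 1 ^ d * (d.factorial : ℝ) := by
  have := Real.pow_div_factorial_le_exp (d : ℝ) d.cast_nonneg d
  rw [div_le_iff₀ (by positivity)] at this
  rwa [← Real.exp_nat_mul, mul_one]

lemma pow_mul_le_factorial_mul_pow {a y θ x : ℝ} {d : ℕ} (ha : 0 ≤ a) (hy : 0 ≤ y) (hθ : 0 < θ)
    (hx : 0 ≤ x) (hyd : y ≤ (a / (Real.exp 1 * θ)) ^ d) {b : ℝ} (hb : 0 ≤ b)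
    (hbx : b ≤ θ * d * x) : b ^ d * y ≤ d.factorial * (a * x) ^ d := by
  calc b ^ d * y ≤ (θ * d * x) ^ d * (a / (Real.exp 1 * θ)) ^ d := by gcongr
    _ = (d : ℝ) ^ d * ((a * x) ^ d / Real.exp 1 ^ d) := by
        rw [← mul_pow, ← div_pow, ← mul_pow]
        congr 1
        field_simp
    _ ≤ (Real.exp 1 ^ d * (d.factorial : ℝ)) * ((a * x) ^ d / Real.exp 1 ^ d) := by
        gcongr
        exact pow_self_le_exp_pow_mul_factorial d
    _ = d.factorial * (a * x) ^ d := by field_simp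

lemma exists_pos_nat_add_le {x : ℝ} {d : ℕ} (hx : d + 1 ≤ x) :
    ∃ A : ℕ, 0 < A ∧ (A + d : ℝ) ≤ x ∧ x ≤ A + d + 1 := by
  have hle : d + 1 ≤ ⌊x⌋₊ := Nat.le_floor (by exact_mod_cast hx)
  have hfloor := Nat.floor_le (a := x) (by linarith [d.cast_nonneg (α := ℝ)])
  have hcast : ((⌊x⌋₊ - d : ℕ) : ℝ) = ⌊x⌋₊ - d := Nat.cast_sub (by omega)
  exact ⟨⌊x⌋₊ - d, by omega, by rw [hcast]; linarith, by
    rw [hcast]; linarith [Nat.lt_floor_add_one x]⟩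

/-- The estimates hold for `A` close to `θ * d * D`; the terms linear in `D` give the claim as
`D → ∞`. -/
lemma mul_le_add_div_of_forall {m d K : ℕ} {θ l E b₁ b₂ c₁ c₂ : ℝ} (hm : 0 < m) (hθ : 0 < θ)
    (hd : 0 < d) (hl : 0 ≤ l) (hb₂ : 0 ≤ b₂)
    (hdK : (K + 1 : ℝ) ≤ (m / (Real.exp 1 * θ)) ^ d)
    (h : ∀ A D : ℕ, 0 < A → 0 < D → (A + d) ^ d * (K + 1) ≤ d.factorial * (m * D) ^ d →
      A * l ≤ d * D * E + 1 / K * (Real.log 2 + d * Real.log (m * D) + d * c₁ + d * D * b₁ + A * b₂)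
        + d * Real.log (m * D) + d * c₂) :
    θ * l ≤ E + (b₁ + θ * b₂) / K := by
  have hm' : (0 : ℝ) < m := by exact_mod_cast hm
  have hd' : (0 : ℝ) < d := by exact_mod_cast hd
  have hlarge : ∀ᶠ D : ℕ in atTop, (d : ℝ) + 1 ≤ θ * d * D :=
    (tendsto_natCast_atTop_atTop.const_mul_atTop (by positivity)).eventually_ge_atTop _
  have hslope : θ * d * l - d * E - 1 / K * (d * b₁ + θ * d * b₂) ≤ 0 := by
    refine nonpos_of_eventually_mul_le_log (b := d / K + d) (c := (d + 1) * l +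
      1 / K * (Real.log 2 + d * Real.log m + d * c₁) + d * Real.log m + d * c₂) ?_
    filter_upwards [hlarge, eventually_gt_atTop 0] with D hD hD0
    have hD' : (0 : ℝ) < D := by exact_mod_cast hD0
    obtain ⟨A, hA0, hAle, hleA⟩ := exists_pos_nat_add_le hD
    have hcard := pow_mul_le_factorial_mul_pow hm'.le (by positivity) hθ hD'.le hdK
      (by positivity) hAle
    have hAl := h A D hA0 hD0 (by exact_mod_cast hcard)
    rw [Real.log_mul hm'.ne' hD'.ne'] at hAl
    have hlow : (θ * d * D - d - 1) * l ≤ A * l := by gcongr; linarith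
    have hup : 1 / (K : ℝ) * (A * b₂) ≤ 1 / (K : ℝ) * (θ * d * D * b₂) := by gcongr; linarith
    have hsplit : (d / K + d) * Real.log D = 1 / K * (d * Real.log D) + d * Real.log D := by ring
    rw [hsplit]
    linarith
  have hfactor : d * (θ * l - E - (b₁ + θ * b₂) / K) ≤ 0 := hslope.trans_eq' (by ring)
  linarith [nonpos_of_mul_nonpos_right hfactor hd']

lemma mul_le_exp_one_mul_of_forall {m : ℕ} {l E b₁ b₂ c₁ c₂ : ℝ} (hm : 0 < m) (hl : 0 ≤ l)
    (hb₂ : 0 ≤ b₂)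
    (h : ∀ d A K D : ℕ, 0 < d → 0 < A → 0 < K → 0 < D →
      (A + d) ^ d * (K + 1) ≤ d.factorial * (m * D) ^ d →
      A * l ≤ d * D * E + 1 / K * (Real.log 2 + d * Real.log (m * D) + d * c₁ + d * D * b₁ + A * b₂)
        + d * Real.log (m * D) + d * c₂) :
    m * l ≤ Real.exp 1 * E := by
  have hm' : (0 : ℝ) < m := by exact_mod_cast hm
  have hlt (θ : ℝ) (hθ : 0 < θ) (hθm : θ < m / Real.exp 1) : θ * l ≤ E := by
    have hbase : 1 < m / (Real.exp 1 * θ) := by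
      rwa [← div_div, one_lt_div hθ]
    have hlim : Tendsto (fun K : ℕ => E + (b₁ + θ * b₂) / K) atTop (𝓝 (E + 0)) :=
      (tendsto_const_div_atTop_nhds_zero_nat _).const_add E
    rw [add_zero] at hlim
    refine ge_of_tendsto hlim ?_
    filter_upwards [eventually_gt_atTop 0] with K hK
    obtain ⟨d, hd⟩ := pow_unbounded_of_one_lt ((K : ℝ) + 1) hbase
    have hd0 : 0 < d := Nat.pos_of_ne_zero fun h0 => by
      rw [h0, pow_zero] at hd
      linarith [K.cast_nonneg (α := ℝ)]
    exact mul_le_add_div_of_forall hm hθ hd0 hl hb₂ hd.le fun A D hA hD => h d A K D hd0 hA hK hD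
  have hlim : Tendsto (fun θ : ℝ => θ * l) (𝓝[<] (m / Real.exp 1)) (𝓝 (m / Real.exp 1 * l)) :=
    (Continuous.tendsto (by fun_prop) _).mono_left nhdsWithin_le_nhds
  have hle : m / Real.exp 1 * l ≤ E := by
    refine le_of_tendsto hlim ?_
    have hpos : 0 < m / Real.exp 1 := div_pos hm' (Real.exp_pos 1)
    filter_upwards [self_mem_nhdsWithin, nhdsWithin_le_nhds (lt_mem_nhds hpos)] with θ hθm hθ
    exact hlt θ hθ hθm
  rw [div_mul_eq_mul_div, div_le_iff₀ (Real.exp_pos 1)] at hle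
  linarith

lemma mul_log_le_of_pow_mul_pow_le {lam u B C C' M R E : ℝ} (hlam : 0 < lam) (hu : 0 < u)
    (hB : 0 < B) (hC : 0 < C) (hC' : 0 < C') (hM : 0 < M) (hR : 0 < R) {N d A K D : ℕ}
    (h : (lam ^ N * (u * Real.exp (-(D * E)))) ^ d * lam ^ A ≤
      M ^ d * ((2 * (M ^ d * ((C * B ^ D) ^ d * R ^ A))) ^ (1 / K : ℝ) * C' ^ d)) :
    A * Real.log lam ≤ d * D * E +
      1 / K * (Real.log 2 + d * Real.log M + d * Real.log C + d * D * Real.log B +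
        A * Real.log R) + d * Real.log M + d * (Real.log C' - N * Real.log lam - Real.log u) := by
  have hlog := Real.log_le_log (by positivity) h
  have hleft : Real.log ((lam ^ N * (u * Real.exp (-(D * E)))) ^ d * lam ^ A) =
      d * (N * Real.log lam + (Real.log u + -(D * E))) + A * Real.log lam := by
    rw [Real.log_mul (by positivity) (by positivity), Real.log_pow, Real.log_pow,
      Real.log_mul (by positivity) (by positivity), Real.log_pow,
      Real.log_mul (by positivity) (by positivity), Real.log_exp]
  have hright : Real.log (M ^ d * ((2 * (M ^ d * ((C * B ^ D) ^ d * R ^ A))) ^ (1 / K : ℝ) *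
      C' ^ d)) = d * Real.log M + (1 / K * (Real.log 2 + (d * Real.log M +
        (d * (Real.log C + D * Real.log B) + A * Real.log R))) + d * Real.log C') := by
    rw [Real.log_mul (by positivity) (by positivity), Real.log_mul (by positivity) (by positivity),
      Real.log_rpow (by positivity), Real.log_mul (by positivity) (by positivity),
      Real.log_mul (by positivity) (by positivity), Real.log_mul (by positivity) (by positivity)]
    simp only [Real.log_pow]
    rw [Real.log_mul (x := C) (by positivity) (by positivity), Real.log_pow]
  rw [hleft, hright] at hlog
  linarith

end Asymptotics

section IntegralSeries

lemma isIntegralSeries_iff {f : ℚ⟦X⟧} :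
    IsIntegralSeries f ↔ f ∈ (PowerSeries.map (Int.castRingHom ℚ)).range := by
  refine ⟨fun hf => ?_, ?_⟩
  · choose a ha using hf
    exact ⟨PowerSeries.mk a, PowerSeries.ext fun n => by simp [ha]⟩
  · rintro ⟨g, rfl⟩ n
    exact ⟨PowerSeries.coeff n g, by simp⟩

lemma IsIntegralSeries.mul {f g : ℚ⟦X⟧} (hf : IsIntegralSeries f) (hg : IsIntegralSeries g) :
    IsIntegralSeries (f * g) := by
  rw [isIntegralSeries_iff] at hf hg ⊢
  exact mul_mem hf hg

lemma IsIntegralSeries.pow {f : ℚ⟦X⟧} (hf : IsIntegralSeries f) (k : ℕ) :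
    IsIntegralSeries (f ^ k) := by
  rw [isIntegralSeries_iff] at hf ⊢
  exact pow_mem hf k

lemma isIntegralSeries_X : IsIntegralSeries PowerSeries.X :=
  isIntegralSeries_iff.mpr ⟨PowerSeries.X, PowerSeries.map_X _⟩

end IntegralSeries

section PowerSeries

variable {R : Type*} [CommRing R]

lemma coeff_pow_mul_self {x : R⟦X⟧} (hx : PowerSeries.constantCoeff x = 0) (y : R⟦X⟧) (n : ℕ) :
    PowerSeries.coeff n (x ^ n * y) =
      PowerSeries.coeff 1 x ^ n * PowerSeries.constantCoeff y := by
  obtain ⟨z, rfl⟩ := PowerSeries.X_dvd_iff.mpr hx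
  have hn := PowerSeries.coeff_X_pow_mul (z ^ n * y) n 0
  have hone := PowerSeries.coeff_succ_X_mul 0 z
  rw [zero_add] at hn hone
  rw [mul_pow, mul_assoc, hn, hone]
  simp

lemma coeff_subst_eq_sum {x : R⟦X⟧} (hx : PowerSeries.constantCoeff x = 0) (f : R⟦X⟧) (n : ℕ) :
    PowerSeries.coeff n (f.subst x) =
      ∑ k ∈ Finset.range (n + 1), PowerSeries.coeff n (x ^ k) * PowerSeries.coeff k f := by
  rw [PowerSeries.coeff_subst' (PowerSeries.HasSubst.of_constantCoeff_zero' hx),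
    finsum_eq_sum_of_support_subset _ (s := Finset.range (n + 1))]
  · exact Finset.sum_congr rfl fun k _ => by rw [smul_eq_mul, mul_comm]
  · refine Function.support_subset_iff'.mpr fun k hk => ?_
    have hnk : n < k := by simpa using hk
    have hdvd := pow_dvd_pow_of_dvd (PowerSeries.X_dvd_iff.mpr hx) k
    rw [PowerSeries.X_pow_dvd_iff.mp hdvd n hnk, smul_zero]

lemma linearIndependent_coeff {ι : Type*} {f : ι → R⟦X⟧} (hf : LinearIndependent R f) :
    LinearIndependent R fun i n => PowerSeries.coeff n (f i) :=
  hf.map' (LinearMap.pi fun n => PowerSeries.coeff n) (LinearMap.ker_eq_bot.mpr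
    fun _ _ h => PowerSeries.ext fun n => congrFun h n)

end PowerSeries

section Bounds

lemma exists_forall_norm_le_of_analyticOnNhd {ι : Type*} [Finite ι] {f : ι → ℂ → ℂ} {r : ℝ}
    (hf : ∀ i, AnalyticOnNhd ℂ (f i) (Metric.closedBall 0 r)) :
    ∃ C : ℝ, 1 ≤ C ∧ ∀ i, ∀ z ∈ Metric.closedBall (0 : ℂ) r, ‖f i z‖ ≤ C := by
  choose C hC using fun i =>
    (isCompact_closedBall (0 : ℂ) r).exists_bound_of_continuousOn (hf i).continuousOn
  obtain ⟨B, hB⟩ := (Set.finite_range C).bddAbove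
  exact ⟨max 1 B, le_max_left _ _, fun i z hz =>
    (hC i z hz).trans ((hB (Set.mem_range_self i)).trans (le_max_right _ _))⟩

lemma exists_norm_coeff_taylor_pow_mul_le {ι : Type*} [Finite ι] {F : ι → ℂ → ℂ} {P : ℂ → ℂ}
    (hF : ∀ i, AnalyticAt ℂ (F i) 0) (hP : AnalyticAt ℂ P 0) :
    ∃ C B R : ℝ, 1 ≤ C ∧ 1 ≤ B ∧ 1 ≤ R ∧ ∀ i k n,
      ‖PowerSeries.coeff n (taylor (fun z => P z ^ k * F i z) 0)‖ ≤ C * B ^ k * R ^ n := by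
  obtain ⟨ε, hε, hball⟩ := Metric.eventually_nhds_iff_ball.mp
    (hP.eventually_analyticAt.and (eventually_all.mpr fun i => (hF i).eventually_analyticAt))
  obtain ⟨r, hr0, hr⟩ := exists_between (lt_min hε one_pos)
  have hsub : Metric.closedBall (0 : ℂ) r ⊆ Metric.ball 0 ε :=
    Metric.closedBall_subset_ball (hr.trans_le (min_le_left _ _))
  have hPr : AnalyticOnNhd ℂ P (Metric.closedBall 0 r) := fun z hz => (hball z (hsub hz)).1
  have hFr (i) : AnalyticOnNhd ℂ (F i) (Metric.closedBall 0 r) := fun z hz =>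
    (hball z (hsub hz)).2 i
  obtain ⟨B, hB1, hB⟩ := exists_forall_norm_le_of_analyticOnNhd fun _ : Unit => hPr
  obtain ⟨C, hC1, hC⟩ := exists_forall_norm_le_of_analyticOnNhd hFr
  refine ⟨C, B, r⁻¹, hC1, hB1, (one_le_inv₀ hr0).mpr (hr.trans_le (min_le_right _ _)).le,
    fun i k n => ?_⟩
  rw [inv_pow, ← div_eq_mul_inv]
  refine norm_coeff_taylor_le hr0 (fun z hz => ((hPr z hz).fun_pow k).fun_mul (hFr i z hz))
    (fun z hz => ?_) n
  have hz' := Metric.sphere_subset_closedBall hz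
  rw [norm_mul, norm_pow, mul_comm C]
  exact mul_le_mul (pow_le_pow_left₀ (norm_nonneg _) (hB () z hz') k) (hC i z hz')
    (norm_nonneg _) (by positivity)

lemma pow_mul_exp_neg_le_one {b r : ℝ} (hb : 0 ≤ b) (hr : Real.posLog b ≤ r) {k D : ℕ}
    (hk : k ≤ D) : b ^ k * Real.exp (-(D * r)) ≤ 1 := by
  have hbr : b ≤ Real.exp r :=
    (Real.le_exp_log b).trans (Real.exp_le_exp.mpr ((le_max_right _ _).trans hr))
  calc b ^ k * Real.exp (-(D * r)) ≤ Real.exp r ^ D * Real.exp (-(D * r)) := by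
        gcongr
        exact (pow_le_pow_left₀ hb hbr k).trans
          (pow_le_pow_right₀ (Real.one_le_exp (Real.posLog_nonneg.trans hr)) hk)
    _ = 1 := by rw [← Real.exp_nat_mul, ← Real.exp_add, add_neg_cancel, Real.exp_zero]

lemma exists_common_continuation {ι : Type*} [Finite ι] {φ : ℂ → ℂ}
    (hφ : AnalyticOnNhd ℂ φ (Metric.closedBall 0 1)) (hφ0 : φ 0 = 0) {f : ι → ℚ⟦X⟧}
    (hf : ∀ i, ContinuesAlong φ (f i)) :
    ∃ (F M : ι → ℂ → ℂ) (N : ℕ) (U : ℂ → ℂ), (∀ i, AnalyticAt ℂ (F i) 0) ∧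
      (∀ i, taylor (F i) 0 = (f i).map (algebraMap ℚ ℂ)) ∧
      (∀ i, AnalyticOnNhd ℂ (M i) (Metric.closedBall 0 1)) ∧ AnalyticAt ℂ U 0 ∧ U 0 ≠ 0 ∧
      ∀ i, ∀ᶠ z in 𝓝 0, M i z = φ z ^ N * U z * F i (φ z) := by
  classical
  have := Fintype.ofFinite ι
  choose F hF hFt Q hQ M hM hMF using hf
  have hprod : ∏ i, Q i ≠ 0 := Finset.prod_ne_zero_iff.mpr fun i _ => hQ i
  obtain ⟨Q₁, hQ₁, hdvd⟩ := exists_eq_pow_rootMultiplicity_mul_and_not_dvd _ hprod 0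
  refine ⟨F, fun i z => (∏ j ∈ Finset.univ.erase i, Q j).eval (φ z) * M i z,
    (∏ i, Q i).rootMultiplicity 0, fun z => Q₁.eval (φ z), hF, hFt, fun i z hz =>
    ((analyticAt_eval _ (φ z)).comp (hφ z hz)).fun_mul (hM i z hz),
    (analyticAt_eval _ (φ 0)).comp (hφ 0 (by simp)), ?_, fun i => ?_⟩
  · simp only [hφ0]
    exact fun h => hdvd (dvd_iff_isRoot.mpr h)
  · filter_upwards [hMF i] with z hz
    have hQφ := congrArg (fun q : ℂ[X] => q.eval (φ z)) hQ₁
    simp only [C_0, sub_zero, eval_mul, eval_pow, eval_X] at hQφ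
    rw [hz, ← hQφ, ← Finset.mul_prod_erase _ _ (Finset.mem_univ i), eval_mul]
    ring

end Bounds

section HolonomyBound

lemma norm_deriv_pow_mul_norm_pow_le {S : Type*} [Fintype S] [Nonempty S] {h : S → ℚ⟦X⟧}
    (hli : LinearIndependent ℚ h) {x : ℚ⟦X⟧} (hx0 : PowerSeries.constantCoeff x = 0)
    (hx1 : PowerSeries.coeff 1 x = 1) (hint : ∀ s, IsIntegralSeries ((h s).subst x))
    {d A K : ℕ} (hA : 0 < A) (hK : 0 < K) {C R : ℝ} (hC : 1 ≤ C) (hR : 1 ≤ R)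
    (hcoeff : ∀ s n, |((PowerSeries.coeff n (h s) : ℚ) : ℝ)| ≤ C * R ^ n)
    (hcard : (lowDegree d A).card * (K + 1) ≤ Fintype.card S ^ d)
    {φ : ℂ → ℂ} (hφ : AnalyticAt ℂ φ 0) (hφ0 : φ 0 = 0) (hφ' : 1 ≤ ‖deriv φ 0‖)
    {H v : S → ℂ → ℂ} (hH : ∀ s, AnalyticAt ℂ (H s) 0)
    (hHt : ∀ s, taylor (H s) 0 = (h s).map (algebraMap ℚ ℂ)) {N : ℕ} {V : ℂ → ℂ}
    (hV : AnalyticAt ℂ V 0) (hv : ∀ s, AnalyticOnNhd ℂ (v s) (Metric.closedBall 0 1))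
    (hvH : ∀ s, ∀ᶠ z in 𝓝 0, v s z = φ z ^ N * V z * H s (φ z)) {C' : ℝ}
    (hvC : ∀ s, ∀ z ∈ Metric.sphere (0 : ℂ) 1, ‖v s z‖ ≤ C') :
    (‖deriv φ 0‖ ^ N * ‖V 0‖) ^ d * ‖deriv φ 0‖ ^ A ≤ (Fintype.card S : ℝ) ^ d *
      ((2 * ((Fintype.card S : ℝ) ^ d * (C ^ d * R ^ A))) ^ (1 / K : ℝ) * C' ^ d) := by
  have hφt : PowerSeries.constantCoeff (taylor φ 0) = 0 := by rw [constantCoeff_taylor, hφ0]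
  have hφ1 : PowerSeries.coeff 1 (taylor φ 0) = deriv φ 0 := by simp [coeff_taylor]
  have hvt (s) : taylor (v s) 0 =
      taylor φ 0 ^ N * taylor V 0 * taylor (fun z => H s (φ z)) 0 := by
    have hHφ : AnalyticAt ℂ (fun z => H s (φ z)) 0 := (hφ0.symm ▸ hH s).comp hφ
    rw [taylor_congr (hvH s), taylor_mul ((hφ.fun_pow N).fun_mul hV) hHφ,
      taylor_mul (hφ.fun_pow N) hV, taylor_pow hφ]
  have hXdvd : PowerSeries.X ^ N ∣ taylor φ 0 ^ N * taylor V 0 :=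
    (pow_dvd_pow_of_dvd (PowerSeries.X_dvd_iff.mpr hφt) N).mul_right _
  rw [← norm_pow, ← norm_mul]
  refine norm_pow_mul_norm_pow_le (linearIndependent_coeff hli) hA hK
    (t := fun n k => PowerSeries.coeff n (x ^ k))
    (g' := fun s n => PowerSeries.coeff (n + N) (taylor (v s) 0))
    (t' := fun n k => PowerSeries.coeff (n + N) (taylor φ 0 ^ N * taylor V 0 * taylor φ 0 ^ k))
    (fun n => ?_) (fun s n => ?_) hC hR hcoeff hcard (fun s n => ?_) (fun n => ?_) hφ'
    fun s n => ?_
  · simpa [hx1] using coeff_pow_mul_self hx0 1 n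
  · rw [← coeff_subst_eq_sum hx0]
    exact hint s n
  · rw [hvt, coeff_mul_taylor_comp (hφ0.symm ▸ hH s) hφ hXdvd]
    simp only [hφ0, sub_zero, hHt, PowerSeries.coeff_map, eq_ratCast]
  · rw [mul_right_comm, ← pow_add, add_comm N, coeff_pow_mul_self hφt, hφ1, constantCoeff_taylor]
    ring
  · simpa using norm_coeff_taylor_le one_pos (hv s) (hvC s) (n + N)

lemma card_lowDegree_mul_le {d A K n : ℕ}
    (h : (A + d) ^ d * (K + 1) ≤ d.factorial * n ^ d) :
    (lowDegree d A).card * (K + 1) ≤ n ^ d := by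
  refine le_of_mul_le_mul_left ?_ d.factorial_pos
  calc d.factorial * ((lowDegree d A).card * (K + 1))
      = (lowDegree d A).card * d.factorial * (K + 1) := by ring
    _ ≤ (A + d) ^ d * (K + 1) := Nat.mul_le_mul_right _ (card_lowDegree_mul_factorial_le d A)
    _ ≤ d.factorial * n ^ d := h

/-- The factor `exp (-D * q)` makes the continuations of `p ^ k * f i`, `k < D`, along `φ` bounded
on the unit circle, independently of `D`. -/
lemma norm_deriv_pow_mul_norm_pow_le_of_pow_mul {m D : ℕ} (hm : 0 < m) (hD : 0 < D)
    {f : Fin m → ℚ⟦X⟧} {p x : ℚ⟦X⟧} {φ P : ℂ → ℂ}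
    (hφ : AnalyticAt ℂ φ 0) (hφ0 : φ 0 = 0) (hφ' : 1 ≤ ‖deriv φ 0‖)
    (hx0 : PowerSeries.constantCoeff x = 0) (hx1 : PowerSeries.coeff 1 x = 1)
    (hfint : ∀ i, IsIntegralSeries ((f i).subst x)) (hpint : IsIntegralSeries (p.subst x))
    (hP : AnalyticAt ℂ P 0) (hPt : taylor P 0 = p.map (algebraMap ℚ ℂ))
    (hPφ : AnalyticOnNhd ℂ (fun z => P (φ z)) (Metric.closedBall 0 1))
    (hli : LinearIndependent ℚ fun s : Fin m × ℕ => p ^ s.2 * f s.1)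
    {F M : Fin m → ℂ → ℂ} {N : ℕ} {U : ℂ → ℂ} (hF : ∀ i, AnalyticAt ℂ (F i) 0)
    (hFt : ∀ i, taylor (F i) 0 = (f i).map (algebraMap ℚ ℂ))
    (hM : ∀ i, AnalyticOnNhd ℂ (M i) (Metric.closedBall 0 1)) (hU : AnalyticAt ℂ U 0)
    (hMF : ∀ i, ∀ᶠ z in 𝓝 0, M i z = φ z ^ N * U z * F i (φ z))
    {B C R : ℝ} (hC : 1 ≤ C) (hB : 1 ≤ B) (hR : 1 ≤ R)
    (hbound : ∀ i k n,
      ‖PowerSeries.coeff n (taylor (fun z => P z ^ k * F i z) 0)‖ ≤ C * B ^ k * R ^ n)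
    {C' : ℝ} (hC' : ∀ i, ∀ z ∈ Metric.closedBall (0 : ℂ) 1, ‖M i z‖ ≤ C') {q : ℂ[X]}
    (hq : ∀ z ∈ Metric.sphere (0 : ℂ) 1, Real.posLog ‖P (φ z)‖ ≤ (q.eval z).re)
    {d A K : ℕ} (hA : 0 < A) (hK : 0 < K)
    (hcard : (A + d) ^ d * (K + 1) ≤ d.factorial * (m * D) ^ d) :
    (‖deriv φ 0‖ ^ N * (‖U 0‖ * Real.exp (-(D * (q.eval 0).re)))) ^ d * ‖deriv φ 0‖ ^ A ≤
      ((m : ℝ) * D) ^ d * ((2 * (((m : ℝ) * D) ^ d * ((C * B ^ D) ^ d * R ^ A))) ^ (1 / K : ℝ) *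
        C' ^ d) := by
  have : Nonempty (Fin m × Fin D) := ⟨⟨0, hm⟩, ⟨0, hD⟩⟩
  have hS : Fintype.card (Fin m × Fin D) = m * D := by simp
  have hli' : LinearIndependent ℚ fun s : Fin m × Fin D => p ^ (s.2 : ℕ) * f s.1 :=
    hli.comp (Prod.map id Fin.val) (Function.injective_id.prodMap Fin.val_injective)
  have hint (s : Fin m × Fin D) : IsIntegralSeries ((p ^ (s.2 : ℕ) * f s.1).subst x) := by
    have hx := PowerSeries.HasSubst.of_constantCoeff_zero' hx0
    rw [PowerSeries.subst_mul hx, PowerSeries.subst_pow hx]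
    exact (hpint.pow _).mul (hfint s.1)
  have hHt (s : Fin m × Fin D) : taylor (fun z => P z ^ (s.2 : ℕ) * F s.1 z) 0 =
      (p ^ (s.2 : ℕ) * f s.1).map (algebraMap ℚ ℂ) := by
    rw [taylor_mul (hP.fun_pow _) (hF s.1), taylor_pow hP, hPt, hFt, map_mul, map_pow]
  have hcoeff (s : Fin m × Fin D) (n : ℕ) :
      |((PowerSeries.coeff n (p ^ (s.2 : ℕ) * f s.1) : ℚ) : ℝ)| ≤ C * B ^ D * R ^ n := by
    have hsn := hbound s.1 s.2 n
    rw [hHt, PowerSeries.coeff_map, eq_ratCast, Complex.norm_ratCast] at hsn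
    refine hsn.trans ?_
    gcongr
    exact s.2.2.le
  have hG (z : ℂ) : AnalyticAt ℂ (fun z => Complex.exp (-(D * q.eval z))) z :=
    (analyticAt_const.fun_mul (analyticAt_eval q z)).fun_neg.cexp
  have hGnorm (z : ℂ) : ‖Complex.exp (-(D * q.eval z))‖ = Real.exp (-(D * (q.eval z).re)) := by
    simp [Complex.norm_exp]
  have hvC (s : Fin m × Fin D) (z : ℂ) (hz : z ∈ Metric.sphere (0 : ℂ) 1) :
      ‖M s.1 z * (P (φ z) ^ (s.2 : ℕ) * Complex.exp (-(D * q.eval z)))‖ ≤ C' := by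
    rw [norm_mul, norm_mul, norm_pow, hGnorm]
    exact (mul_le_of_le_one_right (norm_nonneg _) (pow_mul_exp_neg_le_one (norm_nonneg _)
      (hq z hz) s.2.2.le)).trans (hC' s.1 z (Metric.sphere_subset_closedBall hz))
  have key := norm_deriv_pow_mul_norm_pow_le hli' hx0 hx1 hint hA hK
    (one_le_mul_of_one_le_of_one_le hC (one_le_pow₀ hB)) hR hcoeff
    (hS ▸ card_lowDegree_mul_le hcard) hφ hφ0 hφ'
    (fun s => (hP.fun_pow _).fun_mul (hF s.1)) hHt (hU.fun_mul (hG 0))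
    (fun s z hz => (hM s.1 z hz).fun_mul (((hPφ z hz).fun_pow _).fun_mul (hG z)))
    (fun s => by
      filter_upwards [hMF s.1] with z hz
      rw [hz]
      ring) hvC
  rwa [hS, norm_mul, hGnorm, Nat.cast_mul] at key

lemma exists_forall_mul_log_norm_deriv_le {m : ℕ} {f : Fin m → ℚ⟦X⟧} {p x : ℚ⟦X⟧} {φ P : ℂ → ℂ}
    (hm : 0 < m) (hφ : AnalyticOnNhd ℂ φ (Metric.closedBall 0 1)) (hφ0 : φ 0 = 0)
    (hφ' : 1 ≤ ‖deriv φ 0‖) (hx0 : PowerSeries.constantCoeff x = 0)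
    (hx1 : PowerSeries.coeff 1 x = 1) (hfint : ∀ i, IsIntegralSeries ((f i).subst x))
    (hpint : IsIntegralSeries (p.subst x)) (hf : ∀ i, ContinuesAlong φ (f i))
    (hP : AnalyticAt ℂ P 0) (hPt : taylor P 0 = p.map (algebraMap ℚ ℂ))
    (hPφ : AnalyticOnNhd ℂ (fun z => P (φ z)) (Metric.closedBall 0 1))
    (hli : LinearIndependent ℚ fun s : Fin m × ℕ => p ^ s.2 * f s.1) :
    ∃ b₁ b₂ c₁ c₂ : ℝ, 0 ≤ b₂ ∧ ∀ q : ℂ[X],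
      (∀ z ∈ Metric.sphere (0 : ℂ) 1, Real.posLog ‖P (φ z)‖ ≤ (q.eval z).re) →
      ∀ d A K D : ℕ, 0 < A → 0 < K → 0 < D →
        (A + d) ^ d * (K + 1) ≤ d.factorial * (m * D) ^ d →
        A * Real.log ‖deriv φ 0‖ ≤ d * D * (q.eval 0).re + 1 / K * (Real.log 2 +
          d * Real.log (m * D) + d * c₁ + d * D * b₁ + A * b₂) + d * Real.log (m * D) +
          d * c₂ := by
  obtain ⟨F, M, N, U, hF, hFt, hM, hU, hU0, hMF⟩ := exists_common_continuation hφ hφ0 hf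
  obtain ⟨C, B, R, hC, hB, hR, hbound⟩ := exists_norm_coeff_taylor_pow_mul_le hF hP
  obtain ⟨C', hC'1, hC'⟩ := exists_forall_norm_le_of_analyticOnNhd hM
  refine ⟨Real.log B, Real.log R, Real.log C,
    Real.log C' - N * Real.log ‖deriv φ 0‖ - Real.log ‖U 0‖, Real.log_nonneg hR,
    fun q hq d A K D hA hK hD hcard => ?_⟩
  have key := norm_deriv_pow_mul_norm_pow_le_of_pow_mul hm hD (hφ 0 (by simp)) hφ0 hφ' hx0 hx1
    hfint hpint hP hPt hPφ hli hF hFt hM hU hMF hC hB hR hbound hC' hq hA hK hcard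
  exact mul_log_le_of_pow_mul_pow_le (by positivity) (norm_pos_iff.mpr hU0) (by positivity)
    (by positivity) (by positivity) (by positivity) (by positivity) key

theorem mul_log_norm_deriv_le {m : ℕ} {f : Fin m → ℚ⟦X⟧} {p x : ℚ⟦X⟧} {φ P : ℂ → ℂ}
    (hφ : AnalyticOnNhd ℂ φ (Metric.closedBall 0 1)) (hφ0 : φ 0 = 0) (hφ' : 1 ≤ ‖deriv φ 0‖)
    (hx0 : PowerSeries.constantCoeff x = 0) (hx1 : PowerSeries.coeff 1 x = 1)
    (hfint : ∀ i, IsIntegralSeries ((f i).subst x)) (hpint : IsIntegralSeries (p.subst x))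
    (hf : ∀ i, ContinuesAlong φ (f i)) (hP : AnalyticAt ℂ P 0)
    (hPt : taylor P 0 = p.map (algebraMap ℚ ℂ))
    (hPφ : AnalyticOnNhd ℂ (fun z => P (φ z)) (Metric.closedBall 0 1))
    (hli : LinearIndependent ℚ fun s : Fin m × ℕ => p ^ s.2 * f s.1) :
    m * Real.log ‖deriv φ 0‖ ≤
      Real.exp 1 * Real.circleAverage (fun z => Real.posLog ‖P (φ z)‖) 0 1 := by
  rcases m.eq_zero_or_pos with rfl | hm
  · rw [Nat.cast_zero, zero_mul]
    exact mul_nonneg (Real.exp_pos 1).le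
      (Real.circleAverage_nonneg_of_nonneg fun z _ => Real.posLog_nonneg)
  obtain ⟨b₁, b₂, c₁, c₂, hb₂, hbound⟩ := exists_forall_mul_log_norm_deriv_le hm hφ hφ0 hφ' hx0 hx1
    hfint hpint hf hP hPt hPφ hli
  have hcont : ContinuousOn (fun z => Real.posLog ‖P (φ z)‖) (Metric.sphere 0 1) :=
    Real.continuous_posLog.comp_continuousOn
      (hPφ.continuousOn.norm.mono Metric.sphere_subset_closedBall)
  rw [← div_le_iff₀' (Real.exp_pos 1)]
  refine le_of_forall_pos_le_add fun ε hε => ?_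
  obtain ⟨q, hq, hq0⟩ := exists_polynomial_re_ge hcont hε
  rw [div_le_iff₀' (Real.exp_pos 1)]
  exact (mul_le_exp_one_mul_of_forall hm (Real.log_nonneg hφ') hb₂
    fun d A K D _ => hbound q hq d A K D).trans (by gcongr)

end HolonomyBound

section Expansion

variable {K : Type*} [Field K]

/-- The power series at `0` of a rational function without pole at `0`. -/
noncomputable def expansion (p : K⟮X⟯) : K⟦X⟧ := (p.num : K⟦X⟧) * (p.denom : K⟦X⟧)⁻¹

lemma expansion_mul_denom {p : K⟮X⟯} (hp : p.denom.coeff 0 ≠ 0) :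
    expansion p * (p.denom : K⟦X⟧) = (p.num : K⟦X⟧) := by
  rw [expansion, mul_assoc, PowerSeries.inv_mul_cancel _ (by simpa using hp), mul_one]

lemma algebraMap_eq_expansion {p : K⟮X⟯} (hp : p.denom.coeff 0 ≠ 0) :
    algebraMap K⟮X⟯ K⸨X⸩ p = (expansion p : K⸨X⸩) := by
  have hdenom : ((p.denom : K⟮X⟯) : K⸨X⸩) ≠ 0 := by simpa using p.denom_ne_zero
  refine mul_left_cancel₀ hdenom ?_
  rw [← map_mul, denom_mul_self, ← RatFunc.coe_coe, ← RatFunc.coe_coe, ← PowerSeries.coe_mul,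
    mul_comm, expansion_mul_denom hp]

lemma expansion_subst {p : K⟮X⟯} (hp : p.denom.coeff 0 ≠ 0) {x : K⟦X⟧}
    (hx : PowerSeries.constantCoeff x = 0) :
    (expansion p).subst x = aeval x p.num * (aeval x p.denom)⁻¹ := by
  have hsubst := PowerSeries.HasSubst.of_constantCoeff_zero' hx
  have hmul := congrArg (PowerSeries.subst x : K⟦X⟧ → K⟦X⟧) (expansion_mul_denom hp)
  rw [PowerSeries.subst_mul hsubst, PowerSeries.subst_coe hsubst, PowerSeries.subst_coe hsubst]
    at hmul
  have hdenom : PowerSeries.constantCoeff (aeval x p.denom) ≠ 0 := by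
    rw [aeval_def, hom_eval₂, hx, eval₂_at_zero]
    simpa using hp
  rw [← hmul, mul_assoc, PowerSeries.mul_inv_cancel _ hdenom, mul_one]

end Expansion

universe u in
lemma taylor_ratFunc_eval_zero {K 𝕜 : Type u} [Field K] [NontriviallyNormedField 𝕜]
    [CompleteSpace 𝕜] [CharZero 𝕜] (σ : K →+* 𝕜) {p : K⟮X⟯} (hp : p.denom.coeff 0 ≠ 0) :
    taylor (fun z => p.eval σ z) 0 = (expansion p).map σ := by
  refine HahnSeries.ofPowerSeries_injective (Γ := ℤ) ?_
  rw [← laurent_eq_taylor (analyticAt_ratFunc_eval σ (by simpa using hp)),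
    laurent_ratFunc_eval_zero, algebraMap_eq_expansion hp, laurentMap_coe]

section Field

lemma linearIndependent_pow_of_transcendental {K A : Type*} [Field K] [CommRing A] [Algebra K A]
    {a : A} (ha : Transcendental K a) : LinearIndependent K fun n : ℕ => a ^ n := by
  have h := (basisMonomials K).linearIndependent.map' (aeval a).toLinearMap
    (LinearMap.ker_eq_bot.mpr (transcendental_iff_injective.mp ha))
  simpa [Function.comp_def] using h

lemma finite_span_of_card_le {K V : Type*} [Field K] [AddCommGroup V] [Module K V] {s : Set V}
    {b : ℝ} (h : ∀ (m : ℕ) (v : Fin m → V), (∀ i, v i ∈ s) → LinearIndependent K v → (m : ℝ) ≤ b) :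
    Module.Finite K (Submodule.span K s) ∧ (Module.finrank K (Submodule.span K s) : ℝ) ≤ b := by
  obtain ⟨t, hts, hspan, hli⟩ := exists_linearIndependent K s
  have hcard (u : Finset V) (hu : (u : Set V) ⊆ t) : (u.card : ℝ) ≤ b :=
    h u.card (fun i => u.equivFin.symm i) (fun i => hts (hu (u.equivFin.symm i).2))
      ((LinearIndepOn.mono (v := id) hli hu).comp u.equivFin.symm u.equivFin.symm.injective)
  have hfin : t.Finite := by
    by_contra hinf
    obtain ⟨u, hu, hub⟩ := Set.Infinite.exists_subset_card_eq hinf (⌊b⌋₊ + 1)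
    have hle := hcard u hu
    rw [hub, Nat.cast_succ] at hle
    exact (Nat.lt_floor_add_one b).not_ge hle
  have := hfin.fintype
  rw [← hspan, finrank_span_set_eq_card hli]
  exact ⟨Module.Finite.span_of_finite K hfin, hcard _ (by simp)⟩

lemma finite_and_finrank_le_of_le {K V : Type*} [Field K] [AddCommGroup V] [Module K V]
    {W W' : Submodule K V} (hWW' : W ≤ W') {b : ℝ}
    (h : Module.Finite K W' ∧ (Module.finrank K W' : ℝ) ≤ b) :
    Module.Finite K W ∧ (Module.finrank K W : ℝ) ≤ b := by
  obtain ⟨hfin, hle⟩ := h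
  exact ⟨Submodule.finiteDimensional_of_le hWW',
    (Nat.cast_le.mpr (Submodule.finrank_mono hWW')).trans hle⟩

end Field

section NonconstantRatFunc

variable {p : ℚ⟮X⟯}

/- Mathlib puts two algebra structures over `ℚ` on `ℚ⟮X⟯`; they agree, but not by unfolding. The
instance arguments below cover both. -/

lemma transcendental_of_notMem_range [i : Algebra ℚ ℚ⟮X⟯]
    (hp : p ∉ Set.range (algebraMap ℚ ℚ⟮X⟯)) : Transcendental ℚ p := by
  obtain rfl : i = RatFunc.instAlgebraOfPolynomial ℚ ℚ := Subsingleton.elim _ _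
  exact p.transcendental_of_ne_C fun ⟨c, hc⟩ => hp ⟨c, hc.symm⟩

lemma mem_adjoin_X_of_notMem_range [i : Algebra ℚ ℚ⟮X⟯]
    (hp : p ∉ Set.range (algebraMap ℚ ℚ⟮X⟯)) (r : ℚ⟮X⟯) :
    r ∈ Algebra.adjoin (IntermediateField.adjoin ℚ {p}) {(RatFunc.X : ℚ⟮X⟯)} := by
  obtain rfl : i = RatFunc.instAlgebraOfPolynomial ℚ ℚ := Subsingleton.elim _ _
  rw [← IntermediateField.adjoin_simple_toSubalgebra_of_isAlgebraic
    (p.isAlgebraic_adjoin_simple_X fun ⟨c, hc⟩ => hp ⟨c, hc.symm⟩),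
    RatFunc.IntermediateField.adjoin_X]
  trivial

lemma X_notMem_range_algebraMap [i : Algebra ℚ ℚ⟮X⟯] :
    (RatFunc.X : ℚ⟮X⟯) ∉ Set.range (algebraMap ℚ ℚ⟮X⟯) := by
  rintro ⟨c, hc⟩
  have hX : IsAlgebraic ℚ (RatFunc.X : ℚ⟮X⟯) := hc ▸ isAlgebraic_algebraMap c
  obtain rfl : i = RatFunc.instAlgebraOfPolynomial ℚ ℚ := Subsingleton.elim _ _
  exact RatFunc.transcendental_X hX

lemma linearIndependent_expansion_pow_mul (hp : p ∉ Set.range (algebraMap ℚ ℚ⟮X⟯))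
    (hp0 : p.denom.coeff 0 ≠ 0) {ι : Type*} {f : ι → ℚ⟦X⟧}
    (hf : LinearIndependent (Qp p) fun i => (f i : ℚ⸨X⸩)) :
    LinearIndependent ℚ fun s : ι × ℕ => expansion p ^ s.2 * f s.1 := by
  have hgen : Transcendental ℚ (IntermediateField.AdjoinSimple.gen ℚ p) := fun h =>
    transcendental_of_notMem_range hp (by simpa using h.algebraMap (A := ℚ⟮X⟯))
  have hsmul := (linearIndependent_smul (linearIndependent_pow_of_transcendental hgen) hf).comp
    Prod.swap Prod.swap_injective
  refine LinearIndependent.of_comp (HahnSeries.ofPowerSeries ℤ ℚ).toAddMonoidHom.toRatLinearMap ?_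
  refine Eq.subst (motive := fun v => LinearIndependent ℚ v) (funext fun s => Eq.symm ?_) hsmul
  change ((expansion p ^ s.2 * f s.1 : ℚ⟦X⟧) : ℚ⸨X⸩) =
    algebraMap ℚ⟮X⟯ ℚ⸨X⸩ (p ^ s.2) * (f s.1 : ℚ⸨X⸩)
  rw [map_pow, algebraMap_eq_expansion hp0, PowerSeries.coe_mul, PowerSeries.coe_pow]

lemma algebraMap_mul_mem_of_X_mul_mem (hp : p ∉ Set.range (algebraMap ℚ ℚ⟮X⟯))
    {W : Submodule (Qp p) ℚ⸨X⸩} (hX : ∀ w ∈ W, algebraMap ℚ⟮X⟯ ℚ⸨X⸩ RatFunc.X * w ∈ W)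
    (r : ℚ⟮X⟯) {w : ℚ⸨X⸩} (hw : w ∈ W) : algebraMap ℚ⟮X⟯ ℚ⸨X⸩ r * w ∈ W := by
  have hr := mem_adjoin_X_of_notMem_range hp r
  induction hr using Algebra.adjoin_induction generalizing w with
  | mem y hy =>
    obtain rfl := hy
    exact hX w hw
  | algebraMap c => exact W.smul_mem c hw
  | add a b _ _ ha hb =>
    rw [map_add, add_mul]
    exact W.add_mem (ha hw) (hb hw)
  | mul a b _ _ ha hb =>
    rw [map_mul, mul_assoc]
    exact ha (hb hw)

end NonconstantRatFunc

section ContinuableSpan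

lemma continuesAlong_coe_polynomial {φ : ℂ → ℂ}
    (hφ : AnalyticOnNhd ℂ φ (Metric.closedBall 0 1)) (g : ℚ[X]) : ContinuesAlong φ (g : ℚ⟦X⟧) :=
  ⟨fun z => g.eval₂ (algebraMap ℚ ℂ) z, analyticAt_eval₂ _ g 0, taylor_eval₂_zero _ g, 1,
    one_ne_zero, fun z => g.eval₂ (algebraMap ℚ ℂ) (φ z),
    fun z hz => (analyticAt_eval₂ _ g (φ z)).comp (hφ z hz), by simp⟩

lemma ContinuesAlong.mul {φ : ℂ → ℂ} {f g : ℚ⟦X⟧} (hf : ContinuesAlong φ f)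
    (hg : ContinuesAlong φ g) : ContinuesAlong φ (f * g) := by
  obtain ⟨F, hF, hFf, Q, hQ, M, hM, hMF⟩ := hf
  obtain ⟨G, hG, hGg, R, hR, N, hN, hNG⟩ := hg
  refine ⟨fun z => F z * G z, hF.fun_mul hG, by rw [taylor_mul hF hG, hFf, hGg, map_mul], Q * R,
    mul_ne_zero hQ hR, fun z => M z * N z, fun z hz => (hM z hz).fun_mul (hN z hz), ?_⟩
  filter_upwards [hMF, hNG] with z hMz hNz
  rw [hMz, hNz, eval_mul]
  ring

/-- The series `f` with `f(x(t))` integral that continue meromorphically along `φ`. -/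
def integralContinuable (x : ℚ⟦X⟧) (φ : ℂ → ℂ) : Set ℚ⟦X⟧ :=
  {f | IsIntegralSeries (f.subst x) ∧ ContinuesAlong φ f}

/-- The `ℚ(p)`-span of `integralContinuable x φ` in `ℚ((x))`. -/
noncomputable def continuableSpan (p : ℚ⟮X⟯) (x : ℚ⟦X⟧) (φ : ℂ → ℂ) : Submodule (Qp p) ℚ⸨X⸩ :=
  Submodule.span (Qp p) ((fun f : ℚ⟦X⟧ => (f : ℚ⸨X⸩)) '' integralContinuable x φ)

variable {p : ℚ⟮X⟯} {φ : ℂ → ℂ} {x : ℚ⟦X⟧} {U : Set ℂ}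

lemma H_subset_integralContinuable (hφ : AnalyticOnNhd ℂ φ (Metric.closedBall 0 1))
    (hφU : Set.MapsTo φ (Metric.closedBall 0 1) U) (hφ0 : φ 0 = 0) :
    H U x ⊆ integralContinuable x φ :=
  fun _ hf => ⟨hf.1, continuesAlong_of_mem_H hf hφ hφU hφ0⟩

lemma mul_mem_integralContinuable (hx : PowerSeries.constantCoeff x = 0) {f g : ℚ⟦X⟧}
    (hf : f ∈ integralContinuable x φ) (hg : g ∈ integralContinuable x φ) :
    f * g ∈ integralContinuable x φ := by
  refine ⟨?_, hf.2.mul hg.2⟩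
  rw [PowerSeries.subst_mul (PowerSeries.HasSubst.of_constantCoeff_zero' hx)]
  exact hf.1.mul hg.1

lemma smul_X_mem_integralContinuable (hφ : AnalyticOnNhd ℂ φ (Metric.closedBall 0 1))
    (hx : PowerSeries.constantCoeff x = 0) {M : ℚ} (hM : IsIntegralSeries (M • x)) :
    M • PowerSeries.X ∈ integralContinuable x φ := by
  have hsubst := PowerSeries.HasSubst.of_constantCoeff_zero' hx
  refine ⟨by rwa [PowerSeries.subst_smul hsubst, PowerSeries.subst_X hsubst], ?_⟩
  rw [PowerSeries.smul_eq_C_mul, ← coe_C, ← coe_X, ← coe_mul]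
  exact continuesAlong_coe_polynomial hφ _

lemma X_mul_mem_continuableSpan (hφ : AnalyticOnNhd ℂ φ (Metric.closedBall 0 1))
    (hx : PowerSeries.constantCoeff x = 0) {M : ℚ} (hM0 : M ≠ 0) (hM : IsIntegralSeries (M • x))
    {w : ℚ⸨X⸩} (hw : w ∈ continuableSpan p x φ) :
    algebraMap ℚ⟮X⟯ ℚ⸨X⸩ RatFunc.X * w ∈ continuableSpan p x φ := by
  induction hw using Submodule.span_induction with
  | mem y hy =>
    obtain ⟨f, hf, rfl⟩ := hy
    have hmem : ((M • PowerSeries.X * f : ℚ⟦X⟧) : ℚ⸨X⸩) ∈ continuableSpan p x φ :=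
      Submodule.subset_span ⟨_, mul_mem_integralContinuable hx
        (smul_X_mem_integralContinuable hφ hx hM) hf, rfl⟩
    convert Submodule.smul_mem _ (algebraMap ℚ (Qp p) M⁻¹) hmem using 1
    change _ = algebraMap ℚ⟮X⟯ ℚ⸨X⸩ (algebraMap ℚ ℚ⟮X⟯ M⁻¹) * _
    have hC : algebraMap ℚ⟮X⟯ ℚ⸨X⸩ (algebraMap ℚ ℚ⟮X⟯ M⁻¹) =
        ((PowerSeries.C M⁻¹ : ℚ⟦X⟧) : ℚ⸨X⸩) := by
      simp
    rw [hC, RatFunc.coe_X, ← PowerSeries.coe_X, ← PowerSeries.coe_mul, ← PowerSeries.coe_mul,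
      PowerSeries.smul_eq_C_mul, ← mul_assoc, ← mul_assoc, ← map_mul, inv_mul_cancel₀ hM0,
      map_one, one_mul]
  | zero =>
    rw [mul_zero]
    exact Submodule.zero_mem _
  | add a b _ _ ha hb =>
    rw [mul_add]
    exact Submodule.add_mem _ ha hb
  | smul c a _ ha =>
    rw [mul_smul_comm]
    exact Submodule.smul_mem _ c ha

lemma finite_continuableSpan (hpc : p ∉ Set.range (algebraMap ℚ ℚ⟮X⟯))
    (hφ : AnalyticOnNhd ℂ φ (Metric.closedBall 0 1)) (hφ0 : φ 0 = 0) (hφ' : 1 < ‖deriv φ 0‖)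
    (hp : ∀ z ∈ Metric.closedBall (0 : ℂ) 1, aeval (φ z) p.denom ≠ 0)
    (hx0 : PowerSeries.constantCoeff x = 0) (hx1 : PowerSeries.coeff 1 x = 1)
    (hpint : IsIntegralSeries (pullback p x)) :
    Module.Finite (Qp p) (continuableSpan p x φ) ∧
      (Module.finrank (Qp p) (continuableSpan p x φ) : ℝ) ≤ holonomyBound p φ := by
  have hp0 : p.denom.coeff 0 ≠ 0 := by
    simpa [hφ0, ← coeff_zero_eq_aeval_zero'] using hp 0 (by simp)
  refine finite_span_of_card_le fun m v hv hli => ?_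
  choose f hf hfv using hv
  obtain rfl : (fun i => (f i : ℚ⸨X⸩)) = v := funext hfv
  rw [holonomyBound, le_div_iff₀ (Real.log_pos hφ')]
  exact mul_log_norm_deriv_le (P := fun z => p.eval (algebraMap ℚ ℂ) z) hφ hφ0 hφ'.le hx0 hx1
    (fun i => (hf i).1) (by rwa [expansion_subst hp0 hx0]) (fun i => (hf i).2)
    (analyticAt_ratFunc_eval _ (by simpa using hp0)) (taylor_ratFunc_eval_zero _ hp0)
    (fun z hz => (analyticAt_ratFunc_eval _ (hp z hz)).fun_comp (hφ z hz))
    (linearIndependent_expansion_pow_mul hpc hp0 hli)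

lemma Vp_le_continuableSpan (hφ : AnalyticOnNhd ℂ φ (Metric.closedBall 0 1))
    (hφU : Set.MapsTo φ (Metric.closedBall 0 1) U) (hφ0 : φ 0 = 0) :
    Vp p U x ≤ continuableSpan p x φ :=
  Submodule.span_mono (Set.image_mono (H_subset_integralContinuable hφ hφU hφ0))

/-- Multiplication by `x` preserves the `ℚ(p)`-span because `M • x(t)` is integral, and `ℚ(x)` is
generated by `x` as a ring over `ℚ(p)`. -/
lemma restrictScalars_V_le_continuableSpan (hpc : p ∉ Set.range (algebraMap ℚ ℚ⟮X⟯))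
    (hφ : AnalyticOnNhd ℂ φ (Metric.closedBall 0 1))
    (hφU : Set.MapsTo φ (Metric.closedBall 0 1) U) (hφ0 : φ 0 = 0)
    (hx : PowerSeries.constantCoeff x = 0) {M : ℚ} (hM0 : M ≠ 0) (hM : IsIntegralSeries (M • x)) :
    (V U x).restrictScalars (Qp p) ≤ continuableSpan p x φ := by
  intro v hv
  replace hv : v ∈ V U x := hv
  induction hv using Submodule.span_induction with
  | mem y hy =>
    exact Submodule.subset_span (Set.image_mono (H_subset_integralContinuable hφ hφU hφ0) hy)
  | zero => exact Submodule.zero_mem _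
  | add a b _ _ ha hb => exact Submodule.add_mem _ ha hb
  | smul c a _ ha =>
    exact algebraMap_mul_mem_of_X_mul_mem hpc
      (fun w hw => X_mul_mem_continuableSpan hφ hx hM0 hM hw) c ha

end ContinuableSpan

lemma exists_analyticOnNhd_of_one_lt_uniformizationRadius {U : Set ℂ}
    (h : 1 < uniformizationRadius U 0) :
    ∃ φ : ℂ → ℂ, AnalyticOnNhd ℂ φ (Metric.closedBall 0 1) ∧
      Set.MapsTo φ (Metric.closedBall 0 1) U ∧ φ 0 = 0 ∧ 1 < ‖deriv φ 0‖ := by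
  obtain ⟨R, ⟨F, -, hF, hF0, hF', hmaps, -⟩, hR⟩ := lt_sSup_iff.mp h
  obtain ⟨r, hr1, hrR⟩ := ENNReal.lt_iff_exists_nnreal_btwn.mp hR
  have hr : (1 : ℝ) < r := mod_cast hr1
  have hmem (z : ℂ) (hz : z ∈ Metric.closedBall (0 : ℂ) 1) :
      (r : ℂ) * z ∈ Metric.eball (0 : ℂ) R := by
    refine lt_of_le_of_lt ?_ hrR
    rw [edist_zero_right, ← ofReal_norm, norm_mul, ENNReal.ofReal_le_iff_le_toReal (by simp)]
    have hz' : ‖z‖ ≤ 1 := by simpa using hz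
    simpa using mul_le_of_le_one_right r.2 hz'
  refine ⟨fun z => F (r * z), fun z hz => ?_, fun z hz => ?_, by simpa using hF0, ?_⟩
  · exact (hF.analyticOnNhd Metric.isOpen_eball _ (hmem z hz)).fun_comp
      (analyticAt_const.fun_mul analyticAt_id)
  · exact connectedComponentIn_subset _ _ (hmaps (hmem z hz))
  · rw [deriv_comp_mul_left]
    simpa [hF'] using hr

lemma finite_V_of_one_lt_uniformizationRadius {U : Set ℂ} (h : 1 < uniformizationRadius U 0) :
    Module.Finite ℚ⟮X⟯ (V U PowerSeries.X) := by
  obtain ⟨φ, hφ, hφU, hφ0, hφ'⟩ := exists_analyticOnNhd_of_one_lt_uniformizationRadius h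
  have hspan : Module.Finite (Qp RatFunc.X) (continuableSpan RatFunc.X PowerSeries.X φ) ∧ _ :=
    finite_continuableSpan X_notMem_range_algebraMap hφ hφ0 hφ' (by simp) (by simp) (by simp)
      (by simpa [pullback] using isIntegralSeries_X)
  have hfin : Module.Finite (Qp RatFunc.X) (V U PowerSeries.X) :=
    (finite_and_finrank_le_of_le (restrictScalars_V_le_continuableSpan X_notMem_range_algebraMap
      hφ hφU hφ0 (by simp) one_ne_zero (by simpa using isIntegralSeries_X)) hspan).1
  exact Module.Finite.of_restrictScalars_finite (Qp RatFunc.X) ℚ⟮X⟯ (V U PowerSeries.X)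

end Holonomy

theorem corollary2p3_general (U : Set ℂ) :
    (1 < Holonomy.uniformizationRadius U 0 →
      Module.Finite (RatFunc ℚ) (Holonomy.V U PowerSeries.X)) ∧
    ∀ (p : RatFunc ℚ) (φ : ℂ → ℂ) (x : PowerSeries ℚ),
      p ∉ Set.range (algebraMap ℚ (RatFunc ℚ)) →
      (∀ α ∈ U, Polynomial.aeval α p.denom ≠ 0) →
      AnalyticOnNhd ℂ φ (Metric.closedBall 0 1) →
      Set.MapsTo φ (Metric.closedBall 0 1) U →
      φ 0 = 0 →
      1 < ‖deriv φ 0‖ →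
      PowerSeries.coeff 0 x = 0 →
      PowerSeries.coeff 1 x = 1 →
      Holonomy.IsIntegralSeries (Holonomy.pullback p x) →
      (Module.Finite (Holonomy.Qp p) (Holonomy.Vp p U x) ∧
        (Module.finrank (Holonomy.Qp p) (Holonomy.Vp p U x) : ℝ) ≤ Holonomy.holonomyBound p φ) ∧
      ((∃ M : ℚ, M ≠ 0 ∧ Holonomy.IsIntegralSeries (M • x)) →
        Module.Finite (Holonomy.Qp p) (Holonomy.V U x) ∧
        (Module.finrank (Holonomy.Qp p) (Holonomy.V U x) : ℝ) ≤ Holonomy.holonomyBound p φ) := by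
  refine ⟨Holonomy.finite_V_of_one_lt_uniformizationRadius,
    fun p φ x hpc hp hφ hφU hφ0 hφ' hx0 hx1 hpint => ?_⟩
  rw [PowerSeries.coeff_zero_eq_constantCoeff_apply] at hx0
  have hspan := Holonomy.finite_continuableSpan hpc hφ hφ0 hφ' (fun z hz => hp _ (hφU hz)) hx0 hx1
    hpint
  refine ⟨Holonomy.finite_and_finrank_le_of_le (Holonomy.Vp_le_continuableSpan hφ hφU hφ0) hspan,
    ?_⟩
  rintro ⟨M, hM0, hM⟩
  exact Holonomy.finite_and_finrank_le_of_le
    (Holonomy.restrictScalars_V_le_continuableSpan hpc hφ hφU hφ0 hx0 hM0 hM) hspan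

theorem corollary2p3 (U : Set ℂ) (hU : IsOpen U) (h0 : (0 : ℂ) ∈ U) :
    (1 < Holonomy.uniformizationRadius U 0 →
      Module.Finite (RatFunc ℚ) (Holonomy.V U PowerSeries.X)) ∧
    ∀ (p : RatFunc ℚ) (φ : ℂ → ℂ) (x : PowerSeries ℚ),
      p ∉ Set.range (algebraMap ℚ (RatFunc ℚ)) →
      (∀ α ∈ U, Polynomial.aeval α p.denom ≠ 0) →
      AnalyticOnNhd ℂ φ (Metric.closedBall 0 1) →
      Set.MapsTo φ (Metric.closedBall 0 1) U →
      φ 0 = 0 →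
      1 < ‖deriv φ 0‖ →
      PowerSeries.coeff 0 x = 0 →
      PowerSeries.coeff 1 x = 1 →
      Holonomy.IsIntegralSeries (Holonomy.pullback p x) →
      (Module.Finite (Holonomy.Qp p) (Holonomy.Vp p U x) ∧
        (Module.finrank (Holonomy.Qp p) (Holonomy.Vp p U x) : ℝ) ≤ Holonomy.holonomyBound p φ) ∧
      ((∃ M : ℚ, M ≠ 0 ∧ Holonomy.IsIntegralSeries (M • x)) →
        Module.Finite (Holonomy.Qp p) (Holonomy.V U x) ∧
        (Module.finrank (Holonomy.Qp p) (Holonomy.V U x) : ℝ) ≤ Holonomy.holonomyBound p φ) := by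
  exact corollary2p3_general U
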